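/- **Conventions.** $[Y]$ denotes the norm-closed linear span of $Y$, and products of sets of operators are elementwise. A *$C^*$-base* $(\mathfrak B,\mathfrak H,\mathfrak B^\dagger)$ is a complex Hilbert space $\mathfrak H$ with two commuting nondegenerate $C^*$-algebras $\mathfrak B,\mathfrak B^\dagger\subseteq\mathcal L(\mathfrak H)$; its opposite is $(\mathfrak B^\dagger,\mathfrak H,\mathfrak B)$. A *$C^*$-factorization* of a Hilbert space $H$ with respect to it is a closed subspace $\alpha\subseteq\mathcal L(\mathfrak H,H)$ with $[\alpha^*\alpha]=\mathfrak B$, $[\alpha\mathfrak B]=\alpha$, $[\alpha\mathfrak H]=H$; then $\rho_\alpha:\mathfrak B^\dagger\to\mathcal L(H)$ is given by $\rho_\alpha(b^\dagger)\xi\zeta=\xi b^\dagger\zeta$ for $\xi\in\alpha$, $\zeta\in\mathfrak H$. Two factorizations $\alpha,\beta$ of $H$ (with respect to bases with second algebras $\mathfrak B^\dagger$, $\mathfrak C^\dagger$) are *compatible* if $[\rho_\alpha(\mathfrak B^\dagger)\beta]=\beta$ and $[\rho_\beta(\mathfrak C^\dagger)\alpha]=\alpha$. If $\alpha$ is a factorization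 of $H$ with respect to a base and $\beta$ one of $K$ with respect to the opposite base, $H\,{}_\alpha\!\otimes_\beta K$ is the Hilbert space generated by elements $\xi\otimes\zeta\otimes\eta$ ($\xi\in\alpha,\zeta\in\mathfrak H,\eta\in\beta$) with $\langle\xi\otimes\zeta\otimes\eta|\xi'\otimes\zeta'\otimes\eta'\rangle=\langle\zeta|\xi^*\xi'\eta^*\eta'\zeta'\rangle$ (separation and completion of the algebraic tensor product). Put $|\xi\rangle_1\colon K\to H\,{}_\alpha\!\otimes_\beta K$, $\eta\zeta\mapsto\xi\otimes\zeta\otimes\eta$, and $|\eta\rangle_2\colon H\to H\,{}_\alpha\!\otimes_\beta K$, $\xi\zeta\mapsto\xi\otimes\zeta\otimes\eta$, with adjoints $\langle\xi|_1$, $\langle\eta|_2$; $|\alpha\rangle_1=\{|\xi\rangle_1:\xi\in\alpha\}$, etc.; $\gamma\triangleleft\beta=[|\beta\rangle_2\gamma]$ and $\alpha\triangleright\delta=[|\alpha\rangle_1\delta]$; $\Sigma(\xi\otimes\zeta\otimes\eta)=\eta\otimes\zeta\otimes\xi$; and $(S\otimes T)(\xi\otimes\zeta\otimes\eta)=S\xi\otimes\zeta\otimes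 T\eta$ for isometries $S,T$ carrying the factorizations of the domain into those of the codomain. **Pseudo-multiplicative unitaries.** Let $\alpha$ be a factorization of $H$ with respect to a base and $\beta,\hat\beta$ factorizations of $H$ with respect to the opposite base, pairwise compatible. A unitary $V\colon H\,{}_{\hat\beta}\!\otimes_\alpha H\to H\,{}_\alpha\!\otimes_\beta H$ is a *$C^*$-pseudo-multiplicative unitary* if $V(\alpha\triangleleft\alpha)=\alpha\triangleright\alpha$, $V(\hat\beta\triangleright\beta)=\hat\beta\triangleleft\beta$, $V(\hat\beta\triangleright\hat\beta)=\alpha\triangleright\hat\beta$, $V(\beta\triangleleft\alpha)=\beta\triangleleft\beta$, and the pentagon equation $V_{12}V_{13}V_{23}=V_{23}V_{12}$ holds as an equality of operators $H\,{}_{\hat\beta}\!\otimes_\alpha H\,{}_{\hat\beta}\!\otimes_\alpha H\to H\,{}_\alpha\!\otimes_\beta H\,{}_\alpha\!\otimes_\beta H$ (leg notation, with the canonical associativity isomorphisms). It is *regular* if $[\langle\alpha|_1V|\alpha\rangle_2]=[\alpha\alpha^*]$. Its legs are $$\hat A(V)=[\langle\beta|_2V|\alpha\rangle_2],\qquad A(V)=[\langle\alpha|_1V|\hat\beta\rangle_1]\qquad\text{in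 }\mathcal L(H).$$ **$C^*$-pseudo-Kac systems.** Fix a $C^*$-base $(\mathfrak B,\mathfrak H,\mathfrak B^\dagger)$ and a Hilbert space $H$. A *$C^*$-pseudo-Kac system* $(\alpha,\hat\alpha,\beta,\hat\beta,U,V)$ consists of $C^*$-factorizations $\alpha,\hat\alpha$ of $H$ with respect to $(\mathfrak B,\mathfrak H,\mathfrak B^\dagger)$ and $\beta,\hat\beta$ of $H$ with respect to $(\mathfrak B^\dagger,\mathfrak H,\mathfrak B)$, all pairwise compatible, a self-adjoint unitary $U\in\mathcal L(H)$ with $U\alpha=\hat\alpha$ and $U\beta=\hat\beta$, and a $C^*$-pseudo-multiplicative unitary $V\colon H\,{}_{\hat\beta}\!\otimes_\alpha H\to H\,{}_\alpha\!\otimes_\beta H$ such that $$\check V=\Sigma(1\otimes U)V(1\otimes U)\Sigma\colon H\,{}_{\hat\alpha}\!\otimes_{\hat\beta}H\to H\,{}_{\hat\beta}\!\otimes_{\alpha}H,\qquad \hat V=\Sigma(U\otimes1)V(U\otimes1)\Sigma\colon H\,{}_{\alpha}\!\otimes_{\beta}H\to H\,{}_{\beta}\!\otimes_{\hat\alpha}H$$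 are also $C^*$-pseudo-multiplicative unitaries (for the triples $(\hat\beta,\alpha,\hat\alpha)$ and $(\beta,\hat\alpha,\alpha)$ in place of $(\alpha,\beta,\hat\beta)$, and the opposite base), such that $V,\check V,\hat V$ are regular, and such that $(\Sigma(1\otimes U)V)^3=1$ in $\mathcal L(H\,{}_{\hat\beta}\!\otimes_\alpha H)$. **Proposition.** Let $(\alpha,\hat\alpha,\beta,\hat\beta,U,V)$ be a $C^*$-pseudo-Kac system. Then $$[A(V)\hat A(V)]=[\hat\alpha\hat\alpha^*].$$ -/

import Mathlib

open ContinuousLinearMap InnerProductSpace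

namespace RelTensor
section
variable {𝔥 H K : Type*}
  [NormedAddCommGroup 𝔥] [InnerProductSpace ℂ 𝔥] [CompleteSpace 𝔥]
  [NormedAddCommGroup H] [InnerProductSpace ℂ H] [CompleteSpace H]
  [NormedAddCommGroup K] [InnerProductSpace ℂ K] [CompleteSpace K]

theorem piLp_proj_adjoint {ι : Type*} [Fintype ι] [DecidableEq ι] (i : ι) (z : 𝔥) :
    adjoint (PiLp.proj 2 (fun _ : ι => 𝔥) i : PiLp 2 (fun _ : ι => 𝔥) →L[ℂ] 𝔥) z
      = PiLp.single 2 i z := by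
  refine ext_inner_right ℂ fun w => ?_
  rw [adjoint_inner_left, PiLp.inner_apply, Finset.sum_eq_single i]
  · simp [PiLp.proj_apply]
  · intro j _ hj; simp [hj]
  · simp

theorem piLp_proj_comp_adjoint {ι : Type*} [Fintype ι] [DecidableEq ι] (i j : ι) :
    (PiLp.proj 2 (fun _ : ι => 𝔥) i : PiLp 2 (fun _ : ι => 𝔥) →L[ℂ] 𝔥) ∘L
      adjoint (PiLp.proj 2 (fun _ : ι => 𝔥) j) = if i = j then 1 else 0 := by
  ext z
  rw [comp_apply, piLp_proj_adjoint, PiLp.proj_apply]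
  by_cases h : i = j
  · subst h; simp
  · simp [h]

theorem piLp_sum_adjoint_proj {ι : Type*} [Fintype ι] :
    ∑ i, adjoint (PiLp.proj 2 (fun _ : ι => 𝔥) i : PiLp 2 (fun _ : ι => 𝔥) →L[ℂ] 𝔥) ∘L
      PiLp.proj 2 (fun _ : ι => 𝔥) i = 1 := by
  classical
  refine ContinuousLinearMap.ext fun w => ext_inner_right ℂ fun v => ?_
  simp only [_root_.sum_apply, sum_inner, comp_apply, adjoint_inner_left, PiLp.inner_apply,
    PiLp.proj_apply]
  rfl

theorem gram_sqrt_aux {ι E : Type*} [Fintype ι] [DecidableEq ι]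
    [NormedAddCommGroup E] [InnerProductSpace ℂ E] [CompleteSpace E] (P : ι → E →L[ℂ] 𝔥)
    (hPP : ∀ i j, P i ∘L adjoint (P j) = if i = j then 1 else 0)
    (hsum : ∑ i, adjoint (P i) ∘L P i = 1) (η : ι → 𝔥 →L[ℂ] K) :
    ∃ D : ι → ι → 𝔥 →L[ℂ] 𝔥,
      (∀ i j, adjoint (D i j) = D j i) ∧
      (∀ i j, adjoint (η i) ∘L η j = ∑ k, D i k ∘L D k j) ∧
      ∀ T : 𝔥 →L[ℂ] 𝔥, (∀ i j, Commute T (adjoint (η i) ∘L η j)) → ∀ i j, Commute T (D i j) := by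
  let Y : E →L[ℂ] K := ∑ i, η i ∘L P i
  have hY : ∀ j, Y ∘L adjoint (P j) = η j := by
    intro j
    simp only [Y, ContinuousLinearMap.finsetSum_comp, comp_assoc, hPP]
    rw [Finset.sum_eq_single j]
    · simp [ContinuousLinearMap.one_def]
    · intro b _ hb; simp [hb]
    · simp
  have hYY : 0 ≤ adjoint Y ∘L Y := by
    rw [nonneg_iff_isPositive]; exact isPositive_adjoint_comp_self Y
  have hG : ∀ i j, adjoint (η i) ∘L η j = P i ∘L (adjoint Y ∘L Y) ∘L adjoint (P j) := by
    intro i j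
    rw [← hY i, ← hY j]
    simp [adjoint_comp, comp_assoc]
  clear_value Y
  obtain ⟨D, hD, hDsa, hDc⟩ : ∃ D : E →L[ℂ] E, D ∘L D = adjoint Y ∘L Y ∧ adjoint D = D ∧
      ∀ M : E →L[ℂ] E, Commute M (adjoint Y ∘L Y) → Commute M D :=
    ⟨CFC.sqrt (adjoint Y ∘L Y), CFC.sqrt_mul_sqrt_self _ hYY,
      IsSelfAdjoint.of_nonneg (CFC.sqrt_nonneg (adjoint Y ∘L Y)),
      fun M hM => (hM.symm.cfcₙ_nnreal NNReal.sqrt).symm⟩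
  refine ⟨fun i j => P i ∘L D ∘L adjoint (P j), ?_, ?_, ?_⟩
  · intro i j
    simp [adjoint_comp, comp_assoc, hDsa]
  · intro i j
    rw [hG, ← hD]
    calc _ = P i ∘L D ∘L (1 : E →L[ℂ] E) ∘L D ∘L adjoint (P j) := by
            simp [ContinuousLinearMap.one_def, comp_assoc]
      _ = _ := by
        rw [← hsum]
        simp only [ContinuousLinearMap.finsetSum_comp, ContinuousLinearMap.comp_finsetSum,
          comp_assoc]
  · intro T hT i j
    let M : E →L[ℂ] E := ∑ i, adjoint (P i) ∘L T ∘L P i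
    have h1 : ∀ i, P i ∘L M = T ∘L P i := by
      intro i
      simp only [M, ContinuousLinearMap.comp_finsetSum, ← comp_assoc, hPP]
      rw [Finset.sum_eq_single i]
      · simp [ContinuousLinearMap.one_def]
      · intro b _ hb; simp [hb.symm]
      · simp
    have h2 : ∀ i, M ∘L adjoint (P i) = adjoint (P i) ∘L T := by
      intro i
      simp only [M, ContinuousLinearMap.finsetSum_comp, comp_assoc, hPP]
      rw [Finset.sum_eq_single i]
      · simp [ContinuousLinearMap.one_def]
      · intro b _ hb; simp [hb]
      · simp
    clear_value M
    have hYYs : adjoint Y ∘L Y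
        = ∑ i, ∑ j, adjoint (P i) ∘L (adjoint (η i) ∘L η j) ∘L P j := by
      calc _ = (1 : E →L[ℂ] E) ∘L (adjoint Y ∘L Y) ∘L (1 : E →L[ℂ] E) := by
            simp [ContinuousLinearMap.one_def]
        _ = _ := by
          conv_lhs => rw [← hsum]
          simp only [ContinuousLinearMap.finsetSum_comp, ContinuousLinearMap.comp_finsetSum, hG,
            comp_assoc]
          exact Finset.sum_comm
    have hMD : M ∘L D = D ∘L M := by
      refine hDc M ?_
      rw [hYYs]
      refine Commute.sum_right _ _ _ fun i _ => Commute.sum_right _ _ _ fun j _ => ?_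
      have h : T ∘L (adjoint (η i) ∘L η j) = (adjoint (η i) ∘L η j) ∘L T := (hT i j).eq
      change M ∘L _ = _ ∘L M
      generalize adjoint (η i) ∘L η j = G at h
      rw [← comp_assoc, h2, comp_assoc, ← comp_assoc T, h, comp_assoc, comp_assoc, comp_assoc, h1]
    change T ∘L _ = _ ∘L T
    rw [← comp_assoc, ← h1, comp_assoc, ← comp_assoc M, hMD, comp_assoc, h2, comp_assoc, comp_assoc]

/-- A Gram matrix of operators has a self-adjoint square root whose entries commute with
everything that commutes with the entries of the Gram matrix. -/
theorem exists_gram_sqrt {ι : Type*} [Fintype ι] (η : ι → 𝔥 →L[ℂ] K) :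
    ∃ D : ι → ι → 𝔥 →L[ℂ] 𝔥,
      (∀ i j, adjoint (D i j) = D j i) ∧
      (∀ i j, adjoint (η i) ∘L η j = ∑ k, D i k ∘L D k j) ∧
      ∀ T : 𝔥 →L[ℂ] 𝔥, (∀ i j, Commute T (adjoint (η i) ∘L η j)) → ∀ i j, Commute T (D i j) := by
  classical
  exact gram_sqrt_aux (fun i => PiLp.proj 2 (fun _ : ι => 𝔥) i) piLp_proj_comp_adjoint
    piLp_sum_adjoint_proj η

/-- `ξ* ξ'` and `η* η'` commute for all `ξ, ξ' ∈ α` and `η, η' ∈ β`. -/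
def GramCommute (α : Submodule ℂ (𝔥 →L[ℂ] H)) (β : Submodule ℂ (𝔥 →L[ℂ] K)) : Prop :=
  ∀ ξ ∈ α, ∀ ξ' ∈ α, ∀ η ∈ β, ∀ η' ∈ β, Commute (adjoint ξ ∘L ξ') (adjoint η ∘L η')

theorem commute_apply {S T : 𝔥 →L[ℂ] 𝔥} (h : Commute S T) (x : 𝔥) : S (T x) = T (S x) :=
  DFunLike.congr_fun h.eq x

theorem gram_sum_eq {ι : Type*} [Fintype ι] (ξ : ι → 𝔥 →L[ℂ] H) (η : ι → 𝔥 →L[ℂ] K)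
    (hc : ∀ i j k l, Commute (adjoint (ξ i) ∘L ξ j) (adjoint (η k) ∘L η l)) (ζ : ι → 𝔥) :
    ∃ v : ι → H, ∑ i, ∑ j, ⟪ζ i, adjoint (ξ i) (ξ j (adjoint (η i) (η j (ζ j))))⟫_ℂ
      = ∑ k, ⟪v k, v k⟫_ℂ := by
  obtain ⟨D, hDa, hD, hDc⟩ := exists_gram_sqrt η
  refine ⟨fun k => ∑ j, ξ j (D k j (ζ j)), ?_⟩
  have key : ∀ i j, ⟪ζ i, adjoint (ξ i) (ξ j (adjoint (η i) (η j (ζ j))))⟫_ℂ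
      = ∑ k, ⟪ξ i (D k i (ζ i)), ξ j (D k j (ζ j))⟫_ℂ := by
    intro i j
    have h1 : adjoint (η i) (η j (ζ j)) = ∑ k, D i k (D k j (ζ j)) := by
      have := congrArg (fun T : 𝔥 →L[ℂ] 𝔥 => T (ζ j)) (hD i j)
      simpa [_root_.sum_apply] using this
    rw [h1]
    simp only [map_sum, inner_sum]
    refine Finset.sum_congr rfl fun k _ => ?_
    have h2 := commute_apply (hDc _ (fun k l => hc i j k l) i k) (D k j (ζ j))
    rw [comp_apply, comp_apply] at h2
    rw [h2, ← hDa k i, adjoint_inner_right, adjoint_inner_right]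
  simp only [key, sum_inner, inner_sum]
  rw [Finset.sum_congr rfl fun i _ => Finset.sum_comm, Finset.sum_comm]
  refine Finset.sum_congr rfl fun k _ => ?_
  exact Finset.sum_comm

open Classical in
/-- The kernel `⟨ζ, ξ* ξ' η* η' ζ'⟩` on triples `(ξ, ζ, η)`. For `C*`-factorizations `α`, `β` with
respect to opposite `C*`-bases the Gram operators commute; otherwise the value `0` is a default. -/
noncomputable def tensorKernel (α : Submodule ℂ (𝔥 →L[ℂ] H)) (β : Submodule ℂ (𝔥 →L[ℂ] K))
    (x y : α × 𝔥 × β) : ℂ :=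
  if GramCommute α β then
    ⟪x.2.1, adjoint x.1.1 (y.1.1 (adjoint x.2.2.1 (y.2.2.1 y.2.1)))⟫_ℂ
  else 0

/-- Formal finite sums of symbols `ξ ⊗ ζ ⊗ η`, with `ξ ∈ α`, `ζ ∈ 𝔥`, `η ∈ β`. -/
def PreTensor (α : Submodule ℂ (𝔥 →L[ℂ] H)) (β : Submodule ℂ (𝔥 →L[ℂ] K)) : Type _ :=
  (α × 𝔥 × β) →₀ ℂ

noncomputable instance (α : Submodule ℂ (𝔥 →L[ℂ] H)) (β : Submodule ℂ (𝔥 →L[ℂ] K)) :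
    AddCommGroup (PreTensor α β) := inferInstanceAs (AddCommGroup ((α × 𝔥 × β) →₀ ℂ))

noncomputable instance (α : Submodule ℂ (𝔥 →L[ℂ] H)) (β : Submodule ℂ (𝔥 →L[ℂ] K)) :
    Module ℂ (PreTensor α β) := inferInstanceAs (Module ℂ ((α × 𝔥 × β) →₀ ℂ))

/-- The kernel is Hermitian. -/
theorem tensorKernel_conj (α : Submodule ℂ (𝔥 →L[ℂ] H)) (β : Submodule ℂ (𝔥 →L[ℂ] K))
    (x y : α × 𝔥 × β) : star (tensorKernel α β y x) = tensorKernel α β x y := by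
  unfold tensorKernel
  split_ifs with h
  · have hc := commute_apply
      (h x.1.1 x.1.2 y.1.1 y.1.2 x.2.2.1 x.2.2.2 y.2.2.1 y.2.2.2) y.2.1
    simp only [comp_apply] at hc
    rw [hc]
    change (starRingEnd ℂ) _ = _
    rw [inner_conj_symm, adjoint_inner_right, ← adjoint_inner_left, adjoint_inner_right,
      adjoint_inner_left]
  · simp

/-- The kernel is positive semidefinite. -/
theorem tensorKernel_nonneg (α : Submodule ℂ (𝔥 →L[ℂ] H)) (β : Submodule ℂ (𝔥 →L[ℂ] K))
    (f : (α × 𝔥 × β) →₀ ℂ) :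
    0 ≤ (f.sum fun x a => f.sum fun y c => star a * c * tensorKernel α β x y).re := by
  unfold tensorKernel
  split_ifs with h
  · obtain ⟨v, hv⟩ := gram_sum_eq (fun i : f.support => i.1.1.1) (fun i : f.support => i.1.2.2.1)
      (fun i j k l => h _ i.1.1.2 _ j.1.1.2 _ k.1.2.2.2 _ l.1.2.2.2)
      (fun i => f i.1 • i.1.2.1)
    have : (f.sum fun x a => f.sum fun y c => star a * c *
        ⟪x.2.1, adjoint x.1.1 (y.1.1 (adjoint x.2.2.1 (y.2.2.1 y.2.1)))⟫_ℂ)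
        = ∑ k, ⟪v k, v k⟫_ℂ := by
      rw [← hv]
      simp only [Finsupp.sum]
      rw [← Finset.sum_coe_sort]
      refine Finset.sum_congr rfl fun i _ => ?_
      rw [← Finset.sum_coe_sort]
      refine Finset.sum_congr rfl fun j _ => ?_
      simp only [map_smul, inner_smul_left, inner_smul_right]
      simp [mul_assoc, mul_left_comm]
    rw [this, Complex.re_sum]
    exact Finset.sum_nonneg fun k _ => inner_self_nonneg (𝕜 := ℂ)
  · simp

/-- The positive semidefinite sesquilinear form on formal sums given by the kernel. -/
@[reducible] noncomputable def finsuppCore (α : Submodule ℂ (𝔥 →L[ℂ] H))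
    (β : Submodule ℂ (𝔥 →L[ℂ] K)) : PreInnerProductSpace.Core ℂ ((α × 𝔥 × β) →₀ ℂ) where
  inner f g := f.sum fun x a => g.sum fun y c => star a * c * tensorKernel α β x y
  conj_inner_symm f g := by
    rw [Finsupp.sum_comm]
    simp only [map_finsuppSum]
    congr! 4 with x a
    funext y c
    rw [← tensorKernel_conj α β x y]
    simp [mul_comm]
  re_inner_nonneg f := tensorKernel_nonneg α β f
  add_left f g k := by
    rw [Finsupp.sum_add_index'] <;> simp [← Finsupp.sum_add, add_mul]
  smul_left f g r := by
    rw [Finsupp.sum_smul_index] <;> simp [Finsupp.mul_sum, ← mul_assoc]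

@[reducible] noncomputable def preTensorCore (α : Submodule ℂ (𝔥 →L[ℂ] H))
    (β : Submodule ℂ (𝔥 →L[ℂ] K)) : PreInnerProductSpace.Core ℂ (PreTensor α β) :=
  finsuppCore α β

noncomputable instance (α : Submodule ℂ (𝔥 →L[ℂ] H)) (β : Submodule ℂ (𝔥 →L[ℂ] K)) :
    SeminormedAddCommGroup (PreTensor α β) :=
  @InnerProductSpace.Core.toSeminormedAddCommGroup ℂ _ _ _ _ (preTensorCore α β)

noncomputable instance (α : Submodule ℂ (𝔥 →L[ℂ] H)) (β : Submodule ℂ (𝔥 →L[ℂ] K)) :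
    InnerProductSpace ℂ (PreTensor α β) :=
  InnerProductSpace.ofCore (preTensorCore α β)

/-- The relative tensor product `H_α ⊗_β K = α ⊗ 𝔥 ⊗ β`: the Hilbert space obtained by separation
and completion from the formal sums of symbols `ξ ⊗ ζ ⊗ η` with
`⟨ξ ⊗ ζ ⊗ η, ξ' ⊗ ζ' ⊗ η'⟩ = ⟨ζ, ξ* ξ' η* η' ζ'⟩`. -/
abbrev RTP (α : Submodule ℂ (𝔥 →L[ℂ] H)) (β : Submodule ℂ (𝔥 →L[ℂ] K)) : Type _ :=
  UniformSpace.Completion (PreTensor α β)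

/-- The elementary tensor `ξ ⊗ ζ ⊗ η`. -/
noncomputable def tmul (α : Submodule ℂ (𝔥 →L[ℂ] H)) (β : Submodule ℂ (𝔥 →L[ℂ] K))
    (ξ : α) (ζ : 𝔥) (η : β) : RTP α β :=
  ((show PreTensor α β from Finsupp.single (ξ, ζ, η) 1 : PreTensor α β) : RTP α β)

theorem inner_tmul (α : Submodule ℂ (𝔥 →L[ℂ] H)) (β : Submodule ℂ (𝔥 →L[ℂ] K))
    (h : GramCommute α β) (ξ ξ' : α) (ζ ζ' : 𝔥) (η η' : β) :
    ⟪tmul α β ξ ζ η, tmul α β ξ' ζ' η'⟫_ℂ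
      = ⟪ζ, adjoint ξ.1 (ξ'.1 (adjoint η.1 (η'.1 ζ')))⟫_ℂ := by
  rw [tmul, tmul, UniformSpace.Completion.inner_coe]
  change Finsupp.sum _ _ = _
  rw [Finsupp.sum_single_index (by simp), Finsupp.sum_single_index (by simp)]
  simp [tensorKernel, h]

end

section
variable {E F : Type*}
  [NormedAddCommGroup E] [InnerProductSpace ℂ E] [CompleteSpace E]
  [NormedAddCommGroup F] [InnerProductSpace ℂ F] [CompleteSpace F]

/-- The bounded operator `T` with `T (f i) = g i` for all `i`, for a total family `f`. -/
noncomputable def opOfValues {ι : Type*} (f : ι → E) (g : ι → F) : E →L[ℂ] F :=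
  (Finsupp.linearCombination ℂ g).extendOfNorm (Finsupp.linearCombination ℂ f)

theorem opOfValues_apply {ι : Type*} {f : ι → E} {g : ι → F}
    (hf : (Submodule.span ℂ (Set.range f)).topologicalClosure = ⊤)
    (C : ℝ) (hg : ∀ c : ι →₀ ℂ, ‖Finsupp.linearCombination ℂ g c‖
      ≤ C * ‖Finsupp.linearCombination ℂ f c‖) (i : ι) :
    opOfValues f g (f i) = g i := by
  have hd : DenseRange (Finsupp.linearCombination ℂ f) := by
    have : Set.range (Finsupp.linearCombination ℂ f) = (Submodule.span ℂ (Set.range f) : Set E) := by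
      rw [← Finsupp.range_linearCombination]; rfl
    rw [DenseRange, this]
    exact Submodule.dense_iff_topologicalClosure_eq_top.mpr hf
  have := LinearMap.extendOfNorm_eq (f := Finsupp.linearCombination ℂ g) hd ⟨C, hg⟩
    (Finsupp.single i 1)
  simpa [opOfValues] using this

theorem opOfValues_apply_of_inner {ι : Type*} {f : ι → E} {g : ι → F}
    (hf : (Submodule.span ℂ (Set.range f)).topologicalClosure = ⊤)
    (hg : ∀ i j, ⟪g i, g j⟫_ℂ = ⟪f i, f j⟫_ℂ) (i : ι) : opOfValues f g (f i) = g i := by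
  refine opOfValues_apply hf 1 (fun c => le_of_eq ?_) i
  rw [one_mul]
  have : ⟪Finsupp.linearCombination ℂ g c, Finsupp.linearCombination ℂ g c⟫_ℂ
      = ⟪Finsupp.linearCombination ℂ f c, Finsupp.linearCombination ℂ f c⟫_ℂ := by
    simp only [Finsupp.linearCombination_apply, Finsupp.sum_inner, Finsupp.inner_sum,
      inner_smul_left, inner_smul_right, hg]
  rw [@norm_eq_sqrt_re_inner ℂ, @norm_eq_sqrt_re_inner ℂ, this]
end

section
variable {E F G : Type*}
  [NormedAddCommGroup E] [InnerProductSpace ℂ E] [CompleteSpace E]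
  [NormedAddCommGroup F] [InnerProductSpace ℂ F] [CompleteSpace F]
  [NormedAddCommGroup G] [InnerProductSpace ℂ G] [CompleteSpace G]

/-- `[S]`: the norm-closed linear span of a set of operators. -/
noncomputable def cspan (S : Set (E →L[ℂ] F)) : Submodule ℂ (E →L[ℂ] F) :=
  (Submodule.span ℂ S).topologicalClosure

/-- `S T = {s t | s ∈ S, t ∈ T}`. -/
def opMul (S : Set (F →L[ℂ] G)) (T : Set (E →L[ℂ] F)) : Set (E →L[ℂ] G) :=
  Set.image2 (fun s t => s ∘L t) S T

/-- `S* = {s* | s ∈ S}`. -/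
noncomputable def opAdj (S : Set (E →L[ℂ] F)) : Set (F →L[ℂ] E) :=
  (fun s => adjoint s) '' S

/-- `V γ = δ`, for spaces of operators `γ` into `E` and `δ` into `F`. -/
def MapsOnto (V : E →L[ℂ] F) (γ : Submodule ℂ (G →L[ℂ] E)) (δ : Submodule ℂ (G →L[ℂ] F)) : Prop :=
  (fun x : G →L[ℂ] E => V ∘L x) '' (γ : Set (G →L[ℂ] E)) = (δ : Set (G →L[ℂ] F))

end

/-- A `C*`-base `(𝔅, 𝔥, 𝔅†)`: two commuting nondegenerate `C*`-algebras of operators on `𝔥`. -/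
structure CStarBase (𝔥 : Type*)
    [NormedAddCommGroup 𝔥] [InnerProductSpace ℂ 𝔥] [CompleteSpace 𝔥] where
  B : NonUnitalStarSubalgebra ℂ (𝔥 →L[ℂ] 𝔥)
  Bd : NonUnitalStarSubalgebra ℂ (𝔥 →L[ℂ] 𝔥)
  isClosed_B : IsClosed (B : Set (𝔥 →L[ℂ] 𝔥))
  isClosed_Bd : IsClosed (Bd : Set (𝔥 →L[ℂ] 𝔥))
  nondeg_B : (Submodule.span ℂ {v | ∃ b ∈ B, ∃ ζ : 𝔥, v = b ζ}).topologicalClosure = ⊤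
  nondeg_Bd : (Submodule.span ℂ {v | ∃ b ∈ Bd, ∃ ζ : 𝔥, v = b ζ}).topologicalClosure = ⊤
  commute : ∀ b ∈ B, ∀ c ∈ Bd, Commute b c

section
variable {𝔥 𝔨 H K L M : Type*}
  [NormedAddCommGroup 𝔥] [InnerProductSpace ℂ 𝔥] [CompleteSpace 𝔥]
  [NormedAddCommGroup 𝔨] [InnerProductSpace ℂ 𝔨] [CompleteSpace 𝔨]
  [NormedAddCommGroup H] [InnerProductSpace ℂ H] [CompleteSpace H]
  [NormedAddCommGroup K] [InnerProductSpace ℂ K] [CompleteSpace K]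
  [NormedAddCommGroup L] [InnerProductSpace ℂ L] [CompleteSpace L]
  [NormedAddCommGroup M] [InnerProductSpace ℂ M] [CompleteSpace M]

/-- The opposite `C*`-base `(𝔅†, 𝔥, 𝔅)`. -/
def CStarBase.op (b : CStarBase 𝔥) : CStarBase 𝔥 where
  B := b.Bd
  Bd := b.B
  isClosed_B := b.isClosed_Bd
  isClosed_Bd := b.isClosed_B
  nondeg_B := b.nondeg_Bd
  nondeg_Bd := b.nondeg_B
  commute x hx y hy := (b.commute y hy x hx).symm

/-- `α` is a `C*`-factorization of `H` with respect to the `C*`-base `b`: a closed subspace of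
`L(𝔥, H)` with `[α* α] = 𝔅`, `[α 𝔅] = α` and `[α 𝔥] = H`. -/
structure IsFactorization (b : CStarBase 𝔥) (α : Submodule ℂ (𝔥 →L[ℂ] H)) : Prop where
  isClosed : IsClosed (α : Set (𝔥 →L[ℂ] H))
  gram : (cspan (opMul (opAdj (α : Set (𝔥 →L[ℂ] H))) (α : Set (𝔥 →L[ℂ] H))) :
    Set (𝔥 →L[ℂ] 𝔥)) = b.B
  mul_B : cspan (opMul (α : Set (𝔥 →L[ℂ] H)) b.B) = α
  total : (Submodule.span ℂ {v | ∃ ξ ∈ α, ∃ ζ : 𝔥, v = ξ ζ}).topologicalClosure = ⊤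

/-- `ρ_α(T)`: the operator on `H` with `ρ_α(T) ξ ζ = ξ T ζ` for `ξ ∈ α`, `ζ ∈ 𝔥` (for `T ∈ 𝔅†`). -/
noncomputable def rho (α : Submodule ℂ (𝔥 →L[ℂ] H)) (T : 𝔥 →L[ℂ] 𝔥) : H →L[ℂ] H :=
  opOfValues (fun p : α × 𝔥 => p.1.1 p.2) (fun p => p.1.1 (T p.2))

/-- `α ⊥ β`: `[ρ_α(𝔅†) β] = β` and `[ρ_β(ℭ†) α] = α`. -/
def Compatible (b : CStarBase 𝔥) (c : CStarBase 𝔨) (α : Submodule ℂ (𝔥 →L[ℂ] H))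
    (β : Submodule ℂ (𝔨 →L[ℂ] H)) : Prop :=
  cspan (opMul (rho α '' (b.Bd : Set (𝔥 →L[ℂ] 𝔥))) (β : Set (𝔨 →L[ℂ] H))) = β ∧
  cspan (opMul (rho β '' (c.Bd : Set (𝔨 →L[ℂ] 𝔨))) (α : Set (𝔥 →L[ℂ] H))) = α

/-- `|ξ⟩₁ : K → H ⊗ K`, `η ζ ↦ ξ ⊗ ζ ⊗ η`. -/
noncomputable def ket1 (α : Submodule ℂ (𝔥 →L[ℂ] H)) (β : Submodule ℂ (𝔥 →L[ℂ] K)) (ξ : α) :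
    K →L[ℂ] RTP α β :=
  opOfValues (fun p : β × 𝔥 => p.1.1 p.2) (fun p => tmul α β ξ p.2 p.1)

/-- `|η⟩₂ : H → H ⊗ K`, `ξ ζ ↦ ξ ⊗ ζ ⊗ η`. -/
noncomputable def ket2 (α : Submodule ℂ (𝔥 →L[ℂ] H)) (β : Submodule ℂ (𝔥 →L[ℂ] K)) (η : β) :
    H →L[ℂ] RTP α β :=
  opOfValues (fun p : α × 𝔥 => p.1.1 p.2) (fun p => tmul α β p.1 p.2 η)

/-- `γ ◁ β = [|β⟩₂ γ]`, a space of operators into `H ⊗ K`, for `γ ⊆ L(𝔨, H)`. -/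
noncomputable def factL (α : Submodule ℂ (𝔥 →L[ℂ] H)) (β : Submodule ℂ (𝔥 →L[ℂ] K))
    (γ : Submodule ℂ (𝔨 →L[ℂ] H)) : Submodule ℂ (𝔨 →L[ℂ] RTP α β) :=
  cspan (opMul (Set.range (ket2 α β)) (γ : Set (𝔨 →L[ℂ] H)))

/-- `α ▷ δ = [|α⟩₁ δ]`, a space of operators into `H ⊗ K`, for `δ ⊆ L(𝔨, K)`. -/
noncomputable def factR (α : Submodule ℂ (𝔥 →L[ℂ] H)) (β : Submodule ℂ (𝔥 →L[ℂ] K))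
    (δ : Submodule ℂ (𝔨 →L[ℂ] K)) : Submodule ℂ (𝔨 →L[ℂ] RTP α β) :=
  cspan (opMul (Set.range (ket1 α β)) (δ : Set (𝔨 →L[ℂ] K)))

/-- The flip `Σ`, `ξ ⊗ ζ ⊗ η ↦ η ⊗ ζ ⊗ ξ`. -/
noncomputable def flipOp (α : Submodule ℂ (𝔥 →L[ℂ] H)) (β : Submodule ℂ (𝔥 →L[ℂ] K)) :
    RTP α β →L[ℂ] RTP β α :=
  opOfValues (fun p : α × 𝔥 × β => tmul α β p.1 p.2.1 p.2.2)
    (fun p => tmul β α p.2.2 p.2.1 p.1)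

/-- `S ⊗ T`, `ξ ⊗ ζ ⊗ η ↦ S ξ ⊗ ζ ⊗ T η`, for isometries with `S α ⊆ γ` and `T β ⊆ δ`. -/
noncomputable def tensorMap (α : Submodule ℂ (𝔥 →L[ℂ] H)) (β : Submodule ℂ (𝔥 →L[ℂ] K))
    (γ : Submodule ℂ (𝔥 →L[ℂ] L)) (δ : Submodule ℂ (𝔥 →L[ℂ] M))
    (S : H →L[ℂ] L) (T : K →L[ℂ] M) : RTP α β →L[ℂ] RTP γ δ :=
  opOfValues
    (fun p : {p : α × 𝔥 × β // S ∘L p.1.1 ∈ γ ∧ T ∘L p.2.2.1 ∈ δ} =>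
      tmul α β p.1.1 p.1.2.1 p.1.2.2)
    (fun p => tmul γ δ ⟨S ∘L p.1.1.1, p.2.1⟩ p.1.2.1 ⟨T ∘L p.1.2.2.1, p.2.2⟩)

/-- The associativity unitary
`(H_α ⊗_β K)_{α ▷ γ} ⊗_δ L → H_α ⊗_{β ◁ δ} (K_γ ⊗_δ L)`, `|η⟩₂ |ξ⟩₁ v ↦ |ξ⟩₁ |η⟩₂ v`. -/
noncomputable def assocOp (α : Submodule ℂ (𝔥 →L[ℂ] H)) (β : Submodule ℂ (𝔥 →L[ℂ] K))
    (γ : Submodule ℂ (𝔨 →L[ℂ] K)) (δ : Submodule ℂ (𝔨 →L[ℂ] L)) :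
    RTP (factR α β γ) δ →L[ℂ] RTP α (factL γ δ β) :=
  opOfValues
    (fun p : α × K × δ => ket2 (factR α β γ) δ p.2.2 (ket1 α β p.1 p.2.1))
    (fun p => ket1 α (factL γ δ β) p.1 (ket2 γ δ p.2.2 p.2.1))

/-- The unitary `Σ₂₃ : (H_α ⊗_β K)_{γ ◁ β} ⊗_δ L → (H_γ ⊗_δ L)_{α ◁ δ} ⊗_β K`,
`|η⟩₂ |ξ⟩₂ v ↦ |ξ⟩₂ |η⟩₂ v`. -/
noncomputable def flip23 (α : Submodule ℂ (𝔥 →L[ℂ] H)) (β : Submodule ℂ (𝔥 →L[ℂ] K))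
    (γ : Submodule ℂ (𝔨 →L[ℂ] H)) (δ : Submodule ℂ (𝔨 →L[ℂ] L)) :
    RTP (factL α β γ) δ →L[ℂ] RTP (factL γ δ α) β :=
  opOfValues
    (fun p : β × H × δ => ket2 (factL α β γ) δ p.2.2 (ket2 α β p.1 p.2.1))
    (fun p => ket2 (factL γ δ α) β p.1 (ket2 γ δ p.2.2 p.2.1))

/-! In what follows, `αh`, `βh` stand for `α̂`, `β̂`. -/

/-- `V₂₃ V₁₂`. -/
noncomputable def pentagonShort (α β βh : Submodule ℂ (𝔥 →L[ℂ] H)) (V : RTP βh α →L[ℂ] RTP α β) :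
    RTP (factR βh α βh) α →L[ℂ] RTP α (factL α β β) :=
  tensorMap α (factL βh α β) α (factL α β β) (.id ℂ H) V ∘L
  assocOp α β βh α ∘L
  tensorMap (factR βh α βh) α (factR α β βh) α V (.id ℂ H)

/-- `V₁₃`, the composite `H_β̂ ⊗ (H_α ⊗_β H) → H_β̂ ⊗ (H_β ⊗_α H) = (H_β̂ ⊗_α H) ⊗_α H
→ (H_α ⊗_β H)_{β̂ ◁ β} ⊗_α H → (H_β̂ ⊗_α H)_{α ◁ α} ⊗_β H` of
`1 ⊗ Σ`, `V ⊗ 1` and `Σ₂₃`. -/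
noncomputable def leg13 (α β βh : Submodule ℂ (𝔥 →L[ℂ] H)) (V : RTP βh α →L[ℂ] RTP α β) :
    RTP βh (factR α β α) →L[ℂ] RTP (factL βh α α) β :=
  flip23 α β βh α ∘L
  tensorMap (factR βh α β) α (factL α β βh) α V (.id ℂ H) ∘L
  adjoint (assocOp βh α β α) ∘L
  tensorMap βh (factR α β α) βh (factL β α α) (.id ℂ H) (flipOp α β)

/-- `V₁₂ V₁₃ V₂₃`. -/
noncomputable def pentagonLong (α β βh : Submodule ℂ (𝔥 →L[ℂ] H)) (V : RTP βh α →L[ℂ] RTP α β) :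
    RTP (factR βh α βh) α →L[ℂ] RTP α (factL α β β) :=
  assocOp α β α β ∘L
  tensorMap (factL βh α α) β (factR α β α) β V (.id ℂ H) ∘L
  leg13 α β βh V ∘L
  tensorMap βh (factL βh α α) βh (factR α β α) (.id ℂ H) V ∘L
  assocOp βh α βh α

/-- `V : H_β̂ ⊗_α H → H_α ⊗_β H` is a `C*`-pseudo-multiplicative unitary. -/
structure IsPseudoMultiplicativeUnitary (b : CStarBase 𝔥) (α β βh : Submodule ℂ (𝔥 →L[ℂ] H))
    (V : RTP βh α →L[ℂ] RTP α β) : Prop where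
  fact_α : IsFactorization b α
  fact_β : IsFactorization b.op β
  fact_βh : IsFactorization b.op βh
  compat_α_β : Compatible b b.op α β
  compat_α_βh : Compatible b b.op α βh
  compat_β_βh : Compatible b.op b.op β βh
  adjoint_comp : adjoint V ∘L V = .id ℂ (RTP βh α)
  comp_adjoint : V ∘L adjoint V = .id ℂ (RTP α β)
  map_α : MapsOnto V (factL βh α α) (factR α β α)
  map_β : MapsOnto V (factR βh α β) (factL α β βh)
  map_βh : MapsOnto V (factR βh α βh) (factR α β βh)
  map_β' : MapsOnto V (factL βh α β) (factL α β β)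
  pentagon : pentagonLong α β βh V = pentagonShort α β βh V

/-- `Â(V) = [⟨β|₂ V |α⟩₂]`. -/
noncomputable def legAhat (α β βh : Submodule ℂ (𝔥 →L[ℂ] H)) (V : RTP βh α →L[ℂ] RTP α β) :
    Submodule ℂ (H →L[ℂ] H) :=
  cspan {T | ∃ (η : β) (ξ : α), T = adjoint (ket2 α β η) ∘L V ∘L ket2 βh α ξ}

/-- `A(V) = [⟨α|₁ V |β̂⟩₁]`. -/
noncomputable def legA (α β βh : Submodule ℂ (𝔥 →L[ℂ] H)) (V : RTP βh α →L[ℂ] RTP α β) :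
    Submodule ℂ (H →L[ℂ] H) :=
  cspan {T | ∃ (ξ : α) (η : βh), T = adjoint (ket1 α β ξ) ∘L V ∘L ket1 βh α η}

/-- Regularity: `[⟨α|₁ V |α⟩₂] = [α α*]`. -/
def IsRegular (α β βh : Submodule ℂ (𝔥 →L[ℂ] H)) (V : RTP βh α →L[ℂ] RTP α β) : Prop :=
  cspan {T : H →L[ℂ] H | ∃ ξ ξ' : α, T = adjoint (ket1 α β ξ) ∘L V ∘L ket2 βh α ξ'} =
    cspan (opMul (α : Set (𝔥 →L[ℂ] H)) (opAdj (α : Set (𝔥 →L[ℂ] H))))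

/-- `V̌ = Σ (1 ⊗ U) V (1 ⊗ U) Σ : H_α̂ ⊗_β̂ H → H_β̂ ⊗_α H`. -/
noncomputable def checkOp (α αh β βh : Submodule ℂ (𝔥 →L[ℂ] H)) (U : H →L[ℂ] H)
    (V : RTP βh α →L[ℂ] RTP α β) : RTP αh βh →L[ℂ] RTP βh α :=
  flipOp α βh ∘L tensorMap α β α βh (.id ℂ H) U ∘L V ∘L
    tensorMap βh αh βh α (.id ℂ H) U ∘L flipOp αh βh

/-- `V̂ = Σ (U ⊗ 1) V (U ⊗ 1) Σ : H_α ⊗_β H → H_β ⊗_α̂ H`. -/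
noncomputable def hatOp (α αh β βh : Submodule ℂ (𝔥 →L[ℂ] H)) (U : H →L[ℂ] H)
    (V : RTP βh α →L[ℂ] RTP α β) : RTP α β →L[ℂ] RTP β αh :=
  flipOp αh β ∘L tensorMap α β αh β U (.id ℂ H) ∘L V ∘L
    tensorMap β α βh α U (.id ℂ H) ∘L flipOp α β

/-- `(α, α̂, β, β̂, U, V)` is a balanced `C*`-pseudo-multiplicative unitary. -/
structure IsBalanced (b : CStarBase 𝔥) (α αh β βh : Submodule ℂ (𝔥 →L[ℂ] H)) (U : H →L[ℂ] H)
    (V : RTP βh α →L[ℂ] RTP α β) : Prop where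
  fact_α : IsFactorization b α
  fact_αh : IsFactorization b αh
  fact_β : IsFactorization b.op β
  fact_βh : IsFactorization b.op βh
  symm_U : adjoint U = U
  sq_U : U ∘L U = .id ℂ H
  pmu : IsPseudoMultiplicativeUnitary b α β βh V
  compat_α_αh : Compatible b b α αh
  compat_α_β : Compatible b b.op α β
  compat_α_βh : Compatible b b.op α βh
  compat_αh_β : Compatible b b.op αh β
  compat_αh_βh : Compatible b b.op αh βh
  compat_β_βh : Compatible b.op b.op β βh
  map_U_α : MapsOnto U α αh
  map_U_β : MapsOnto U β βh
  pmu_check : IsPseudoMultiplicativeUnitary b.op βh α αh (checkOp α αh β βh U V)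
  pmu_hat : IsPseudoMultiplicativeUnitary b.op β αh α (hatOp α αh β βh U V)

/-- `(α, α̂, β, β̂, U, V)` is a `C*`-pseudo-Kac system. -/
structure IsPseudoKacSystem (b : CStarBase 𝔥) (α αh β βh : Submodule ℂ (𝔥 →L[ℂ] H))
    (U : H →L[ℂ] H) (V : RTP βh α →L[ℂ] RTP α β) : Prop where
  balanced : IsBalanced b α αh β βh U V
  regular : IsRegular α β βh V
  regular_check : IsRegular βh α αh (checkOp α αh β βh U V)
  regular_hat : IsRegular β αh α (hatOp α αh β βh U V)
  cube : (flipOp α βh ∘L tensorMap α β α βh (.id ℂ H) U ∘L V) ^ 3 = 1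

/-! The operators above are well defined and satisfy the formulas in their descriptions. -/

theorem subset_cspan (S : Set (H →L[ℂ] K)) : S ⊆ cspan S :=
  Submodule.subset_span.trans (Submodule.le_topologicalClosure _)

theorem total_tmul (α : Submodule ℂ (𝔥 →L[ℂ] H)) (β : Submodule ℂ (𝔥 →L[ℂ] K)) :
    (Submodule.span ℂ (Set.range fun p : α × 𝔥 × β =>
      tmul α β p.1 p.2.1 p.2.2)).topologicalClosure = ⊤ := by
  rw [← Submodule.dense_iff_topologicalClosure_eq_top]
  refine (UniformSpace.Completion.denseRange_coe (α := PreTensor α β)).mono ?_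
  rintro _ ⟨f, rfl⟩
  have : ∀ f : (α × 𝔥 × β) →₀ ℂ, ((show PreTensor α β from f : PreTensor α β) : RTP α β) ∈
      Submodule.span ℂ (Set.range fun p : α × 𝔥 × β => tmul α β p.1 p.2.1 p.2.2) := by
    intro f
    induction f using Finsupp.induction_linear with
    | zero => exact Submodule.zero_mem _
    | add f g hf hg =>
      have := Submodule.add_mem _ hf hg
      rwa [← UniformSpace.Completion.coe_add] at this
    | single x c =>
      have h1 : tmul α β x.1 x.2.1 x.2.2 ∈
        Submodule.span ℂ (Set.range fun p : α × 𝔥 × β => tmul α β p.1 p.2.1 p.2.2) :=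
        Submodule.subset_span ⟨x, rfl⟩
      have h2 := Submodule.smul_mem _ c h1
      rw [tmul, ← UniformSpace.Completion.coe_smul] at h2
      have h3 : (show PreTensor α β from Finsupp.single x c : PreTensor α β)
          = c • (show PreTensor α β from Finsupp.single x 1 : PreTensor α β) := by
        change Finsupp.single x c = c • Finsupp.single x (1 : ℂ)
        simp
      rw [h3]
      exact h2
  exact this f

/-- The vectors `ξ ζ`, with `ξ ∈ α` and `ζ ∈ 𝔥`, are total in `H`. -/
def IsTotal (α : Submodule ℂ (𝔥 →L[ℂ] H)) : Prop :=
  (Submodule.span ℂ (Set.range fun p : α × 𝔥 => p.1.1 p.2)).topologicalClosure = ⊤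

theorem IsFactorization.isTotal {b : CStarBase 𝔥} {α : Submodule ℂ (𝔥 →L[ℂ] H)}
    (h : IsFactorization b α) : IsTotal α := by
  rw [IsTotal, ← h.total]
  congr 2
  ext v
  constructor
  · rintro ⟨p, rfl⟩; exact ⟨p.1.1, p.1.2, p.2, rfl⟩
  · rintro ⟨ξ, hξ, ζ, rfl⟩; exact ⟨(⟨ξ, hξ⟩, ζ), rfl⟩

theorem GramCommute.symm {α : Submodule ℂ (𝔥 →L[ℂ] H)} {β : Submodule ℂ (𝔥 →L[ℂ] K)}
    (h : GramCommute α β) : GramCommute β α :=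
  fun η hη η' hη' ξ hξ ξ' hξ' => (h ξ hξ ξ' hξ' η hη η' hη').symm

theorem IsFactorization.gram_mem {b : CStarBase 𝔥} {α : Submodule ℂ (𝔥 →L[ℂ] H)}
    (h : IsFactorization b α) (ξ ξ' : α) : adjoint ξ.1 ∘L ξ'.1 ∈ b.B := by
  have : adjoint ξ.1 ∘L ξ'.1 ∈ (b.B : Set (𝔥 →L[ℂ] 𝔥)) := by
    rw [← h.gram]
    exact subset_cspan _ ⟨_, ⟨_, ξ.2, rfl⟩, _, ξ'.2, rfl⟩
  exact this

theorem IsFactorization.comp_mem {b : CStarBase 𝔥} {α : Submodule ℂ (𝔥 →L[ℂ] H)}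
    (h : IsFactorization b α) (ξ : α) {T : 𝔥 →L[ℂ] 𝔥} (hT : T ∈ b.B) : ξ.1 ∘L T ∈ α := by
  have : ξ.1 ∘L T ∈ cspan (opMul (α : Set (𝔥 →L[ℂ] H)) b.B) :=
    subset_cspan _ ⟨_, ξ.2, _, hT, rfl⟩
  rwa [h.mul_B] at this

theorem IsFactorization.gramCommute {b : CStarBase 𝔥} {α : Submodule ℂ (𝔥 →L[ℂ] H)}
    {β : Submodule ℂ (𝔥 →L[ℂ] K)} (hα : IsFactorization b α) (hβ : IsFactorization b.op β) :
    GramCommute α β := fun ξ hξ ξ' hξ' η hη η' hη' =>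
  b.commute _ (hα.gram_mem ⟨ξ, hξ⟩ ⟨ξ', hξ'⟩) _ (hβ.gram_mem ⟨η, hη⟩ ⟨η', hη'⟩)

theorem gram_sum_eq_inner (α : Submodule ℂ (𝔥 →L[ℂ] H)) (S : 𝔥 →L[ℂ] 𝔥)
    (hS : ∀ ξ ξ' : α, Commute (adjoint S) (adjoint ξ.1 ∘L ξ'.1)) (c : (α × 𝔥) →₀ ℂ) :
    ⟪c.sum fun p a => a • p.1.1 (S p.2), c.sum fun p a => a • p.1.1 (S p.2)⟫_ℂ =
      c.sum fun p a => c.sum fun q a' =>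
        star a * a' * ⟪p.2, adjoint p.1.1 (q.1.1 (adjoint S (S q.2)))⟫_ℂ := by
  rw [Finsupp.sum_comm]
  simp only [Finsupp.sum, sum_inner, inner_sum]
  refine Finset.sum_congr rfl fun q _ => Finset.sum_congr rfl fun p _ => ?_
  rw [inner_smul_left, inner_smul_right, mul_assoc]
  have h1 := commute_apply (hS p.1 q.1) (S q.2)
  simp only [comp_apply] at h1
  rw [← h1, adjoint_inner_right, adjoint_inner_right]
  rfl

theorem norm_sum_le (α : Submodule ℂ (𝔥 →L[ℂ] H)) (T : 𝔥 →L[ℂ] 𝔥)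
    (hT : ∀ ξ ξ' : α, Commute T (adjoint ξ.1 ∘L ξ'.1)) (c : (α × 𝔥) →₀ ℂ) :
    ‖c.sum fun p a => a • p.1.1 (T p.2)‖ ≤ ‖T‖ * ‖c.sum fun p a => a • p.1.1 p.2‖ := by
  have hTa : ∀ ξ ξ' : α, Commute (adjoint T) (adjoint ξ.1 ∘L ξ'.1) := by
    intro ξ ξ'
    have h := (hT ξ' ξ).star_star
    have h2 : star (adjoint ξ'.1 ∘L ξ.1) = adjoint ξ.1 ∘L ξ'.1 := by
      rw [star_eq_adjoint, adjoint_comp, adjoint_adjoint]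
    rw [h2] at h
    exact h
  let R : 𝔥 →L[ℂ] 𝔥 := algebraMap ℝ _ (‖T‖ ^ 2) - adjoint T ∘L T
  have hR : 0 ≤ R := by
    have : star T * T ≤ algebraMap ℝ _ (‖T‖ ^ 2) := by
      have := IsSelfAdjoint.le_algebraMap_norm_self (a := star T * T) (IsSelfAdjoint.star_mul_self T)
      rwa [CStarRing.norm_star_mul_self, ← sq] at this
    exact sub_nonneg.mpr this
  let S := CFC.sqrt R
  have hSS : adjoint S ∘L S = R := by
    have h1 : adjoint S = S := IsSelfAdjoint.of_nonneg (CFC.sqrt_nonneg R)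
    rw [h1]
    exact CFC.sqrt_mul_sqrt_self R hR
  have hSc : ∀ ξ ξ' : α, Commute (adjoint S) (adjoint ξ.1 ∘L ξ'.1) := by
    intro ξ ξ'
    have h1 : adjoint S = S := IsSelfAdjoint.of_nonneg (CFC.sqrt_nonneg R)
    rw [h1]
    have h2 : Commute R (adjoint ξ.1 ∘L ξ'.1) :=
      (Algebra.commute_algebraMap_left _ _).sub_left ((hTa ξ ξ').mul_left (hT ξ ξ'))
    exact h2.cfcₙ_nnreal NNReal.sqrt
  have e1 := gram_sum_eq_inner α S hSc c
  have e2 := gram_sum_eq_inner α T hTa c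
  have e3 := gram_sum_eq_inner α (.id ℂ 𝔥)
    (fun ξ ξ' => by
      have : adjoint (ContinuousLinearMap.id ℂ 𝔥) = 1 := star_one (𝔥 →L[ℂ] 𝔥)
      rw [this]; exact Commute.one_left _) c
  have e4 : ⟪c.sum fun p a => a • p.1.1 (S p.2), c.sum fun p a => a • p.1.1 (S p.2)⟫_ℂ
      = (‖T‖ ^ 2 : ℝ) * ⟪c.sum fun p a => a • p.1.1 p.2, c.sum fun p a => a • p.1.1 p.2⟫_ℂ
        - ⟪c.sum fun p a => a • p.1.1 (T p.2), c.sum fun p a => a • p.1.1 (T p.2)⟫_ℂ := by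
    have e3' : ⟪c.sum fun p a => a • p.1.1 p.2, c.sum fun p a => a • p.1.1 p.2⟫_ℂ
      = c.sum fun p a => c.sum fun q a' =>
        star a * a' * ⟪p.2, adjoint p.1.1 (q.1.1 q.2)⟫_ℂ := by
      have h1 : adjoint (ContinuousLinearMap.id ℂ 𝔥) = .id ℂ 𝔥 := star_one (𝔥 →L[ℂ] 𝔥)
      simpa [h1] using e3
    rw [e1, e2, e3']
    simp only [Finsupp.sum, Finset.mul_sum, ← Finset.sum_sub_distrib]
    refine Finset.sum_congr rfl fun p _ => Finset.sum_congr rfl fun q _ => ?_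
    have h1 : adjoint S (S q.2) = ((‖T‖ ^ 2 : ℝ) : ℂ) • q.2 - adjoint T (T q.2) := by
      have := DFunLike.congr_fun hSS q.2
      rw [comp_apply] at this
      rw [this]
      simp only [R, _root_.sub_apply, comp_apply]
      congr 1
    rw [h1]
    simp only [map_sub, map_smul, inner_sub_right, inner_smul_right]
    ring
  have e5 : 0 ≤ (⟪c.sum fun p a => a • p.1.1 (S p.2), c.sum fun p a => a • p.1.1 (S p.2)⟫_ℂ).re :=
    inner_self_nonneg (𝕜 := ℂ)
  rw [e4, Complex.sub_re, Complex.re_ofReal_mul] at e5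
  have n1 := inner_self_eq_norm_sq (𝕜 := ℂ) (c.sum fun p a => a • p.1.1 (T p.2))
  have n2 := inner_self_eq_norm_sq (𝕜 := ℂ) (c.sum fun p a => a • p.1.1 p.2)
  simp only [RCLike.re_eq_complex_re] at n1 n2
  rw [n1, n2, ← mul_pow, sub_nonneg] at e5
  exact le_of_sq_le_sq e5 (by positivity)

theorem rho_apply {α : Submodule ℂ (𝔥 →L[ℂ] H)} (hα : IsTotal α) {T : 𝔥 →L[ℂ] 𝔥}
    (hT : ∀ ξ ξ' : α, Commute T (adjoint ξ.1 ∘L ξ'.1)) (ξ : α) (ζ : 𝔥) :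
    rho α T (ξ.1 ζ) = ξ.1 (T ζ) :=
  opOfValues_apply hα ‖T‖ (fun c => by
    simp only [Finsupp.linearCombination_apply]
    exact norm_sum_le α T hT c) (ξ, ζ)

theorem flipOp_apply {α : Submodule ℂ (𝔥 →L[ℂ] H)} {β : Submodule ℂ (𝔥 →L[ℂ] K)}
    (hc : GramCommute α β) (ξ : α) (ζ : 𝔥) (η : β) :
    flipOp α β (tmul α β ξ ζ η) = tmul β α η ζ ξ :=
  opOfValues_apply_of_inner (total_tmul α β) (fun p q => by
    rw [inner_tmul _ _ hc, inner_tmul _ _ hc.symm]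
    congr 1
    exact (commute_apply (hc _ p.1.2 _ q.1.2 _ p.2.2.2 _ q.2.2.2) q.2.1).symm)
    (ξ, ζ, η)

theorem tensorMap_apply {α : Submodule ℂ (𝔥 →L[ℂ] H)}
    {β : Submodule ℂ (𝔥 →L[ℂ] K)} {γ : Submodule ℂ (𝔥 →L[ℂ] L)} {δ : Submodule ℂ (𝔥 →L[ℂ] M)}
    (hc : GramCommute α β) (hc' : GramCommute γ δ) (S : H →L[ℂ] L) (T : K →L[ℂ] M)
    (hS : adjoint S ∘L S = .id ℂ H) (hT : adjoint T ∘L T = .id ℂ K)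
    (hSγ : ∀ ξ : α, S ∘L ξ.1 ∈ γ) (hTδ : ∀ η : β, T ∘L η.1 ∈ δ) (ξ : α) (ζ : 𝔥) (η : β) :
    tensorMap α β γ δ S T (tmul α β ξ ζ η) = tmul γ δ ⟨_, hSγ ξ⟩ ζ ⟨_, hTδ η⟩ := by
  refine opOfValues_apply_of_inner (ι := {p : α × 𝔥 × β // S ∘L p.1.1 ∈ γ ∧ T ∘L p.2.2.1 ∈ δ})
    (f := fun p => tmul α β p.1.1 p.1.2.1 p.1.2.2)
    (g := fun p => tmul γ δ ⟨S ∘L p.1.1.1, p.2.1⟩ p.1.2.1 ⟨T ∘L p.1.2.2.1, p.2.2⟩)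
    ?_ (fun p q => ?_) ⟨(ξ, ζ, η), hSγ ξ, hTδ η⟩
  · rw [← total_tmul α β]
    congr 2
    ext v
    constructor
    · rintro ⟨p, rfl⟩; exact ⟨p.1, rfl⟩
    · rintro ⟨p, rfl⟩; exact ⟨⟨p, hSγ _, hTδ _⟩, rfl⟩
  · rw [inner_tmul _ _ hc, inner_tmul _ _ hc']
    have h1 : ∀ x, adjoint S (S x) = x := DFunLike.congr_fun hS
    have h2 : ∀ x, adjoint T (T x) = x := DFunLike.congr_fun hT
    simp [adjoint_comp, h1, h2]

theorem gram_exists_sqrt (η : 𝔥 →L[ℂ] K) : ∃ S : 𝔥 →L[ℂ] 𝔥, adjoint S = S ∧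
    S ∘L S = adjoint η ∘L η ∧ ∀ T, Commute T (adjoint η ∘L η) → Commute T S := by
  have hp : 0 ≤ adjoint η ∘L η := by
    rw [nonneg_iff_isPositive]; exact isPositive_adjoint_comp_self η
  exact ⟨CFC.sqrt (adjoint η ∘L η), IsSelfAdjoint.of_nonneg (CFC.sqrt_nonneg _),
    CFC.sqrt_mul_sqrt_self _ hp, fun T hT => (hT.symm.cfcₙ_nnreal NNReal.sqrt).symm⟩

theorem ket2_apply {α : Submodule ℂ (𝔥 →L[ℂ] H)} {β : Submodule ℂ (𝔥 →L[ℂ] K)}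
    (hα : IsTotal α) (hc : GramCommute α β) (ξ : α) (ζ : 𝔥) (η : β) :
    ket2 α β η (ξ.1 ζ) = tmul α β ξ ζ η := by
  obtain ⟨S, hSa, hSS, hSc⟩ := gram_exists_sqrt η.1
  have hs : ∀ ξ ξ' : α, Commute S (adjoint ξ.1 ∘L ξ'.1) := fun ξ ξ' =>
    (hSc _ (hc _ ξ.2 _ ξ'.2 _ η.2 _ η.2)).symm
  refine opOfValues_apply (f := fun p : α × 𝔥 => p.1.1 p.2) (g := fun p => tmul α β p.1 p.2 η)
    hα ‖S‖ (fun c => ?_) (ξ, ζ)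
  simp only [Finsupp.linearCombination_apply]
  refine le_trans (le_of_eq ?_) (norm_sum_le α S hs c)
  rw [@norm_eq_sqrt_re_inner ℂ, @norm_eq_sqrt_re_inner ℂ,
    gram_sum_eq_inner α S (fun ξ ξ' => by rw [hSa]; exact hs ξ ξ')]
  congr 2
  rw [Finsupp.sum_comm]
  simp only [Finsupp.sum, sum_inner, inner_sum]
  refine Finset.sum_congr rfl fun q _ => Finset.sum_congr rfl fun p _ => ?_
  rw [inner_smul_left, inner_smul_right, inner_tmul _ _ hc, mul_assoc, hSa]
  have h1 : S (S q.2) = adjoint η.1 (η.1 q.2) := DFunLike.congr_fun hSS q.2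
  rw [h1]
  rfl

theorem ket1_apply {α : Submodule ℂ (𝔥 →L[ℂ] H)} {β : Submodule ℂ (𝔥 →L[ℂ] K)}
    (hβ : IsTotal β) (hc : GramCommute α β) (ξ : α) (ζ : 𝔥) (η : β) :
    ket1 α β ξ (η.1 ζ) = tmul α β ξ ζ η := by
  obtain ⟨S, hSa, hSS, hSc⟩ := gram_exists_sqrt ξ.1
  have hs : ∀ η η' : β, Commute S (adjoint η.1 ∘L η'.1) := fun η η' =>
    (hSc _ (hc _ ξ.2 _ ξ.2 _ η.2 _ η'.2).symm).symm
  refine opOfValues_apply (f := fun p : β × 𝔥 => p.1.1 p.2) (g := fun p => tmul α β ξ p.2 p.1)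
    hβ ‖S‖ (fun c => ?_) (η, ζ)
  simp only [Finsupp.linearCombination_apply]
  refine le_trans (le_of_eq ?_) (norm_sum_le β S hs c)
  rw [@norm_eq_sqrt_re_inner ℂ, @norm_eq_sqrt_re_inner ℂ,
    gram_sum_eq_inner β S (fun ξ ξ' => by rw [hSa]; exact hs ξ ξ')]
  congr 2
  rw [Finsupp.sum_comm]
  simp only [Finsupp.sum, sum_inner, inner_sum]
  refine Finset.sum_congr rfl fun q _ => Finset.sum_congr rfl fun p _ => ?_
  rw [inner_smul_left, inner_smul_right, inner_tmul _ _ hc, mul_assoc, hSa]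
  have h1 : S (S q.2) = adjoint ξ.1 (ξ.1 q.2) := DFunLike.congr_fun hSS q.2
  have h2 := commute_apply (hc _ ξ.2 _ ξ.2 _ p.1.2 _ q.1.2) q.2
  simp only [comp_apply] at h2
  rw [h1, h2]
  rfl

theorem eq_of_total {ι : Type*} {f : ι → H}
    (hf : (Submodule.span ℂ (Set.range f)).topologicalClosure = ⊤) {S T : H →L[ℂ] K}
    (h : ∀ i, S (f i) = T (f i)) : S = T := by
  refine ContinuousLinearMap.ext_on (s := Set.range f)
    (Submodule.dense_iff_topologicalClosure_eq_top.mpr hf) ?_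
  rintro _ ⟨i, rfl⟩
  exact h i

theorem eq_of_inner_total {ι : Type*} {f : ι → H}
    (hf : (Submodule.span ℂ (Set.range f)).topologicalClosure = ⊤) {x y : H}
    (h : ∀ i, ⟪x, f i⟫_ℂ = ⟪y, f i⟫_ℂ) : x = y := by
  have : innerSL ℂ x = innerSL ℂ y := by
    refine eq_of_total hf fun i => ?_
    simpa using h i
  exact innerSL_inj.mp this

theorem mem_of_total {ι : Type*} {f : ι → H}
    (hf : (Submodule.span ℂ (Set.range f)).topologicalClosure = ⊤) (T : H →L[ℂ] K)
    (W : Submodule ℂ K) (hW : IsClosed (W : Set K)) (h : ∀ i, T (f i) ∈ W) (v : H) : T v ∈ W := by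
  have h1 : Submodule.span ℂ (Set.range f) ≤ W.comap T.toLinearMap := by
    rw [Submodule.span_le]
    rintro _ ⟨i, rfl⟩
    exact h i
  have h2 : IsClosed (W.comap T.toLinearMap : Set H) := hW.preimage T.continuous
  have h3 := Submodule.topologicalClosure_minimal _ h1 h2
  rw [hf] at h3
  exact h3 (Submodule.mem_top (x := v))

/-- `⟨ξ|₁ |ξ'⟩₁ = ρ_β(ξ* ξ')`. -/
theorem adjoint_ket1_ket1 {α : Submodule ℂ (𝔥 →L[ℂ] H)} {β : Submodule ℂ (𝔥 →L[ℂ] K)}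
    (hβ : IsTotal β) (hc : GramCommute α β) (ξ ξ' : α) (v : K) :
    adjoint (ket1 α β ξ) (ket1 α β ξ' v) = rho β (adjoint ξ.1 ∘L ξ'.1) v := by
  suffices adjoint (ket1 α β ξ) ∘L ket1 α β ξ' = rho β (adjoint ξ.1 ∘L ξ'.1) from
    DFunLike.congr_fun this v
  refine eq_of_total hβ fun p => eq_of_inner_total hβ fun q => ?_
  rw [rho_apply hβ (fun η η' => hc _ ξ.2 _ ξ'.2 _ η.2 _ η'.2), comp_apply, ket1_apply hβ hc,
    adjoint_inner_left, ket1_apply hβ hc, inner_tmul _ _ hc, adjoint_inner_right]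
  have h3 : ∀ z w, ⟪p.1.1 z, w⟫_ℂ = ⟪z, adjoint p.1.1 w⟫_ℂ :=
    fun z w => (adjoint_inner_right _ _ _).symm
  rw [h3, comp_apply, adjoint_inner_left]

/-- `⟨η|₂ |η'⟩₂ = ρ_α(η* η')`. -/
theorem adjoint_ket2_ket2 {α : Submodule ℂ (𝔥 →L[ℂ] H)} {β : Submodule ℂ (𝔥 →L[ℂ] K)}
    (hα : IsTotal α) (hc : GramCommute α β) (η η' : β) (v : H) :
    adjoint (ket2 α β η) (ket2 α β η' v) = rho α (adjoint η.1 ∘L η'.1) v := by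
  suffices adjoint (ket2 α β η) ∘L ket2 α β η' = rho α (adjoint η.1 ∘L η'.1) from
    DFunLike.congr_fun this v
  refine eq_of_total hα fun p => eq_of_inner_total hα fun q => ?_
  rw [rho_apply hα (fun ξ ξ' => (hc _ ξ.2 _ ξ'.2 _ η.2 _ η'.2).symm), comp_apply,
    ket2_apply hα hc, adjoint_inner_left, ket2_apply hα hc, inner_tmul _ _ hc]
  have h2 := commute_apply (hc _ p.1.2 _ q.1.2 _ η'.2 _ η.2) q.2
  simp only [comp_apply] at h2
  have h3 : ∀ z w, ⟪p.1.1 z, w⟫_ℂ = ⟪z, adjoint p.1.1 w⟫_ℂ :=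
    fun z w => (adjoint_inner_right _ _ _).symm
  rw [h2, adjoint_inner_right, h3, comp_apply, adjoint_inner_left]

theorem cspan_gram_mem {S : Set (𝔨 →L[ℂ] H)} (C : NonUnitalStarSubalgebra ℂ (𝔨 →L[ℂ] 𝔨))
    (hC : IsClosed (C : Set (𝔨 →L[ℂ] 𝔨))) (h : ∀ s ∈ S, ∀ t ∈ S, adjoint s ∘L t ∈ C)
    {X Y : 𝔨 →L[ℂ] H} (hX : X ∈ cspan S) (hY : Y ∈ cspan S) : adjoint X ∘L Y ∈ C := by
  have key : ∀ T : H →L[ℂ] 𝔨, (∀ s ∈ S, T ∘L s ∈ C) → ∀ Z ∈ cspan S, T ∘L Z ∈ C := by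
    intro T hT
    let Φ : (𝔨 →L[ℂ] H) →L[ℂ] (𝔨 →L[ℂ] 𝔨) := ContinuousLinearMap.compL ℂ 𝔨 H 𝔨 T
    have h1 : Submodule.span ℂ S ≤ C.toSubmodule.comap Φ.toLinearMap :=
      Submodule.span_le.mpr fun s hs => hT s hs
    have h2 : IsClosed (C.toSubmodule.comap Φ.toLinearMap : Set (𝔨 →L[ℂ] H)) :=
      hC.preimage Φ.continuous
    exact fun Z hZ => Submodule.topologicalClosure_minimal _ h1 h2 hZ
  refine key (adjoint X) (fun s hs => ?_) Y hY
  have h3 := star_mem (key (adjoint s) (h s hs) X hX)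
  have h4 : star (adjoint s ∘L X) = adjoint X ∘L s := by
    rw [star_eq_adjoint, adjoint_comp, adjoint_adjoint]
  rwa [h4] at h3

theorem Compatible.mem_right {b : CStarBase 𝔥} {c : CStarBase 𝔨} {α : Submodule ℂ (𝔥 →L[ℂ] H)}
    {β : Submodule ℂ (𝔨 →L[ℂ] H)} (h : Compatible b c α β) {T : 𝔥 →L[ℂ] 𝔥} (hT : T ∈ b.Bd)
    (η : β) : rho α T ∘L η.1 ∈ β := by
  have : rho α T ∘L η.1 ∈ cspan (opMul (rho α '' (b.Bd : Set (𝔥 →L[ℂ] 𝔥))) (β : Set _)) :=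
    subset_cspan _ ⟨_, ⟨T, hT, rfl⟩, _, η.2, rfl⟩
  rwa [h.1] at this

theorem Compatible.symm {b : CStarBase 𝔥} {c : CStarBase 𝔨} {α : Submodule ℂ (𝔥 →L[ℂ] H)}
    {β : Submodule ℂ (𝔨 →L[ℂ] H)} (h : Compatible b c α β) : Compatible c b β α := ⟨h.2, h.1⟩

theorem IsFactorization.rho_apply {b : CStarBase 𝔥} {α : Submodule ℂ (𝔥 →L[ℂ] H)}
    (hα : IsFactorization b α) {T : 𝔥 →L[ℂ] 𝔥} (hT : T ∈ b.Bd) (ξ : α) (ζ : 𝔥) :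
    rho α T (ξ.1 ζ) = ξ.1 (T ζ) :=
  RelTensor.rho_apply hα.isTotal (fun ξ ξ' => (b.commute _ (hα.gram_mem ξ ξ') T hT).symm) ξ ζ

theorem Compatible.rho_comm {b : CStarBase 𝔥} {c : CStarBase 𝔨} {α : Submodule ℂ (𝔥 →L[ℂ] H)}
    {β : Submodule ℂ (𝔨 →L[ℂ] H)} (hβ : IsFactorization c β)
    (h : Compatible b c α β) {S : 𝔥 →L[ℂ] 𝔥} (hS : S ∈ b.Bd) {T : 𝔨 →L[ℂ] 𝔨} (hT : T ∈ c.Bd)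
    (v : H) : rho α S (rho β T v) = rho β T (rho α S v) := by
  suffices rho α S ∘L rho β T = rho β T ∘L rho α S from DFunLike.congr_fun this v
  refine eq_of_total hβ.isTotal fun p => ?_
  have h1 := hβ.rho_apply hT ⟨_, h.mem_right hS p.1⟩ p.2
  simp only [comp_apply] at h1 ⊢
  rw [hβ.rho_apply hT, h1]

theorem total_ket1 {α : Submodule ℂ (𝔥 →L[ℂ] H)} {β : Submodule ℂ (𝔥 →L[ℂ] K)}
    (hβ : IsTotal β) (hc : GramCommute α β) :
    (Submodule.span ℂ (Set.range fun p : α × K => ket1 α β p.1 p.2)).topologicalClosure = ⊤ := by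
  rw [eq_top_iff, ← total_tmul α β]
  refine Submodule.topologicalClosure_mono (Submodule.span_mono ?_)
  rintro _ ⟨p, rfl⟩
  exact ⟨(p.1, p.2.2.1 p.2.1), ket1_apply hβ hc _ _ _⟩

theorem total_ket2 {α : Submodule ℂ (𝔥 →L[ℂ] H)} {β : Submodule ℂ (𝔥 →L[ℂ] K)}
    (hα : IsTotal α) (hc : GramCommute α β) :
    (Submodule.span ℂ (Set.range fun p : β × H => ket2 α β p.1 p.2)).topologicalClosure = ⊤ := by
  rw [eq_top_iff, ← total_tmul α β]
  refine Submodule.topologicalClosure_mono (Submodule.span_mono ?_)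
  rintro _ ⟨p, rfl⟩
  exact ⟨(p.2.2, p.1.1 p.2.1), ket2_apply hα hc _ _ _⟩

theorem ket1_comp_mem (α : Submodule ℂ (𝔥 →L[ℂ] H)) (β : Submodule ℂ (𝔥 →L[ℂ] K))
    {δ : Submodule ℂ (𝔨 →L[ℂ] K)} (ξ : α) (x : δ) : ket1 α β ξ ∘L x.1 ∈ factR α β δ :=
  subset_cspan _ ⟨_, ⟨ξ, rfl⟩, _, x.2, rfl⟩

theorem ket2_comp_mem (α : Submodule ℂ (𝔥 →L[ℂ] H)) (β : Submodule ℂ (𝔥 →L[ℂ] K))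
    {γ : Submodule ℂ (𝔨 →L[ℂ] H)} (η : β) (x : γ) : ket2 α β η ∘L x.1 ∈ factL α β γ :=
  subset_cspan _ ⟨_, ⟨η, rfl⟩, _, x.2, rfl⟩

theorem isTotal_factR {α : Submodule ℂ (𝔥 →L[ℂ] H)} {β : Submodule ℂ (𝔥 →L[ℂ] K)}
    {δ : Submodule ℂ (𝔨 →L[ℂ] K)} (hβ : IsTotal β) (hδ : IsTotal δ) (hc : GramCommute α β) :
    IsTotal (factR α β δ) := by
  rw [IsTotal, eq_top_iff, ← total_ket1 hβ hc]
  refine Submodule.topologicalClosure_minimal _ (Submodule.span_le.mpr ?_)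
    (Submodule.isClosed_topologicalClosure _)
  rintro _ ⟨p, rfl⟩
  refine mem_of_total hδ (ket1 α β p.1) _ (Submodule.isClosed_topologicalClosure _) (fun q => ?_) _
  exact Submodule.le_topologicalClosure _
    (Submodule.subset_span ⟨(⟨_, ket1_comp_mem α β p.1 q.1⟩, q.2), rfl⟩)

theorem isTotal_factL {α : Submodule ℂ (𝔥 →L[ℂ] H)} {β : Submodule ℂ (𝔥 →L[ℂ] K)}
    {γ : Submodule ℂ (𝔨 →L[ℂ] H)} (hα : IsTotal α) (hγ : IsTotal γ) (hc : GramCommute α β) :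
    IsTotal (factL α β γ) := by
  rw [IsTotal, eq_top_iff, ← total_ket2 hα hc]
  refine Submodule.topologicalClosure_minimal _ (Submodule.span_le.mpr ?_)
    (Submodule.isClosed_topologicalClosure _)
  rintro _ ⟨p, rfl⟩
  refine mem_of_total hγ (ket2 α β p.1) _ (Submodule.isClosed_topologicalClosure _) (fun q => ?_) _
  exact Submodule.le_topologicalClosure _
    (Submodule.subset_span ⟨(⟨_, ket2_comp_mem α β p.1 q.1⟩, q.2), rfl⟩)

theorem factR_gram_mem {b : CStarBase 𝔥} {c : CStarBase 𝔨} {α : Submodule ℂ (𝔥 →L[ℂ] H)}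
    {β : Submodule ℂ (𝔥 →L[ℂ] K)} {δ : Submodule ℂ (𝔨 →L[ℂ] K)} (hα : IsFactorization b α)
    (hβ : IsFactorization b.op β) (hδ : IsFactorization c δ) (h : Compatible b.op c β δ)
    {X Y : 𝔨 →L[ℂ] RTP α β} (hX : X ∈ factR α β δ) (hY : Y ∈ factR α β δ) :
    adjoint X ∘L Y ∈ c.B := by
  refine cspan_gram_mem c.B c.isClosed_B ?_ hX hY
  rintro _ ⟨_, ⟨ξ, rfl⟩, x, hx, rfl⟩ _ ⟨_, ⟨ξ', rfl⟩, y, hy, rfl⟩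
  have h1 := hδ.gram_mem ⟨x, hx⟩ ⟨_, h.mem_right (hα.gram_mem ξ ξ') ⟨y, hy⟩⟩
  convert h1 using 1
  ext v
  simp only [adjoint_comp, comp_apply]
  rw [adjoint_ket1_ket1 hβ.isTotal (hα.gramCommute hβ)]

theorem factL_gram_mem {b : CStarBase 𝔥} {c : CStarBase 𝔨} {α : Submodule ℂ (𝔥 →L[ℂ] H)}
    {β : Submodule ℂ (𝔥 →L[ℂ] K)} {γ : Submodule ℂ (𝔨 →L[ℂ] H)} (hα : IsFactorization b α)
    (hβ : IsFactorization b.op β) (hγ : IsFactorization c γ) (h : Compatible b c α γ)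
    {X Y : 𝔨 →L[ℂ] RTP α β} (hX : X ∈ factL α β γ) (hY : Y ∈ factL α β γ) :
    adjoint X ∘L Y ∈ c.B := by
  refine cspan_gram_mem c.B c.isClosed_B ?_ hX hY
  rintro _ ⟨_, ⟨η, rfl⟩, x, hx, rfl⟩ _ ⟨_, ⟨η', rfl⟩, y, hy, rfl⟩
  have h1 := hγ.gram_mem ⟨x, hx⟩ ⟨_, h.mem_right (hβ.gram_mem η η') ⟨y, hy⟩⟩
  convert h1 using 1
  ext v
  simp only [adjoint_comp, comp_apply]
  rw [adjoint_ket2_ket2 hα.isTotal (hα.gramCommute hβ)]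

theorem rho_factR {α : Submodule ℂ (𝔥 →L[ℂ] H)} {β : Submodule ℂ (𝔥 →L[ℂ] K)}
    {δ : Submodule ℂ (𝔨 →L[ℂ] K)} {T : 𝔨 →L[ℂ] 𝔨} (hβ : IsTotal β) (hδ : IsTotal δ)
    (hc : GramCommute α β) (hT : ∀ x y : factR α β δ, Commute T (adjoint x.1 ∘L y.1))
    (hT' : ∀ x y : δ, Commute T (adjoint x.1 ∘L y.1)) (ξ : α) (v : K) :
    rho (factR α β δ) T (ket1 α β ξ v) = ket1 α β ξ (rho δ T v) := by
  suffices rho (factR α β δ) T ∘L ket1 α β ξ = ket1 α β ξ ∘L rho δ T from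
    DFunLike.congr_fun this v
  refine eq_of_total hδ fun p => ?_
  rw [comp_apply, comp_apply, rho_apply hδ hT']
  exact rho_apply (isTotal_factR hβ hδ hc) hT ⟨_, ket1_comp_mem α β ξ p.1⟩ p.2

theorem rho_factL {α : Submodule ℂ (𝔥 →L[ℂ] H)} {β : Submodule ℂ (𝔥 →L[ℂ] K)}
    {γ : Submodule ℂ (𝔨 →L[ℂ] H)} {T : 𝔨 →L[ℂ] 𝔨} (hα : IsTotal α) (hγ : IsTotal γ)
    (hc : GramCommute α β) (hT : ∀ x y : factL α β γ, Commute T (adjoint x.1 ∘L y.1))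
    (hT' : ∀ x y : γ, Commute T (adjoint x.1 ∘L y.1)) (η : β) (v : H) :
    rho (factL α β γ) T (ket2 α β η v) = ket2 α β η (rho γ T v) := by
  suffices rho (factL α β γ) T ∘L ket2 α β η = ket2 α β η ∘L rho γ T from
    DFunLike.congr_fun this v
  refine eq_of_total hγ fun p => ?_
  rw [comp_apply, comp_apply, rho_apply hγ hT']
  exact rho_apply (isTotal_factL hα hγ hc) hT ⟨_, ket2_comp_mem α β η p.1⟩ p.2

theorem assocOp_apply {b : CStarBase 𝔥} {c : CStarBase 𝔨} {α : Submodule ℂ (𝔥 →L[ℂ] H)}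
    {β : Submodule ℂ (𝔥 →L[ℂ] K)} {γ : Submodule ℂ (𝔨 →L[ℂ] K)} {δ : Submodule ℂ (𝔨 →L[ℂ] L)}
    (hα : IsFactorization b α) (hβ : IsFactorization b.op β) (hγ : IsFactorization c γ)
    (hδ : IsFactorization c.op δ) (h : Compatible b.op c β γ) (ξ : α) (v : K) (η : δ) :
    assocOp α β γ δ (ket2 (factR α β γ) δ η (ket1 α β ξ v)) =
      ket1 α (factL γ δ β) ξ (ket2 γ δ η v) := by
  have hαβ := hα.gramCommute hβ
  have hγδ := hγ.gramCommute hδ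
  have c1 : GramCommute (factR α β γ) δ := fun x hx y hy z hz w hw =>
    c.commute _ (factR_gram_mem hα hβ hγ h hx hy) _ (hδ.gram_mem ⟨z, hz⟩ ⟨w, hw⟩)
  have c2 : GramCommute α (factL γ δ β) := fun z hz w hw x hx y hy =>
    b.commute _ (hα.gram_mem ⟨z, hz⟩ ⟨w, hw⟩) _ (factL_gram_mem (c := b.op) hγ hδ hβ h.symm hx hy)
  have t1 := isTotal_factR hβ.isTotal hγ.isTotal hαβ
  have t2 := isTotal_factL hγ.isTotal hβ.isTotal hγδ
  refine opOfValues_apply_of_inner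
    (f := fun p : α × K × δ => ket2 (factR α β γ) δ p.2.2 (ket1 α β p.1 p.2.1))
    (g := fun p => ket1 α (factL γ δ β) p.1 (ket2 γ δ p.2.2 p.2.1)) ?_ (fun p q => ?_) (ξ, v, η)
  · rw [eq_top_iff, ← total_ket2 t1 c1]
    refine Submodule.topologicalClosure_minimal _ (Submodule.span_le.mpr ?_)
      (Submodule.isClosed_topologicalClosure _)
    rintro _ ⟨p, rfl⟩
    refine mem_of_total (total_ket1 hβ.isTotal hαβ) (ket2 (factR α β γ) δ p.1) _
      (Submodule.isClosed_topologicalClosure _) (fun q => ?_) _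
    exact Submodule.le_topologicalClosure _ (Submodule.subset_span ⟨(q.1, q.2, p.1), rfl⟩)
  · rw [← adjoint_inner_right, adjoint_ket1_ket1 t2 c2,
      rho_factL hγ.isTotal hβ.isTotal hγδ (fun x y => c2 _ p.1.2 _ q.1.2 _ x.2 _ y.2)
        (fun x y => hαβ _ p.1.2 _ q.1.2 _ x.2 _ y.2),
      ← adjoint_inner_right, adjoint_ket2_ket2 hγ.isTotal hγδ,
      ← adjoint_inner_right (ket2 (factR α β γ) δ p.2.2), adjoint_ket2_ket2 t1 c1,
      rho_factR hβ.isTotal hγ.isTotal hαβ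
        (fun x y => (c1 _ x.2 _ y.2 _ p.2.2.2 _ q.2.2.2).symm)
        (fun x y => (hγδ _ x.2 _ y.2 _ p.2.2.2 _ q.2.2.2).symm),
      ← adjoint_inner_right, adjoint_ket1_ket1 hβ.isTotal hαβ]
    congr 1
    exact (h.rho_comm hγ (hα.gram_mem p.1 q.1) (hδ.gram_mem p.2.2 q.2.2) _).symm

theorem flip23_apply {b : CStarBase 𝔥} {c : CStarBase 𝔨} {α : Submodule ℂ (𝔥 →L[ℂ] H)}
    {β : Submodule ℂ (𝔥 →L[ℂ] K)} {γ : Submodule ℂ (𝔨 →L[ℂ] H)} {δ : Submodule ℂ (𝔨 →L[ℂ] L)}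
    (hα : IsFactorization b α) (hβ : IsFactorization b.op β) (hγ : IsFactorization c γ)
    (hδ : IsFactorization c.op δ) (h : Compatible b c α γ) (ξ : β) (v : H) (η : δ) :
    flip23 α β γ δ (ket2 (factL α β γ) δ η (ket2 α β ξ v)) =
      ket2 (factL γ δ α) β ξ (ket2 γ δ η v) := by
  have hαβ := hα.gramCommute hβ
  have hγδ := hγ.gramCommute hδ
  have c1 : GramCommute (factL α β γ) δ := fun x hx y hy z hz w hw =>
    c.commute _ (factL_gram_mem hα hβ hγ h hx hy) _ (hδ.gram_mem ⟨z, hz⟩ ⟨w, hw⟩)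
  have c2 : GramCommute (factL γ δ α) β := fun x hx y hy z hz w hw =>
    b.commute _ (factL_gram_mem hγ hδ hα h.symm hx hy) _ (hβ.gram_mem ⟨z, hz⟩ ⟨w, hw⟩)
  have t1 := isTotal_factL hα.isTotal hγ.isTotal hαβ
  have t2 := isTotal_factL hγ.isTotal hα.isTotal hγδ
  refine opOfValues_apply_of_inner
    (f := fun p : β × H × δ => ket2 (factL α β γ) δ p.2.2 (ket2 α β p.1 p.2.1))
    (g := fun p => ket2 (factL γ δ α) β p.1 (ket2 γ δ p.2.2 p.2.1)) ?_ (fun p q => ?_) (ξ, v, η)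
  · rw [eq_top_iff, ← total_ket2 t1 c1]
    refine Submodule.topologicalClosure_minimal _ (Submodule.span_le.mpr ?_)
      (Submodule.isClosed_topologicalClosure _)
    rintro _ ⟨p, rfl⟩
    refine mem_of_total (total_ket2 hα.isTotal hαβ) (ket2 (factL α β γ) δ p.1) _
      (Submodule.isClosed_topologicalClosure _) (fun q => ?_) _
    exact Submodule.le_topologicalClosure _ (Submodule.subset_span ⟨(q.1, q.2, p.1), rfl⟩)
  · rw [← adjoint_inner_right, adjoint_ket2_ket2 t2 c2,
      rho_factL hγ.isTotal hα.isTotal hγδ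
        (fun x y => (c2 _ x.2 _ y.2 _ p.1.2 _ q.1.2).symm)
        (fun x y => (hαβ _ x.2 _ y.2 _ p.1.2 _ q.1.2).symm),
      ← adjoint_inner_right, adjoint_ket2_ket2 hγ.isTotal hγδ,
      ← adjoint_inner_right (ket2 (factL α β γ) δ p.2.2), adjoint_ket2_ket2 t1 c1,
      rho_factL hα.isTotal hγ.isTotal hαβ
        (fun x y => (c1 _ x.2 _ y.2 _ p.2.2.2 _ q.2.2.2).symm)
        (fun x y => (hγδ _ x.2 _ y.2 _ p.2.2.2 _ q.2.2.2).symm),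
      ← adjoint_inner_right, adjoint_ket2_ket2 hα.isTotal hαβ]
    congr 1
    exact (h.rho_comm hγ (hβ.gram_mem p.1 q.1) (hδ.gram_mem p.2.2 q.2.2) _).symm

end
end RelTensor

open RelTensor

open ContinuousLinearMap InnerProductSpace

namespace RelTensor

-- Write `J = Σ(1 ⊗ U)`, which is `flipU`. On kets it acts by `J|ξ⟩₁ = |ξ⟩₂U` and `J|η⟩₂ = |Uη⟩₁`,
-- so `J|β⟩₂ = |β̂⟩₁`. The closed span of a product of sets depends only on the closed spans of its
-- factors, so identities between spans may be substituted inside longer products.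
--
-- Three facts carry the proof.
--
-- (1) Absorption (`cspan_comp_ket2_adjoint_leg`): `[V|α⟩₂⟨α|₂V*|β⟩₂] = [|β⟩₂⟨α|₂V*|β⟩₂]`. Here
-- `|ξ⟩₂⟨ξ'|₂ = 1 ⊗ ξξ'*`, and by regularity the operators `ξξ'*` have the same closed span as the
-- slices `⟨ξ|₁V|ξ'⟩₂`. The pentagon equation in the form `V₁₃V₂₃V₁₂* = V₁₂*V₂₃`, sliced by `⟨ξ|₂`
-- and `|ξ'⟩₃`, expresses `V(1 ⊗ ⟨ξ|₁V|ξ'⟩₂)V*|η⟩₂` through the vector `V|ξ'⟩₂η`. Since `V(β ◁ α) =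
-- β ◁ β`, such vectors span the same space as the `|η⟩₂η'`, for which the slice is
-- `|η⟩₂⟨ξ|₂V*|η'⟩₂`. Multiplying absorption by `⟨β|₂` gives `[ÂÂ*] = Â*`, hence `Â* = Â`
-- (`cspan_adjoint_leg`).
--
-- (2) `[Âα̂] = α̂` (`cspan_legAhat_αh`): the relation `V̌(α̂ ▷ α̂) = β̂ ▷ α̂` for the
-- pseudo-multiplicative unitary `V̌` says `[V|α⟩₂α̂] = [|β⟩₂α̂]`, and `[⟨β|₂|β⟩₂] = [ρ_α(𝔅†)]`
-- preserves `α̂` by compatibility.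
--
-- (3) `[⟨α|₁VJV|α⟩₂] = [α̂α̂*]` (`cspan_slice_flipU`): `(JV)³ = 1` gives `VJVJ = J*V*`, which turns
-- the left side into `U[⟨α|₁V|α⟩₂]*U = U[αα*]U`.
--
-- Combining them, `[α̂α̂*] = [α̂(Âα̂)*] = [α̂α̂*Â*] = [⟨α|₁VJV|α⟩₂⟨α|₂V*|β⟩₂] =
-- [⟨α|₁VJ|β⟩₂⟨α|₂V*|β⟩₂] = [⟨α|₁V|β̂⟩₁Â*] = [AÂ]`.

local infixl:70 " ⬝ " => opMul

/-! ### Closed linear spans of products and adjoints of operator sets. -/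

section OperatorSpaces
variable {E F G D : Type*}
  [NormedAddCommGroup E] [InnerProductSpace ℂ E] [CompleteSpace E]
  [NormedAddCommGroup F] [InnerProductSpace ℂ F] [CompleteSpace F]
  [NormedAddCommGroup G] [InnerProductSpace ℂ G] [CompleteSpace G]
  [NormedAddCommGroup D] [InnerProductSpace ℂ D] [CompleteSpace D]

theorem isClosed_cspan (S : Set (E →L[ℂ] F)) : IsClosed (cspan S : Set (E →L[ℂ] F)) :=
  Submodule.isClosed_topologicalClosure _

theorem cspan_le {S : Set (E →L[ℂ] F)} {W : Submodule ℂ (E →L[ℂ] F)}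
    (hW : IsClosed (W : Set (E →L[ℂ] F))) (h : S ⊆ W) : cspan S ≤ W :=
  Submodule.topologicalClosure_minimal _ (Submodule.span_le.mpr h) hW

theorem cspan_le_cspan {S T : Set (E →L[ℂ] F)} (h : S ⊆ cspan T) : cspan S ≤ cspan T :=
  cspan_le (isClosed_cspan T) h

theorem cspan_coe {W : Submodule ℂ (E →L[ℂ] F)} (hW : IsClosed (W : Set (E →L[ℂ] F))) :
    cspan (W : Set (E →L[ℂ] F)) = W :=
  le_antisymm (cspan_le hW subset_rfl) fun _ hx => subset_cspan _ hx

theorem cspan_cspan (S : Set (E →L[ℂ] F)) : cspan (cspan S : Set (E →L[ℂ] F)) = cspan S :=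
  cspan_coe (isClosed_cspan S)

theorem opMul_assoc (S : Set (F →L[ℂ] G)) (T : Set (E →L[ℂ] F)) (R : Set (D →L[ℂ] E)) :
    S ⬝ T ⬝ R = S ⬝ (T ⬝ R) :=
  Set.image2_assoc fun _ _ _ => rfl

theorem opAdj_opMul (S : Set (F →L[ℂ] G)) (T : Set (E →L[ℂ] F)) :
    opAdj (S ⬝ T) = opAdj T ⬝ opAdj S := by
  ext x
  constructor
  · rintro ⟨_, ⟨s, hs, t, ht, rfl⟩, rfl⟩
    exact ⟨_, ⟨t, ht, rfl⟩, _, ⟨s, hs, rfl⟩, (adjoint_comp _ _).symm⟩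
  · rintro ⟨_, ⟨t, ht, rfl⟩, _, ⟨s, hs, rfl⟩, rfl⟩
    exact ⟨_, ⟨s, hs, t, ht, rfl⟩, adjoint_comp _ _⟩

theorem opAdj_opAdj (S : Set (E →L[ℂ] F)) : opAdj (opAdj S) = S := by
  simp [opAdj, Set.image_image]

theorem opAdj_singleton (V : E →L[ℂ] F) : opAdj {V} = {adjoint V} := Set.image_singleton

theorem singleton_opMul_singleton (V : F →L[ℂ] G) (W : E →L[ℂ] F) :
    ({V} : Set (F →L[ℂ] G)) ⬝ {W} = {V ∘L W} := Set.image2_singleton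

theorem singleton_opMul (W : F →L[ℂ] G) (S : Set (E →L[ℂ] F)) :
    ({W} : Set (F →L[ℂ] G)) ⬝ S = (fun s => W ∘L s) '' S :=
  Set.image2_singleton_left

theorem one_opMul (S : Set (E →L[ℂ] F)) :
    ({ContinuousLinearMap.id ℂ F} : Set (F →L[ℂ] F)) ⬝ S = S := by
  simp [opMul]

/-- A bounded linear map on a space of operators maps closed spans into closed spans. -/
theorem map_mem_of_mem_cspan {X : Type*} [AddCommGroup X] [Module ℂ X] [TopologicalSpace X]
    {C : Submodule ℂ (E →L[ℂ] F)} (Φ : C →L[ℂ] X) {S : Set (E →L[ℂ] F)} {W : Submodule ℂ X}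
    (hW : IsClosed (W : Set X)) (h : ∀ s ∈ S, ∃ hs : s ∈ C, Φ ⟨s, hs⟩ ∈ W) {x : E →L[ℂ] F}
    (hx : x ∈ cspan S) (hxC : x ∈ C) : Φ ⟨x, hxC⟩ ∈ W := by
  have h1 : Submodule.span ℂ S ≤ (W.comap Φ.toLinearMap).map C.subtype := by
    rw [Submodule.span_le]
    intro s hs
    obtain ⟨hsC, hsW⟩ := h s hs
    exact ⟨⟨s, hsC⟩, hsW, rfl⟩
  have h2 : IsClosed (W.comap Φ.toLinearMap : Set C) := hW.preimage Φ.continuous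
  -- `C` need not be closed, so the closed span of `S` may leave it. Only points of `C` matter, and
  -- the closure inside `C` is the trace on `C` of the closure in the ambient space.
  have h3 : (⟨x, hxC⟩ : C) ∈ closure (W.comap Φ.toLinearMap : Set C) := by
    rw [Topology.IsInducing.subtypeVal.closure_eq_preimage_closure_image]
    exact closure_mono h1 hx
  rw [h2.closure_eq] at h3
  exact h3

/-- Composition with a fixed operator is bounded and linear, so it carries a closed span into the
closed span of the products. With its left-handed counterpart this allows one factor of a long
product to be exchanged for another with the same closed span. -/
theorem cspan_opMul_congr_right (S : Set (F →L[ℂ] G)) {T T' : Set (E →L[ℂ] F)}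
    (h : cspan T = cspan T') : cspan (S ⬝ T) = cspan (S ⬝ T') := by
  have key : ∀ T T' : Set (E →L[ℂ] F), cspan T = cspan T' → cspan (S ⬝ T) ≤ cspan (S ⬝ T') := by
    intro T T' h
    refine cspan_le_cspan ?_
    rintro _ ⟨s, hs, t, ht, rfl⟩
    have ht' : t ∈ cspan T' := h ▸ subset_cspan T ht
    have h2 : cspan T' ≤ (cspan (S ⬝ T')).comap (compL ℂ E F G s).toLinearMap :=
      cspan_le ((isClosed_cspan _).preimage (compL ℂ E F G s).continuous)
        fun t ht => subset_cspan _ ⟨s, hs, t, ht, rfl⟩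
    exact h2 ht'
  exact le_antisymm (key _ _ h) (key _ _ h.symm)

theorem cspan_opMul_congr_left {S S' : Set (F →L[ℂ] G)} (T : Set (E →L[ℂ] F))
    (h : cspan S = cspan S') : cspan (S ⬝ T) = cspan (S' ⬝ T) := by
  have key : ∀ S S' : Set (F →L[ℂ] G), cspan S = cspan S' → cspan (S ⬝ T) ≤ cspan (S' ⬝ T) := by
    intro S S' h
    refine cspan_le_cspan ?_
    rintro _ ⟨s, hs, t, ht, rfl⟩
    have hs' : s ∈ cspan S' := h ▸ subset_cspan S hs
    have h2 : cspan S' ≤ (cspan (S' ⬝ T)).comap ((compL ℂ E F G).flip t).toLinearMap :=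
      cspan_le ((isClosed_cspan _).preimage ((compL ℂ E F G).flip t).continuous)
        fun s hs => subset_cspan _ ⟨s, hs, t, ht, rfl⟩
    exact h2 hs'
  exact le_antisymm (key _ _ h) (key _ _ h.symm)

/-- The adjoint is a conjugate-linear isometry, so the preimage of a closed subspace under it is
again a closed subspace. -/
theorem cspan_opAdj_congr {S T : Set (E →L[ℂ] F)} (h : cspan S = cspan T) :
    cspan (opAdj S) = cspan (opAdj T) := by
  have key : ∀ S T : Set (E →L[ℂ] F), cspan S = cspan T → cspan (opAdj S) ≤ cspan (opAdj T) := by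
    intro S T h
    refine cspan_le_cspan ?_
    rintro _ ⟨s, hs, rfl⟩
    have hs' : s ∈ cspan T := h ▸ subset_cspan S hs
    have h2 : cspan T ≤ (cspan (opAdj T)).comap
        (adjoint : (E →L[ℂ] F) ≃ₗᵢ⋆[ℂ] (F →L[ℂ] E)).toLinearEquiv.toLinearMap :=
      cspan_le ((isClosed_cspan _).preimage (adjoint : (E →L[ℂ] F) ≃ₗᵢ⋆[ℂ] _).continuous)
        fun t ht => subset_cspan _ ⟨t, ht, rfl⟩
    exact h2 hs'
  exact le_antisymm (key _ _ h) (key _ _ h.symm)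

theorem MapsOnto.cspan_eq {V : E →L[ℂ] F} {γ : Submodule ℂ (G →L[ℂ] E)}
    {δ : Submodule ℂ (G →L[ℂ] F)} (h : MapsOnto V γ δ) :
    cspan (({V} : Set (E →L[ℂ] F)) ⬝ (γ : Set (G →L[ℂ] E))) = cspan (δ : Set (G →L[ℂ] F)) := by
  rw [← h]
  simp [opMul]

theorem MapsOnto.comp_mem {V : E →L[ℂ] F} {γ : Submodule ℂ (G →L[ℂ] E)}
    {δ : Submodule ℂ (G →L[ℂ] F)} (h : MapsOnto V γ δ) (x : γ) : V ∘L x.1 ∈ δ := by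
  have : V ∘L x.1 ∈ (δ : Set (G →L[ℂ] F)) := by
    rw [← h]
    exact ⟨x.1, x.2, rfl⟩
  exact this

end OperatorSpaces

/-! ### Isometries tested on total families. -/

section Isometries
variable {E F : Type*}
  [NormedAddCommGroup E] [InnerProductSpace ℂ E] [CompleteSpace E]
  [NormedAddCommGroup F] [InnerProductSpace ℂ F] [CompleteSpace F]

theorem adjoint_comp_self_of_total {ι : Type*} {f : ι → E}
    (hf : (Submodule.span ℂ (Set.range f)).topologicalClosure = ⊤) {T : E →L[ℂ] F}
    (h : ∀ i j, ⟪T (f i), T (f j)⟫_ℂ = ⟪f i, f j⟫_ℂ) : adjoint T ∘L T = .id ℂ E := by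
  refine eq_of_total hf fun j => eq_of_inner_total hf fun i => ?_
  rw [comp_apply, adjoint_inner_left, id_apply, ← inner_conj_symm, h, inner_conj_symm]

theorem adjoint_comp_cancel {G : Type*} [NormedAddCommGroup G] [InnerProductSpace ℂ G]
    {T : E →L[ℂ] F} (hT : adjoint T ∘L T = .id ℂ E) (S : G →L[ℂ] E) :
    adjoint T ∘L T ∘L S = S := by
  rw [← comp_assoc, hT, id_comp]

end Isometries

/-! ### The representations `ρ`, the ket operators, and their continuity. -/

section Kets
variable {𝔥 H K L M : Type*}
  [NormedAddCommGroup 𝔥] [InnerProductSpace ℂ 𝔥] [CompleteSpace 𝔥]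
  [NormedAddCommGroup H] [InnerProductSpace ℂ H] [CompleteSpace H]
  [NormedAddCommGroup K] [InnerProductSpace ℂ K] [CompleteSpace K]
  [NormedAddCommGroup L] [InnerProductSpace ℂ L] [CompleteSpace L]
  [NormedAddCommGroup M] [InnerProductSpace ℂ M] [CompleteSpace M]

/-- The operators commuting with `α* α`. -/
noncomputable def gramCommutant (α : Submodule ℂ (𝔥 →L[ℂ] H)) : Submodule ℂ (𝔥 →L[ℂ] 𝔥) where
  carrier := {T | ∀ ξ ξ' : α, Commute T (adjoint ξ.1 ∘L ξ'.1)}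
  zero_mem' _ _ := Commute.zero_left _
  add_mem' hS hT ξ ξ' := (hS ξ ξ').add_left (hT ξ ξ')
  smul_mem' c _ hT ξ ξ' := (hT ξ ξ').smul_left c

theorem commute_adjoint {T : 𝔥 →L[ℂ] 𝔥} {x y : 𝔥 →L[ℂ] H} (h : Commute T (adjoint x ∘L y)) :
    Commute (adjoint T) (adjoint y ∘L x) := by
  have h2 := h.star_star
  rwa [star_eq_adjoint, star_eq_adjoint, adjoint_comp, adjoint_adjoint] at h2

theorem adjoint_mem_gramCommutant {α : Submodule ℂ (𝔥 →L[ℂ] H)} {T : 𝔥 →L[ℂ] 𝔥}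
    (hT : T ∈ gramCommutant α) : adjoint T ∈ gramCommutant α :=
  fun ξ ξ' => commute_adjoint (hT ξ' ξ)

/-- For fixed `A`, the condition `TAx = AxT` is linear and closed in `x`, so it passes from `S` to
its closed span. This treats the right-hand entry of the Gram operator; taking adjoints exchanges
the two entries and treats the other. -/
theorem mem_gramCommutant_cspan {S : Set (𝔥 →L[ℂ] H)} {T : 𝔥 →L[ℂ] 𝔥}
    (hT : ∀ s ∈ S, ∀ t ∈ S, Commute T (adjoint s ∘L t)) : T ∈ gramCommutant (cspan S) := by
  have key : ∀ (T : 𝔥 →L[ℂ] 𝔥) (A : H →L[ℂ] 𝔥), (∀ s ∈ S, Commute T (A ∘L s)) →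
      ∀ x ∈ cspan S, Commute T (A ∘L x) := by
    intro T A h x hx
    let Φ : (𝔥 →L[ℂ] H) →L[ℂ] (𝔥 →L[ℂ] 𝔥) :=
      compL ℂ 𝔥 𝔥 𝔥 T ∘L compL ℂ 𝔥 H 𝔥 A - (compL ℂ 𝔥 𝔥 𝔥).flip T ∘L compL ℂ 𝔥 H 𝔥 A
    have hle : cspan S ≤ LinearMap.ker Φ.toLinearMap :=
      cspan_le Φ.isClosed_ker fun s hs => sub_eq_zero.mpr (h s hs)
    exact sub_eq_zero.mp (hle hx)
  have h1 : ∀ s ∈ S, ∀ x ∈ cspan S, Commute (adjoint T) (adjoint s ∘L x) := fun s hs =>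
    key _ _ fun t ht => commute_adjoint (hT t ht s hs)
  intro x y
  refine key T (adjoint x.1) (fun s hs => ?_) y.1 y.2
  simpa using commute_adjoint (h1 s hs x.1 x.2)

/-- The estimate on finite sums survives extension by density. It makes `ρ_α` continuous, which is
what moving `ρ_α` through closed spans requires. -/
theorem norm_rho_le {α : Submodule ℂ (𝔥 →L[ℂ] H)} (hα : IsTotal α) {T : 𝔥 →L[ℂ] 𝔥}
    (hT : T ∈ gramCommutant α) : ‖rho α T‖ ≤ ‖T‖ := by
  refine LinearMap.opNorm_extendOfNorm_le ?_ (norm_nonneg T) fun c => ?_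
  · have : Set.range (Finsupp.linearCombination ℂ fun p : α × 𝔥 => p.1.1 p.2) =
        (Submodule.span ℂ (Set.range fun p : α × 𝔥 => p.1.1 p.2) : Set H) := by
      rw [← Finsupp.range_linearCombination]; rfl
    rw [DenseRange, this]
    exact Submodule.dense_iff_topologicalClosure_eq_top.mpr hα
  · simp only [Finsupp.linearCombination_apply]
    exact norm_sum_le α T hT c

theorem rho_comp {α : Submodule ℂ (𝔥 →L[ℂ] H)} (hα : IsTotal α) {T : 𝔥 →L[ℂ] 𝔥}
    (hT : T ∈ gramCommutant α) (ξ : α) : rho α T ∘L ξ.1 = ξ.1 ∘L T :=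
  ContinuousLinearMap.ext fun ζ => rho_apply hα hT ξ ζ

theorem rho_adjoint {α : Submodule ℂ (𝔥 →L[ℂ] H)} (hα : IsTotal α) {T : 𝔥 →L[ℂ] 𝔥}
    (hT : T ∈ gramCommutant α) : adjoint (rho α T) = rho α (adjoint T) := by
  refine eq_of_total hα fun p => eq_of_inner_total hα fun q => ?_
  rw [rho_apply hα (adjoint_mem_gramCommutant hT), adjoint_inner_left, rho_apply hα hT]
  have h := commute_apply (hT p.1 q.1) q.2
  simp only [comp_apply] at h
  rw [← adjoint_inner_right, ← h, ← adjoint_inner_left, adjoint_inner_right]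

/-- `ρ_α` as a bounded linear map. -/
noncomputable def rhoL {α : Submodule ℂ (𝔥 →L[ℂ] H)} (hα : IsTotal α) :
    gramCommutant α →L[ℂ] (H →L[ℂ] H) :=
  LinearMap.mkContinuous
    { toFun := fun T => rho α T.1
      map_add' := fun S T => eq_of_total hα fun p => by
        rw [_root_.add_apply, rho_apply hα (S + T).2, rho_apply hα S.2, rho_apply hα T.2]
        simp
      map_smul' := fun c T => eq_of_total hα fun p => by
        rw [RingHom.id_apply, _root_.smul_apply, rho_apply hα (c • T).2, rho_apply hα T.2]
        simp }
    1 fun T => by simpa using norm_rho_le hα T.2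

/-- Both sides send `ξζ` to `VξTζ`. Each mapping relation of a pseudo-multiplicative unitary thus
becomes an intertwining relation for the associated representations. -/
theorem comp_rho {α : Submodule ℂ (𝔥 →L[ℂ] H)} {γ : Submodule ℂ (𝔥 →L[ℂ] K)}
    (hα : IsTotal α) (hγ : IsTotal γ) {T : 𝔥 →L[ℂ] 𝔥} (hT : T ∈ gramCommutant α)
    (hT' : T ∈ gramCommutant γ) {V : H →L[ℂ] K} (hV : ∀ ξ : α, V ∘L ξ.1 ∈ γ) :
    V ∘L rho α T = rho γ T ∘L V := by
  refine eq_of_total hα fun p => ?_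
  rw [comp_apply, comp_apply, rho_apply hα hT]
  exact (rho_apply hγ hT' ⟨_, hV p.1⟩ p.2).symm

/-- `α` and `β` act totally and have commuting Gram operators. -/
structure TensorPair (α : Submodule ℂ (𝔥 →L[ℂ] H)) (β : Submodule ℂ (𝔥 →L[ℂ] K)) : Prop where
  left : IsTotal α
  right : IsTotal β
  gram : GramCommute α β

variable {α : Submodule ℂ (𝔥 →L[ℂ] H)} {β : Submodule ℂ (𝔥 →L[ℂ] K)}
  {γ : Submodule ℂ (𝔥 →L[ℂ] L)} {δ : Submodule ℂ (𝔥 →L[ℂ] M)}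

theorem TensorPair.symm (p : TensorPair α β) : TensorPair β α := ⟨p.right, p.left, p.gram.symm⟩

theorem IsFactorization.tensorPair {b : CStarBase 𝔥} (hα : IsFactorization b α)
    (hβ : IsFactorization b.op β) : TensorPair α β :=
  ⟨hα.isTotal, hβ.isTotal, hα.gramCommute hβ⟩

theorem TensorPair.gram_left (p : TensorPair α β) (η η' : β) :
    adjoint η.1 ∘L η'.1 ∈ gramCommutant α :=
  fun ξ ξ' => (p.gram _ ξ.2 _ ξ'.2 _ η.2 _ η'.2).symm

theorem TensorPair.gram_right (p : TensorPair α β) (ξ ξ' : α) :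
    adjoint ξ.1 ∘L ξ'.1 ∈ gramCommutant β :=
  p.symm.gram_left ξ ξ'

theorem TensorPair.adjoint_ket1_ket1 (p : TensorPair α β) (ξ ξ' : α) :
    adjoint (ket1 α β ξ) ∘L ket1 α β ξ' = rho β (adjoint ξ.1 ∘L ξ'.1) :=
  ContinuousLinearMap.ext fun v => RelTensor.adjoint_ket1_ket1 p.right p.gram ξ ξ' v

theorem TensorPair.adjoint_ket2_ket2 (p : TensorPair α β) (η η' : β) :
    adjoint (ket2 α β η) ∘L ket2 α β η' = rho α (adjoint η.1 ∘L η'.1) :=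
  ContinuousLinearMap.ext fun v => RelTensor.adjoint_ket2_ket2 p.left p.gram η η' v

/-- `|η⟩₂ ξ = |ξ⟩₁ η`. -/
theorem TensorPair.ket2_comp (p : TensorPair α β) (ξ : α) (η : β) :
    ket2 α β η ∘L ξ.1 = ket1 α β ξ ∘L η.1 :=
  ContinuousLinearMap.ext fun ζ => by
    rw [comp_apply, comp_apply, ket2_apply p.left p.gram, ket1_apply p.right p.gram]

/-- `⟨η|₂ |ξ⟩₁ = ξ η*`. -/
theorem TensorPair.adjoint_ket2_ket1 (p : TensorPair α β) (ξ : α) (η : β) :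
    adjoint (ket2 α β η) ∘L ket1 α β ξ = ξ.1 ∘L adjoint η.1 := by
  refine eq_of_total p.right fun q => ?_
  have h1 := DFunLike.congr_fun (p.ket2_comp ξ q.1) q.2
  have h2 := DFunLike.congr_fun (p.adjoint_ket2_ket2 η q.1) (ξ.1 q.2)
  simp only [comp_apply] at h1 h2 ⊢
  rw [← h1, h2, RelTensor.rho_apply p.left (p.gram_left η q.1), comp_apply]

/-- `η ↦ |η⟩₂` as a bounded linear map. -/
noncomputable def TensorPair.ket2L (p : TensorPair α β) : β →L[ℂ] (H →L[ℂ] RTP α β) :=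
  LinearMap.mkContinuous
    { toFun := fun η => ket2 α β η
      -- On generators `|η⟩₂ξζ = |ξ⟩₁ηζ`, and the right side is visibly linear in `η`.
      map_add' := fun η η' => eq_of_total p.left fun q => by
        rw [_root_.add_apply, ket2_apply p.left p.gram, ket2_apply p.left p.gram,
          ket2_apply p.left p.gram, ← ket1_apply p.right p.gram, ← ket1_apply p.right p.gram,
          ← ket1_apply p.right p.gram, ← map_add]
        rfl
      map_smul' := fun c η => eq_of_total p.left fun q => by
        rw [RingHom.id_apply, _root_.smul_apply, ket2_apply p.left p.gram,
          ket2_apply p.left p.gram, ← ket1_apply p.right p.gram, ← ket1_apply p.right p.gram,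
          ← map_smul]
        rfl }
    -- Contractivity: `‖|η⟩₂‖² = ‖ρ_α(η*η)‖ ≤ ‖η*η‖ = ‖η‖²`.
    1 fun η => by
      rw [one_mul]
      refine le_of_sq_le_sq ?_ (norm_nonneg _)
      calc _ = ‖rho α (adjoint η.1 ∘L η.1)‖ := by
            rw [← p.adjoint_ket2_ket2, norm_adjoint_comp_self, sq]; rfl
        _ ≤ ‖adjoint η.1 ∘L η.1‖ := norm_rho_le p.left (p.gram_left η η)
        _ = _ := by rw [norm_adjoint_comp_self, sq]; rfl

theorem TensorPair.flipOp_comp_ket1 (p : TensorPair α β) (ξ : α) :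
    flipOp α β ∘L ket1 α β ξ = ket2 β α ξ := by
  refine eq_of_total p.right fun q => ?_
  rw [comp_apply, ket1_apply p.right p.gram, flipOp_apply p.gram,
    ket2_apply p.right p.gram.symm]

theorem TensorPair.flipOp_comp_ket2 (p : TensorPair α β) (η : β) :
    flipOp α β ∘L ket2 α β η = ket1 β α η := by
  refine eq_of_total p.left fun q => ?_
  rw [comp_apply, ket2_apply p.left p.gram, flipOp_apply p.gram,
    ket1_apply p.left p.gram.symm]

theorem TensorPair.flipOp_isometry (p : TensorPair α β) :
    adjoint (flipOp α β) ∘L flipOp α β = .id ℂ (RTP α β) := by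
  refine adjoint_comp_self_of_total (total_tmul α β) fun x y => ?_
  rw [flipOp_apply p.gram, flipOp_apply p.gram, inner_tmul _ _ p.gram, inner_tmul _ _ p.gram.symm]
  congr 1
  exact (commute_apply (p.gram _ x.1.2 _ y.1.2 _ x.2.2.2 _ y.2.2.2) y.2.1).symm

section TensorMap
variable {S : H →L[ℂ] L} {T : K →L[ℂ] M}

theorem tensorMap_comp_ket1 (p : TensorPair α β) (q : TensorPair γ δ)
    (hS : adjoint S ∘L S = .id ℂ H) (hT : adjoint T ∘L T = .id ℂ K)
    (hSγ : ∀ ξ : α, S ∘L ξ.1 ∈ γ) (hTδ : ∀ η : β, T ∘L η.1 ∈ δ) (ξ : α) :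
    tensorMap α β γ δ S T ∘L ket1 α β ξ = ket1 γ δ ⟨_, hSγ ξ⟩ ∘L T := by
  refine eq_of_total p.right fun x => ?_
  rw [comp_apply, ket1_apply p.right p.gram, tensorMap_apply p.gram q.gram S T hS hT hSγ hTδ,
    ← ket1_apply q.right q.gram]
  rfl

theorem tensorMap_comp_ket2 (p : TensorPair α β) (q : TensorPair γ δ)
    (hS : adjoint S ∘L S = .id ℂ H) (hT : adjoint T ∘L T = .id ℂ K)
    (hSγ : ∀ ξ : α, S ∘L ξ.1 ∈ γ) (hTδ : ∀ η : β, T ∘L η.1 ∈ δ) (η : β) :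
    tensorMap α β γ δ S T ∘L ket2 α β η = ket2 γ δ ⟨_, hTδ η⟩ ∘L S := by
  refine eq_of_total p.left fun x => ?_
  rw [comp_apply, ket2_apply p.left p.gram, tensorMap_apply p.gram q.gram S T hS hT hSγ hTδ,
    ← ket2_apply q.left q.gram]
  rfl

theorem tensorMap_isometry (p : TensorPair α β) (q : TensorPair γ δ)
    (hS : adjoint S ∘L S = .id ℂ H) (hT : adjoint T ∘L T = .id ℂ K)
    (hSγ : ∀ ξ : α, S ∘L ξ.1 ∈ γ) (hTδ : ∀ η : β, T ∘L η.1 ∈ δ) :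
    adjoint (tensorMap α β γ δ S T) ∘L tensorMap α β γ δ S T = .id ℂ (RTP α β) := by
  refine adjoint_comp_self_of_total (total_tmul α β) fun x y => ?_
  rw [tensorMap_apply p.gram q.gram S T hS hT hSγ hTδ,
    tensorMap_apply p.gram q.gram S T hS hT hSγ hTδ, inner_tmul _ _ p.gram, inner_tmul _ _ q.gram]
  have h1 : ∀ x, adjoint S (S x) = x := DFunLike.congr_fun hS
  have h2 : ∀ x, adjoint T (T x) = x := DFunLike.congr_fun hT
  simp [adjoint_comp, h1, h2]

end TensorMap

/-! ### Operators on the second factor -/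

/-- `{|ξ⟩₁ | ξ ∈ α}`, as a closed space of operators `K → H ⊗ K`. -/
noncomputable def ket1Space (α : Submodule ℂ (𝔥 →L[ℂ] H)) (β : Submodule ℂ (𝔥 →L[ℂ] K)) :
    Submodule ℂ (K →L[ℂ] RTP α β) :=
  cspan (Set.range (ket1 α β))

theorem ket1_mem (α : Submodule ℂ (𝔥 →L[ℂ] H)) (β : Submodule ℂ (𝔥 →L[ℂ] K)) (ξ : α) :
    ket1 α β ξ ∈ ket1Space α β := subset_cspan _ ⟨ξ, rfl⟩

theorem TensorPair.isTotal_ket1Space (p : TensorPair α β) : IsTotal (ket1Space α β) := by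
  rw [IsTotal, eq_top_iff, ← total_ket1 p.right p.gram]
  refine Submodule.topologicalClosure_mono (Submodule.span_mono ?_)
  rintro _ ⟨q, rfl⟩
  exact ⟨(⟨_, ket1_mem α β q.1⟩, q.2), rfl⟩

/-- Treating the kets `|ξ⟩₁` as a space of operators out of `K`, its representation sends `k` to the
operator `|ξ⟩₁v ↦ |ξ⟩₁kv`, which is the amplification `1 ⊗ k`. Since `⟨ξ|₁|ξ'⟩₁ = ρ_β(ξ*ξ')`, the
amplification is available once `k` commutes with these operators. -/
theorem TensorPair.mem_gramCommutant_ket1Space (p : TensorPair α β) {k : K →L[ℂ] K}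
    (hk : ∀ ξ ξ' : α, Commute k (rho β (adjoint ξ.1 ∘L ξ'.1))) :
    k ∈ gramCommutant (ket1Space α β) := by
  refine mem_gramCommutant_cspan ?_
  rintro _ ⟨ξ, rfl⟩ _ ⟨ξ', rfl⟩
  rw [p.adjoint_ket1_ket1]
  exact hk ξ ξ'

end Kets

/-! ### Threefold relative tensor products. -/

section Iterated
variable {𝔥 𝔨 H K L : Type*}
  [NormedAddCommGroup 𝔥] [InnerProductSpace ℂ 𝔥] [CompleteSpace 𝔥]
  [NormedAddCommGroup 𝔨] [InnerProductSpace ℂ 𝔨] [CompleteSpace 𝔨]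
  [NormedAddCommGroup H] [InnerProductSpace ℂ H] [CompleteSpace H]
  [NormedAddCommGroup K] [InnerProductSpace ℂ K] [CompleteSpace K]
  [NormedAddCommGroup L] [InnerProductSpace ℂ L] [CompleteSpace L]
  {b : CStarBase 𝔥} {c : CStarBase 𝔨}

/-- The Gram operators of `α ▷ γ = [|α⟩₁γ]` are limits of sums of `x*ρ_β(ξ*ξ')y` with `x, y ∈ γ`.
Compatibility puts `ρ_β(ξ*ξ')y` back in `γ`, so they lie in the first algebra of `c` and commute
with those of `δ`. -/
theorem tensorPair_factR_left {α : Submodule ℂ (𝔥 →L[ℂ] H)}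
    {β : Submodule ℂ (𝔥 →L[ℂ] K)} {γ : Submodule ℂ (𝔨 →L[ℂ] K)} {δ : Submodule ℂ (𝔨 →L[ℂ] L)}
    (hα : IsFactorization b α) (hβ : IsFactorization b.op β) (hγ : IsFactorization c γ)
    (hδ : IsFactorization c.op δ) (h : Compatible b.op c β γ) :
    TensorPair (factR α β γ) δ where
  left := isTotal_factR hβ.isTotal hγ.isTotal (hα.gramCommute hβ)
  right := hδ.isTotal
  gram := fun _ hx _ hy z hz w hw =>
    c.commute _ (factR_gram_mem hα hβ hγ h hx hy) _ (hδ.gram_mem ⟨z, hz⟩ ⟨w, hw⟩)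

theorem tensorPair_factL_left {α : Submodule ℂ (𝔥 →L[ℂ] H)}
    {β : Submodule ℂ (𝔥 →L[ℂ] K)} {γ : Submodule ℂ (𝔨 →L[ℂ] H)} {δ : Submodule ℂ (𝔨 →L[ℂ] L)}
    (hα : IsFactorization b α) (hβ : IsFactorization b.op β) (hγ : IsFactorization c γ)
    (hδ : IsFactorization c.op δ) (h : Compatible b c α γ) :
    TensorPair (factL α β γ) δ where
  left := isTotal_factL hα.isTotal hγ.isTotal (hα.gramCommute hβ)
  right := hδ.isTotal
  gram := fun _ hx _ hy z hz w hw =>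
    c.commute _ (factL_gram_mem hα hβ hγ h hx hy) _ (hδ.gram_mem ⟨z, hz⟩ ⟨w, hw⟩)

theorem tensorPair_factL_right {α : Submodule ℂ (𝔥 →L[ℂ] H)}
    {β : Submodule ℂ (𝔥 →L[ℂ] K)} {γ : Submodule ℂ (𝔨 →L[ℂ] K)} {δ : Submodule ℂ (𝔨 →L[ℂ] L)}
    (hα : IsFactorization b α) (hβ : IsFactorization b.op β) (hγ : IsFactorization c γ)
    (hδ : IsFactorization c.op δ) (h : Compatible b.op c β γ) :
    TensorPair α (factL γ δ β) :=
  (tensorPair_factL_left (b := c) (c := b.op) hγ hδ hβ hα h.symm).symm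

theorem tensorPair_factR_right {α : Submodule ℂ (𝔥 →L[ℂ] H)}
    {β : Submodule ℂ (𝔥 →L[ℂ] K)} {γ : Submodule ℂ (𝔨 →L[ℂ] K)} {δ : Submodule ℂ (𝔨 →L[ℂ] L)}
    (hα : IsFactorization b α) (hβ : IsFactorization b.op β) (hγ : IsFactorization c γ)
    (hδ : IsFactorization c.op δ) (h : Compatible b.op c β γ) :
    TensorPair δ (factR α β γ) :=
  (tensorPair_factR_left hα hβ hγ hδ h).symm

/-- The inner products of `|η⟩₂|ξ⟩₁v` and of `|ξ⟩₁|η⟩₂v` are given by `ρ_β(ξ*ξ')` and `ρ_γ(η*η')`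
composed in opposite orders, and these commute because `β` and `γ` are compatible. The isometry
property suffices for the pentagon slices: adjoints of associativity maps are either cancelled
against the maps themselves or evaluated on kets. -/
theorem assocOp_isometry {α : Submodule ℂ (𝔥 →L[ℂ] H)}
    {β : Submodule ℂ (𝔥 →L[ℂ] K)} {γ : Submodule ℂ (𝔨 →L[ℂ] K)} {δ : Submodule ℂ (𝔨 →L[ℂ] L)}
    (hα : IsFactorization b α) (hβ : IsFactorization b.op β) (hγ : IsFactorization c γ)
    (hδ : IsFactorization c.op δ) (h : Compatible b.op c β γ) :
    adjoint (assocOp α β γ δ) ∘L assocOp α β γ δ = .id ℂ (RTP (factR α β γ) δ) := by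
  have hαβ := hα.gramCommute hβ
  have hγδ := hγ.gramCommute hδ
  have p1 := tensorPair_factR_left hα hβ hγ hδ h
  have p2 := tensorPair_factL_right hα hβ hγ hδ h
  refine adjoint_comp_self_of_total
    (f := fun p : α × K × δ => ket2 (factR α β γ) δ p.2.2 (ket1 α β p.1 p.2.1)) ?_ fun p q => ?_
  · rw [eq_top_iff, ← total_ket2 p1.left p1.gram]
    refine Submodule.topologicalClosure_minimal _ (Submodule.span_le.mpr ?_)
      (Submodule.isClosed_topologicalClosure _)
    rintro _ ⟨p, rfl⟩
    refine mem_of_total (total_ket1 hβ.isTotal hαβ) (ket2 (factR α β γ) δ p.1) _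
      (Submodule.isClosed_topologicalClosure _) (fun q => ?_) _
    exact Submodule.le_topologicalClosure _ (Submodule.subset_span ⟨(q.1, q.2, p.1), rfl⟩)
  · rw [assocOp_apply hα hβ hγ hδ h, assocOp_apply hα hβ hγ hδ h,
      ← adjoint_inner_right, adjoint_ket1_ket1 p2.right p2.gram,
      rho_factL hγ.isTotal hβ.isTotal hγδ (p2.gram_right p.1 q.1)
        (fun x y => hαβ _ p.1.2 _ q.1.2 _ x.2 _ y.2),
      ← adjoint_inner_right, adjoint_ket2_ket2 hγ.isTotal hγδ,
      ← adjoint_inner_right (ket2 (factR α β γ) δ p.2.2), adjoint_ket2_ket2 p1.left p1.gram,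
      rho_factR hβ.isTotal hγ.isTotal hαβ (p1.gram_left p.2.2 q.2.2)
        (fun x y => (hγδ _ x.2 _ y.2 _ p.2.2.2 _ q.2.2.2).symm),
      ← adjoint_inner_right, adjoint_ket1_ket1 hβ.isTotal hαβ]
    congr 1
    exact (h.rho_comm hγ (hα.gram_mem p.1 q.1) (hδ.gram_mem p.2.2 q.2.2) _).symm

/-- As for the associativity map, the two inner products differ by the order of the commuting
operators `ρ_α(ξ*ξ')` and `ρ_γ(η*η')`. -/
theorem flip23_isometry {α : Submodule ℂ (𝔥 →L[ℂ] H)}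
    {β : Submodule ℂ (𝔥 →L[ℂ] K)} {γ : Submodule ℂ (𝔨 →L[ℂ] H)} {δ : Submodule ℂ (𝔨 →L[ℂ] L)}
    (hα : IsFactorization b α) (hβ : IsFactorization b.op β) (hγ : IsFactorization c γ)
    (hδ : IsFactorization c.op δ) (h : Compatible b c α γ) :
    adjoint (flip23 α β γ δ) ∘L flip23 α β γ δ = .id ℂ (RTP (factL α β γ) δ) := by
  have hαβ := hα.gramCommute hβ
  have hγδ := hγ.gramCommute hδ
  have p1 := tensorPair_factL_left hα hβ hγ hδ h
  have p2 := tensorPair_factL_left hγ hδ hα hβ h.symm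
  refine adjoint_comp_self_of_total
    (f := fun p : β × H × δ => ket2 (factL α β γ) δ p.2.2 (ket2 α β p.1 p.2.1)) ?_ fun p q => ?_
  · rw [eq_top_iff, ← total_ket2 p1.left p1.gram]
    refine Submodule.topologicalClosure_minimal _ (Submodule.span_le.mpr ?_)
      (Submodule.isClosed_topologicalClosure _)
    rintro _ ⟨p, rfl⟩
    refine mem_of_total (total_ket2 hα.isTotal hαβ) (ket2 (factL α β γ) δ p.1) _
      (Submodule.isClosed_topologicalClosure _) (fun q => ?_) _
    exact Submodule.le_topologicalClosure _ (Submodule.subset_span ⟨(q.1, q.2, p.1), rfl⟩)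
  · rw [flip23_apply hα hβ hγ hδ h, flip23_apply hα hβ hγ hδ h,
      ← adjoint_inner_right, adjoint_ket2_ket2 p2.left p2.gram,
      rho_factL hγ.isTotal hα.isTotal hγδ (p2.gram_left p.1 q.1)
        (fun x y => (hαβ _ x.2 _ y.2 _ p.1.2 _ q.1.2).symm),
      ← adjoint_inner_right, adjoint_ket2_ket2 hγ.isTotal hγδ,
      ← adjoint_inner_right (ket2 (factL α β γ) δ p.2.2), adjoint_ket2_ket2 p1.left p1.gram,
      rho_factL hα.isTotal hγ.isTotal hαβ (p1.gram_left p.2.2 q.2.2)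
        (fun x y => (hγδ _ x.2 _ y.2 _ p.2.2.2 _ q.2.2.2).symm),
      ← adjoint_inner_right, adjoint_ket2_ket2 hα.isTotal hαβ]
    congr 1
    exact (h.rho_comm hγ (hβ.gram_mem p.1 q.1) (hδ.gram_mem p.2.2 q.2.2) _).symm

/-- The associativity unitary maps `|ζ⟩₂ |η⟩₂` to `||ζ⟩₂ η⟩₂`. -/
theorem assocOp_comp_ket2_ket2 {α : Submodule ℂ (𝔥 →L[ℂ] H)}
    {β : Submodule ℂ (𝔥 →L[ℂ] K)} {γ : Submodule ℂ (𝔨 →L[ℂ] K)} {δ : Submodule ℂ (𝔨 →L[ℂ] L)}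
    (hα : IsFactorization b α) (hβ : IsFactorization b.op β) (hγ : IsFactorization c γ)
    (hδ : IsFactorization c.op δ) (h : Compatible b.op c β γ) (ζ : δ) (η : β) :
    assocOp α β γ δ ∘L ket2 (factR α β γ) δ ζ ∘L ket2 α β η =
      ket2 α (factL γ δ β) ⟨_, ket2_comp_mem γ δ ζ η⟩ := by
  have p := hα.tensorPair hβ
  have p2 := tensorPair_factL_right hα hβ hγ hδ h
  refine eq_of_total hα.isTotal fun q => ?_
  have h1 := DFunLike.congr_fun (p.ket2_comp q.1 η) q.2
  have h2 := DFunLike.congr_fun (p2.ket2_comp q.1 ⟨_, ket2_comp_mem γ δ ζ η⟩) q.2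
  simp only [comp_apply] at h1 h2 ⊢
  rw [h1, h2, assocOp_apply hα hβ hγ hδ h]

end Iterated

/-! ### Adjoints of intertwining relations. -/

section Intertwining
variable {E E' F F' : Type*}
  [NormedAddCommGroup E] [InnerProductSpace ℂ E] [CompleteSpace E]
  [NormedAddCommGroup E'] [InnerProductSpace ℂ E'] [CompleteSpace E']
  [NormedAddCommGroup F] [InnerProductSpace ℂ F] [CompleteSpace F]
  [NormedAddCommGroup F'] [InnerProductSpace ℂ F'] [CompleteSpace F']

/-- If `A xᵢ = yᵢ B` for a total family `x`, and `B` intertwines the Gram operators of the two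
families, then `A* yᵢ = xᵢ B*`. -/
theorem adjoint_comp_of_comp_eq {ι : Type*} {x : ι → F →L[ℂ] E} {y : ι → F' →L[ℂ] E'}
    {A : E →L[ℂ] E'} {B : F →L[ℂ] F'}
    (hx : (Submodule.span ℂ (Set.range fun p : ι × F => x p.1 p.2)).topologicalClosure = ⊤)
    (hA : ∀ i v, A (x i v) = y i (B v))
    (hB : ∀ i j v, adjoint (y i) (y j (B v)) = B (adjoint (x i) (x j v))) (i : ι) (w : F') :
    adjoint A (y i w) = x i (adjoint B w) := by
  refine eq_of_inner_total hx fun p => ?_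
  rw [adjoint_inner_left, hA, ← adjoint_inner_right, hB, ← adjoint_inner_left,
    adjoint_inner_right]

end Intertwining

/-! ### Slices of the pentagon equation. -/

section Pentagon
variable {𝔥 H : Type*}
  [NormedAddCommGroup 𝔥] [InnerProductSpace ℂ 𝔥] [CompleteSpace 𝔥]
  [NormedAddCommGroup H] [InnerProductSpace ℂ H] [CompleteSpace H]
  {b : CStarBase 𝔥} {α β βh : Submodule ℂ (𝔥 →L[ℂ] H)} {V : RTP βh α →L[ℂ] RTP α β}

theorem id_isometry : adjoint (ContinuousLinearMap.id ℂ H) ∘L .id ℂ H = .id ℂ H := by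
  rw [comp_id]; exact star_one (H →L[ℂ] H)

/-- If `W k = k' V`, with `W` an isometry and `V V* = 1`, then `W* k' = k V*`. -/
theorem adjoint_comp_of_comp_unitary {E F : Type*}
    [NormedAddCommGroup E] [InnerProductSpace ℂ E] [CompleteSpace E]
    [NormedAddCommGroup F] [InnerProductSpace ℂ F] [CompleteSpace F]
    {V : E →L[ℂ] F} (hV : V ∘L adjoint V = .id ℂ F) {G G' : Type*}
    [NormedAddCommGroup G] [InnerProductSpace ℂ G] [CompleteSpace G]
    [NormedAddCommGroup G'] [InnerProductSpace ℂ G'] [CompleteSpace G']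
    {W : G →L[ℂ] G'} (hW : adjoint W ∘L W = .id ℂ G) {k : E →L[ℂ] G} {k' : F →L[ℂ] G'}
    (h : W ∘L k = k' ∘L V) : adjoint W ∘L k' = k ∘L adjoint V := by
  calc adjoint W ∘L k' = adjoint W ∘L (k' ∘L V) ∘L adjoint V := by
        rw [comp_assoc, hV, comp_id]
    _ = k ∘L adjoint V := by rw [← h, comp_assoc, adjoint_comp_cancel hW]

theorem mem_gramCommutant_of_gram_mem {K : Type*} [NormedAddCommGroup K] [InnerProductSpace ℂ K]
    [CompleteSpace K] {γ : Submodule ℂ (𝔥 →L[ℂ] K)}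
    (h : ∀ x ∈ γ, ∀ y ∈ γ, adjoint x ∘L y ∈ b.B) {T : 𝔥 →L[ℂ] 𝔥} (hT : T ∈ b.Bd) :
    T ∈ gramCommutant γ :=
  fun x y => (b.commute _ (h _ x.2 _ y.2) _ hT).symm

theorem IsFactorization.mem_gramCommutant {γ : Submodule ℂ (𝔥 →L[ℂ] H)}
    (h : IsFactorization b γ) {T : 𝔥 →L[ℂ] 𝔥} (hT : T ∈ b.Bd) : T ∈ gramCommutant γ :=
  mem_gramCommutant_of_gram_mem (fun x hx y hy => h.gram_mem ⟨x, hx⟩ ⟨y, hy⟩) hT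

namespace IsPseudoMultiplicativeUnitary

/-- `⟨ξ|₂ V₁₃ = V (1 ⊗ ⟨ξ|₁)`. -/
theorem slice_leg13 (h : IsPseudoMultiplicativeUnitary b α β βh V) (ξ : α) :
    adjoint (ket2 (factL α β βh) α ξ) ∘L adjoint (flip23 α β βh α) ∘L leg13 α β βh V =
      V ∘L adjoint (ket2 (factR βh α β) α ξ) ∘L adjoint (assocOp βh α β α) ∘L
        tensorMap βh (factR α β α) βh (factL β α α) (.id ℂ H) (flipOp α β) := by
  have q1 : TensorPair (factR βh α β) α := tensorPair_factR_left (b := b.op) (c := b.op)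
    h.fact_βh h.fact_α h.fact_β h.fact_α h.compat_α_β
  have q2 : TensorPair (factL α β βh) α := tensorPair_factL_left (c := b.op)
    h.fact_α h.fact_β h.fact_βh h.fact_α h.compat_α_βh
  have e1 : adjoint (tensorMap (factR βh α β) α (factL α β βh) α V (.id ℂ H)) ∘L
      ket2 (factL α β βh) α ξ = ket2 (factR βh α β) α ξ ∘L adjoint V :=
    adjoint_comp_of_comp_unitary h.comp_adjoint
      (tensorMap_isometry (S := V) (T := .id ℂ H) q1 q2 h.adjoint_comp id_isometry
        h.map_β.comp_mem fun η => η.2)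
      (tensorMap_comp_ket2 (S := V) (T := .id ℂ H) q1 q2 h.adjoint_comp id_isometry
        h.map_β.comp_mem (fun η => η.2) ξ)
  -- This reads `⟨ξ|₂(V ⊗ 1) = V⟨ξ|₂`: slicing the last factor commutes with `V` acting on the first
  -- two.
  have e2 := congrArg adjoint e1
  simp only [ContinuousLinearMap.adjoint_comp, adjoint_adjoint] at e2
  rw [leg13, adjoint_comp_cancel (flip23_isometry (c := b.op) h.fact_α h.fact_β h.fact_βh
    h.fact_α h.compat_α_βh), ← comp_assoc, e2, comp_assoc]

/-- `V |ξ⟩₂ ρ_α(T) = ρ(T) V |ξ⟩₂`. -/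
theorem comp_ket2_rho (h : IsPseudoMultiplicativeUnitary b α β βh V) (ξ : α)
    {T : 𝔥 →L[ℂ] 𝔥} (hT : T ∈ b.Bd) :
    V ∘L ket2 βh α ξ ∘L rho α T = rho (factR α β α) T ∘L V ∘L ket2 βh α ξ := by
  have h1 : T ∈ gramCommutant (factL βh α α) := mem_gramCommutant_of_gram_mem
    (fun x hx y hy => factL_gram_mem (b := b.op) h.fact_βh h.fact_α h.fact_α h.compat_α_βh.symm
      hx hy) hT
  have h2 : T ∈ gramCommutant (factR α β α) := mem_gramCommutant_of_gram_mem
    (fun x hx y hy => factR_gram_mem h.fact_α h.fact_β h.fact_α h.compat_α_β.symm hx hy) hT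
  have p1 := h.fact_α.tensorPair h.fact_β
  have p2 := h.fact_α.tensorPair h.fact_βh
  have t1 := isTotal_factL p2.right p2.left p2.gram.symm
  have t2 := isTotal_factR p1.right p1.left p1.gram
  have e1 : ket2 βh α ξ ∘L rho α T = rho (factL βh α α) T ∘L ket2 βh α ξ :=
    ContinuousLinearMap.ext fun v =>
      (rho_factL p2.right p2.left p2.gram.symm h1 (h.fact_α.mem_gramCommutant hT) ξ v).symm
  -- `|ξ⟩₂` intertwines `ρ_α` with the representation of `α ◁ α`, and `V(α ◁ α) = α ▷ α` carries the
  -- latter to that of `α ▷ α`.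
  rw [e1, ← comp_assoc, comp_rho t1 t2 h1 h2 h.map_α.comp_mem, comp_assoc]

theorem rho_comp_ket1 (h : IsPseudoMultiplicativeUnitary b α β βh V) (ξ : α)
    {T : 𝔥 →L[ℂ] 𝔥} (hT : T ∈ b.Bd) :
    rho (factR α β α) T ∘L ket1 α β ξ = ket1 α β ξ ∘L rho α T := by
  have h2 : T ∈ gramCommutant (factR α β α) := mem_gramCommutant_of_gram_mem
    (fun x hx y hy => factR_gram_mem h.fact_α h.fact_β h.fact_α h.compat_α_β.symm hx hy) hT
  have p1 := h.fact_α.tensorPair h.fact_β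
  exact ContinuousLinearMap.ext fun v =>
    rho_factR p1.right p1.left p1.gram h2 (h.fact_α.mem_gramCommutant hT) ξ v

theorem rho_factR_adjoint (h : IsPseudoMultiplicativeUnitary b α β βh V)
    {T : 𝔥 →L[ℂ] 𝔥} (hT : T ∈ b.Bd) :
    adjoint (rho (factR α β α) T) = rho (factR α β α) (adjoint T) := by
  have p1 := h.fact_α.tensorPair h.fact_β
  exact rho_adjoint (isTotal_factR p1.right p1.left p1.gram) (mem_gramCommutant_of_gram_mem
    (fun x hx y hy => factR_gram_mem h.fact_α h.fact_β h.fact_α h.compat_α_β.symm hx hy) hT)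

/-- `⟨ξ|₁ V |ξ'⟩₂` commutes with `ρ_α`. -/
theorem commute_slice_rho (h : IsPseudoMultiplicativeUnitary b α β βh V) (ξ ξ' : α)
    {T : 𝔥 →L[ℂ] 𝔥} (hT : T ∈ b.Bd) :
    Commute (adjoint (ket1 α β ξ) ∘L V ∘L ket2 βh α ξ') (rho α T) := by
  have hT' : adjoint T ∈ b.Bd := star_mem hT
  have e1 := congrArg adjoint (h.rho_comp_ket1 ξ hT')
  rw [ContinuousLinearMap.adjoint_comp, ContinuousLinearMap.adjoint_comp, rho_adjoint h.fact_α.isTotal (h.fact_α.mem_gramCommutant hT'),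
    h.rho_factR_adjoint hT', adjoint_adjoint] at e1
  change (_ ∘L _) ∘L _ = _ ∘L _
  rw [comp_assoc, comp_assoc, h.comp_ket2_rho ξ' hT, ← comp_assoc, e1, comp_assoc]

/-- `⟨ξ|₁ V |ξ'⟩₂` can be amplified to `H ⊗ H`. -/
theorem slice_mem_gramCommutant (h : IsPseudoMultiplicativeUnitary b α β βh V) (ξ ξ' : α) :
    adjoint (ket1 α β ξ) ∘L V ∘L ket2 βh α ξ' ∈ gramCommutant (ket1Space βh α) :=
  (h.fact_α.tensorPair h.fact_βh).symm.mem_gramCommutant_ket1Space fun η η' =>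
    h.commute_slice_rho ξ ξ' (h.fact_βh.gram_mem η η')

/-- `(1 ⊗ ⟨ξ|₁) V₂₃ |ξ'⟩₃ = 1 ⊗ ⟨ξ|₁ V |ξ'⟩₂`. -/
theorem slice_leg23 (h : IsPseudoMultiplicativeUnitary b α β βh V) (ξ ξ' : α) :
    (adjoint (ket2 (factR βh α β) α ξ) ∘L adjoint (assocOp βh α β α) ∘L
        tensorMap βh (factR α β α) βh (factL β α α) (.id ℂ H) (flipOp α β)) ∘L
      tensorMap βh (factL βh α α) βh (factR α β α) (.id ℂ H) V ∘L
      assocOp βh α βh α ∘L ket2 (factR βh α βh) α ξ' =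
    rho (ket1Space βh α) (adjoint (ket1 α β ξ) ∘L V ∘L ket2 βh α ξ') := by
  have p1 := h.fact_α.tensorPair h.fact_β
  have p2 := (h.fact_α.tensorPair h.fact_βh).symm
  have q1 : TensorPair βh (factL βh α α) := tensorPair_factL_right (b := b.op) (c := b.op)
    h.fact_βh h.fact_α h.fact_βh h.fact_α h.compat_α_βh
  have q2 : TensorPair βh (factR α β α) :=
    tensorPair_factR_right h.fact_α h.fact_β h.fact_α h.fact_βh h.compat_α_β.symm
  have q3 : TensorPair βh (factL β α α) := tensorPair_factL_right (b := b.op) (c := b.op)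
    h.fact_βh h.fact_α h.fact_β h.fact_α h.compat_α_β
  have hf : ∀ x : factR α β α, flipOp α β ∘L x.1 ∈ factL β α α := by
    have hle : factR α β α ≤ (factL β α α).comap (compL ℂ 𝔥 _ _ (flipOp α β)).toLinearMap := by
      refine cspan_le ((isClosed_cspan _).preimage (compL ℂ 𝔥 _ _ (flipOp α β)).continuous) ?_
      rintro _ ⟨_, ⟨ξ, rfl⟩, x, hx, rfl⟩
      refine subset_cspan _ ⟨_, ⟨ξ, rfl⟩, x, hx, ?_⟩
      change _ = flipOp α β ∘L ket1 α β ξ ∘L x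
      rw [← comp_assoc, p1.flipOp_comp_ket1]
    exact fun x => hle x.2
  -- Up to associativity, `⟨ξ|₂` on the triple product is `1 ⊗ ⟨ξ|₂`. Evaluating the adjoint on the
  -- kets `|η⟩₁w` avoids any appeal to surjectivity of the associativity map.
  have e0 : ∀ (η : βh) (w : RTP β α),
      adjoint (assocOp βh α β α ∘L ket2 (factR βh α β) α ξ) (ket1 βh (factL β α α) η w) =
        ket1 βh α η (adjoint (ket2 β α ξ) w) := by
    refine adjoint_comp_of_comp_eq (total_ket1 p2.right p2.gram)
      (fun η v => assocOp_apply (b := b.op) (c := b.op)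
        h.fact_βh h.fact_α h.fact_β h.fact_α h.compat_α_β η v ξ) fun η η' v => ?_
    rw [RelTensor.adjoint_ket1_ket1 q3.right q3.gram, RelTensor.adjoint_ket1_ket1 p2.right p2.gram]
    exact rho_factL p1.right p1.left p1.gram.symm (q3.gram_right η η') (p2.gram_right η η') ξ v
  have e1 : ∀ η v, tensorMap βh (factR α β α) βh (factL β α α) (.id ℂ H) (flipOp α β)
      (ket1 βh (factR α β α) η v) = ket1 βh (factL β α α) η (flipOp α β v) := fun η =>
    DFunLike.congr_fun (tensorMap_comp_ket1 (S := .id ℂ H) q2 q3 id_isometry p1.flipOp_isometry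
      (fun η => η.2) hf η)
  have e2 : ∀ η v, tensorMap βh (factL βh α α) βh (factR α β α) (.id ℂ H) V
      (ket1 βh (factL βh α α) η v) = ket1 βh (factR α β α) η (V v) := fun η =>
    DFunLike.congr_fun (tensorMap_comp_ket1 (S := .id ℂ H) q1 q2 id_isometry h.adjoint_comp
      (fun η => η.2) h.map_α.comp_mem η)
  have e3 : adjoint (ket2 β α ξ) ∘L flipOp α β = adjoint (ket1 α β ξ) := by
    rw [← p1.flipOp_comp_ket1, ContinuousLinearMap.adjoint_comp, comp_assoc, p1.flipOp_isometry, comp_id]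
  refine eq_of_total (total_ket1 p2.right p2.gram) fun p => ?_
  have e4 := rho_apply p2.isTotal_ket1Space (h.slice_mem_gramCommutant ξ ξ')
    ⟨_, ket1_mem βh α p.1⟩ p.2
  have e5 := DFunLike.congr_fun e3 (V (ket2 βh α ξ' p.2))
  have e6 := e0 p.1
  rw [ContinuousLinearMap.adjoint_comp] at e6
  simp only [comp_apply] at e4 e5 e6 ⊢
  rw [e4, assocOp_apply (b := b.op) (c := b.op) h.fact_βh h.fact_α h.fact_βh h.fact_α
    h.compat_α_βh, e2, e1, e6, e5]

/-- `⟨ξ|₂ V₁₂* : H ⊗ (H ⊗ H) → H ⊗ H`, up to the associativity unitary. -/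
noncomputable def sliceShort (α β βh : Submodule ℂ (𝔥 →L[ℂ] H)) (V : RTP βh α →L[ℂ] RTP α β)
    (ξ : α) : RTP α (factL α β β) →L[ℂ] RTP α β :=
  adjoint (ket2 (factL α β βh) α ξ) ∘L adjoint (flip23 α β βh α) ∘L
    adjoint (tensorMap (factL βh α α) β (factR α β α) β V (.id ℂ H)) ∘L
    adjoint (assocOp α β α β)

/-- The pentagon equation, in the form `⟨ξ|₂ V₁₃ V₂₃ V₁₂* |ξ'⟩₃ |η⟩₂ = ⟨ξ|₂ V₁₂* V₂₃ |ξ'⟩₃ |η⟩₂`. -/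
theorem pentagon_slice (h : IsPseudoMultiplicativeUnitary b α β βh V) (ξ ξ' : α) (η : β) :
    V ∘L rho (ket1Space βh α) (adjoint (ket1 α β ξ) ∘L V ∘L ket2 βh α ξ') ∘L adjoint V ∘L
      ket2 α β η = sliceShort α β βh V ξ ∘L ket2 α (factL α β β)
        ⟨_, h.map_β'.comp_mem ⟨_, ket2_comp_mem βh α ξ' η⟩⟩ := by
  have q1 : TensorPair (factR βh α βh) α := tensorPair_factR_left (b := b.op) (c := b.op)
    h.fact_βh h.fact_α h.fact_βh h.fact_α h.compat_α_βh
  have q2 : TensorPair (factR α β βh) α := tensorPair_factR_left (c := b.op)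
    h.fact_α h.fact_β h.fact_βh h.fact_α h.compat_β_βh
  have q3 : TensorPair α (factL βh α β) := tensorPair_factL_right (c := b.op)
    h.fact_α h.fact_β h.fact_βh h.fact_α h.compat_β_βh
  have q4 : TensorPair α (factL α β β) := tensorPair_factL_right
    h.fact_α h.fact_β h.fact_α h.fact_β h.compat_α_β.symm
  have q5 : TensorPair (factL βh α α) β := tensorPair_factL_left (b := b.op) (c := b)
    h.fact_βh h.fact_α h.fact_α h.fact_β h.compat_α_βh.symm
  have q6 : TensorPair (factR α β α) β := tensorPair_factR_left
    h.fact_α h.fact_β h.fact_α h.fact_β h.compat_α_β.symm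
  have e1 : tensorMap (factR βh α βh) α (factR α β βh) α V (.id ℂ H) ∘L
      ket2 (factR βh α βh) α ξ' = ket2 (factR α β βh) α ξ' ∘L V :=
    tensorMap_comp_ket2 (S := V) (T := .id ℂ H) q1 q2 h.adjoint_comp id_isometry
      h.map_βh.comp_mem (fun η => η.2) ξ'
  have e2 := assocOp_comp_ket2_ket2 (c := b.op) h.fact_α h.fact_β h.fact_βh h.fact_α
    h.compat_β_βh ξ' η
  have e3 : tensorMap α (factL βh α β) α (factL α β β) (.id ℂ H) V ∘L
      ket2 α (factL βh α β) ⟨_, ket2_comp_mem βh α ξ' η⟩ = ket2 α (factL α β β)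
        ⟨_, h.map_β'.comp_mem ⟨_, ket2_comp_mem βh α ξ' η⟩⟩ :=
    tensorMap_comp_ket2 (S := .id ℂ H) q3 q4 id_isometry h.adjoint_comp
      (fun η => η.2) h.map_β'.comp_mem _
  -- `V₁₂` passes through `|ξ'⟩₃` and cancels `V*`, leaving `V₂₃|ξ'⟩₃|η⟩₂`, which is the ket of
  -- `V|ξ'⟩₂η`.
  have e4 : pentagonShort α β βh V ∘L ket2 (factR βh α βh) α ξ' ∘L adjoint V ∘L ket2 α β η =
      ket2 α (factL α β β) ⟨_, h.map_β'.comp_mem ⟨_, ket2_comp_mem βh α ξ' η⟩⟩ := by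
    rw [← e3, ← e2, pentagonShort]
    ext v
    have f1 := fun w => DFunLike.congr_fun e1 w
    have f2 := fun w => DFunLike.congr_fun h.comp_adjoint w
    simp only [comp_apply, id_apply] at f1 f2 ⊢
    rw [f1, f2]
  have i1 := assocOp_isometry h.fact_α h.fact_β h.fact_α h.fact_β h.compat_α_β.symm
  have i2 := tensorMap_isometry (S := V) (T := .id ℂ H) q5 q6 h.adjoint_comp id_isometry
    h.map_α.comp_mem fun η => η.2
  have e5 := h.slice_leg13 ξ
  have e6 := h.slice_leg23 ξ ξ'
  -- With the long side of the pentagon inserted, the adjoints in `sliceShort` cancel its outermost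
  -- `V₁₂` and associativity map. What remains is `⟨ξ|₂V₁₃V₂₃|ξ'⟩₃`, which the two preceding slice
  -- formulas evaluate.
  rw [← e4, ← h.pentagon, ← e6, pentagonLong, sliceShort]
  ext v
  have f1 := fun w => DFunLike.congr_fun i1 w
  have f2 := fun w => DFunLike.congr_fun i2 w
  have f3 := fun w => DFunLike.congr_fun e5 w
  simp only [comp_apply, id_apply] at f1 f2 f3 ⊢
  rw [f1, f2, f3]

/-- The ket of `|η⟩₂η'` is `|η⟩₃|η'⟩₂`. The operator `V₁₂*` does not touch the third leg, so `|η⟩₃`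
moves to its left. Slicing out the middle leg by `⟨ξ|₂` then leaves `|η⟩` as the new second leg. -/
theorem sliceShort_comp_ket2 (h : IsPseudoMultiplicativeUnitary b α β βh V) (ξ : α) (η η' : β) :
    sliceShort α β βh V ξ ∘L ket2 α (factL α β β) ⟨_, ket2_comp_mem α β η η'⟩ =
      ket2 α β η ∘L adjoint (ket2 βh α ξ) ∘L adjoint V ∘L ket2 α β η' := by
  have p1 := h.fact_α.tensorPair h.fact_β
  have p2 := (h.fact_α.tensorPair h.fact_βh).symm
  have q5 : TensorPair (factL βh α α) β := tensorPair_factL_left (b := b.op) (c := b)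
    h.fact_βh h.fact_α h.fact_α h.fact_β h.compat_α_βh.symm
  have q6 : TensorPair (factR α β α) β := tensorPair_factR_left
    h.fact_α h.fact_β h.fact_α h.fact_β h.compat_α_β.symm
  have e1 := assocOp_comp_ket2_ket2 h.fact_α h.fact_β h.fact_α h.fact_β h.compat_α_β.symm η η'
  have i1 := assocOp_isometry h.fact_α h.fact_β h.fact_α h.fact_β h.compat_α_β.symm
  have e2 : adjoint (tensorMap (factL βh α α) β (factR α β α) β V (.id ℂ H)) ∘L
      ket2 (factR α β α) β η = ket2 (factL βh α α) β η ∘L adjoint V :=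
    adjoint_comp_of_comp_unitary h.comp_adjoint
      (tensorMap_isometry (S := V) (T := .id ℂ H) q5 q6 h.adjoint_comp id_isometry
        h.map_α.comp_mem fun η => η.2)
      (tensorMap_comp_ket2 (S := V) (T := .id ℂ H) q5 q6 h.adjoint_comp id_isometry
        h.map_α.comp_mem (fun η => η.2) η)
  have e3 : ∀ (η : β) (w : RTP βh α),
      adjoint (flip23 α β βh α ∘L ket2 (factL α β βh) α ξ) (ket2 (factL βh α α) β η w) =
        ket2 α β η (adjoint (ket2 βh α ξ) w) := by
    refine adjoint_comp_of_comp_eq (total_ket2 p1.left p1.gram)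
      (fun η v => flip23_apply (c := b.op) h.fact_α h.fact_β h.fact_βh h.fact_α
        h.compat_α_βh η v ξ) fun η η' v => ?_
    rw [RelTensor.adjoint_ket2_ket2 q5.left q5.gram, RelTensor.adjoint_ket2_ket2 p1.left p1.gram]
    exact rho_factL p2.left p2.right p2.gram (q5.gram_left η η') (p1.gram_left η η') ξ v
  rw [← e1, sliceShort]
  ext v
  have f1 := fun w => DFunLike.congr_fun i1 w
  have f2 := fun w => DFunLike.congr_fun e2 w
  rw [ContinuousLinearMap.adjoint_comp] at e3
  simp only [comp_apply, id_apply] at e3 f1 f2 ⊢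
  rw [f1, f2, e3]

end IsPseudoMultiplicativeUnitary
end Pentagon

/-! ### Regularity and self-adjointness of `Â(V)`. -/

section Legs
variable {𝔥 H K : Type*}
  [NormedAddCommGroup 𝔥] [InnerProductSpace ℂ 𝔥] [CompleteSpace 𝔥]
  [NormedAddCommGroup H] [InnerProductSpace ℂ H] [CompleteSpace H]
  [NormedAddCommGroup K] [InnerProductSpace ℂ K] [CompleteSpace K]
  {b : CStarBase 𝔥}

/-- `ρ_γ` is bounded and linear on the commutant of the Gram operators, where both sets lie. It is
used for `ρ_α` on `𝔅†` and for the amplification `k ↦ 1 ⊗ k`. -/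
theorem cspan_rho_image_congr {γ : Submodule ℂ (𝔥 →L[ℂ] H)} (hγ : IsTotal γ)
    {S T : Set (𝔥 →L[ℂ] 𝔥)} (hS : S ⊆ gramCommutant γ) (hT : T ⊆ gramCommutant γ)
    (h : cspan S = cspan T) : cspan (rho γ '' S) = cspan (rho γ '' T) := by
  have key : ∀ S T : Set (𝔥 →L[ℂ] 𝔥), S ⊆ gramCommutant γ → T ⊆ gramCommutant γ →
      cspan S = cspan T → cspan (rho γ '' S) ≤ cspan (rho γ '' T) := by
    intro S T hS hT h
    refine cspan_le_cspan ?_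
    rintro _ ⟨s, hs, rfl⟩
    have hs' : s ∈ cspan T := h ▸ subset_cspan S hs
    exact map_mem_of_mem_cspan (rhoL hγ) (W := cspan (rho γ '' T)) (isClosed_cspan _)
      (fun t ht => ⟨hT ht, subset_cspan _ ⟨t, ht, rfl⟩⟩) hs' (hS hs)
  exact le_antisymm (key _ _ hS hT h) (key _ _ hT hS h.symm)

/-- `[⟨β|₂ |β⟩₂] = [ρ_α(𝔅†)]`. -/
theorem cspan_adjoint_ket2_ket2 {α : Submodule ℂ (𝔥 →L[ℂ] H)} {β : Submodule ℂ (𝔥 →L[ℂ] K)}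
    (hα : IsFactorization b α) (hβ : IsFactorization b.op β) :
    cspan (opAdj (Set.range (ket2 α β)) ⬝ Set.range (ket2 α β)) =
      cspan (rho α '' (b.Bd : Set (𝔥 →L[ℂ] 𝔥))) := by
  have p := hα.tensorPair hβ
  have h1 : opAdj (Set.range (ket2 α β)) ⬝ Set.range (ket2 α β) =
      rho α '' (opAdj (β : Set (𝔥 →L[ℂ] K)) ⬝ (β : Set (𝔥 →L[ℂ] K))) := by
    ext x
    constructor
    · rintro ⟨_, ⟨_, ⟨η, rfl⟩, rfl⟩, _, ⟨η', rfl⟩, rfl⟩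
      exact ⟨_, ⟨_, ⟨_, η.2, rfl⟩, _, η'.2, rfl⟩, (p.adjoint_ket2_ket2 η η').symm⟩
    · rintro ⟨_, ⟨_, ⟨η, hη, rfl⟩, η', hη', rfl⟩, rfl⟩
      exact ⟨_, ⟨_, ⟨⟨η, hη⟩, rfl⟩, rfl⟩, _, ⟨⟨η', hη'⟩, rfl⟩,
        p.adjoint_ket2_ket2 ⟨η, hη⟩ ⟨η', hη'⟩⟩
  have h2 : cspan (opAdj (β : Set (𝔥 →L[ℂ] K)) ⬝ (β : Set (𝔥 →L[ℂ] K))) =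
      cspan (b.Bd : Set (𝔥 →L[ℂ] 𝔥)) := by
    have h3 : (cspan (opAdj (β : Set (𝔥 →L[ℂ] K)) ⬝ (β : Set (𝔥 →L[ℂ] K))) : Set (𝔥 →L[ℂ] 𝔥)) =
        b.Bd := hβ.gram
    rw [← h3, cspan_cspan]
  rw [h1]
  refine cspan_rho_image_congr hα.isTotal ?_ (fun T hT => hα.mem_gramCommutant hT) h2
  rintro _ ⟨_, ⟨η, hη, rfl⟩, η', hη', rfl⟩
  exact p.gram_left ⟨η, hη⟩ ⟨η', hη'⟩

variable {α β βh : Submodule ℂ (𝔥 →L[ℂ] H)} {V : RTP βh α →L[ℂ] RTP α β}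

theorem legAhat_eq (α β βh : Submodule ℂ (𝔥 →L[ℂ] H)) (V : RTP βh α →L[ℂ] RTP α β) :
    legAhat α β βh V =
      cspan (opAdj (Set.range (ket2 α β)) ⬝ ({V} ⬝ Set.range (ket2 βh α))) := by
  refine congrArg cspan (Set.ext fun T => ⟨?_, ?_⟩)
  · rintro ⟨η, ξ, rfl⟩
    exact ⟨_, ⟨_, ⟨η, rfl⟩, rfl⟩, _, ⟨_, rfl, _, ⟨ξ, rfl⟩, rfl⟩, rfl⟩
  · rintro ⟨_, ⟨_, ⟨η, rfl⟩, rfl⟩, _, ⟨_, rfl, _, ⟨ξ, rfl⟩, rfl⟩, rfl⟩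
    exact ⟨η, ξ, rfl⟩

theorem legA_eq (α β βh : Submodule ℂ (𝔥 →L[ℂ] H)) (V : RTP βh α →L[ℂ] RTP α β) :
    legA α β βh V =
      cspan (opAdj (Set.range (ket1 α β)) ⬝ ({V} ⬝ Set.range (ket1 βh α))) := by
  refine congrArg cspan (Set.ext fun T => ⟨?_, ?_⟩)
  · rintro ⟨η, ξ, rfl⟩
    exact ⟨_, ⟨_, ⟨η, rfl⟩, rfl⟩, _, ⟨_, rfl, _, ⟨ξ, rfl⟩, rfl⟩, rfl⟩
  · rintro ⟨_, ⟨_, ⟨η, rfl⟩, rfl⟩, _, ⟨_, rfl, _, ⟨ξ, rfl⟩, rfl⟩, rfl⟩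
    exact ⟨η, ξ, rfl⟩

theorem IsRegular.cspan_eq (h : IsRegular α β βh V) :
    cspan (opAdj (Set.range (ket1 α β)) ⬝ ({V} ⬝ Set.range (ket2 βh α))) =
      cspan ((α : Set (𝔥 →L[ℂ] H)) ⬝ opAdj (α : Set (𝔥 →L[ℂ] H))) := by
  rw [← h]
  refine congrArg cspan (Set.ext fun T => ⟨?_, ?_⟩)
  · rintro ⟨_, ⟨_, ⟨η, rfl⟩, rfl⟩, _, ⟨_, rfl, _, ⟨ξ, rfl⟩, rfl⟩, rfl⟩
    exact ⟨η, ξ, rfl⟩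
  · rintro ⟨η, ξ, rfl⟩
    exact ⟨_, ⟨_, ⟨η, rfl⟩, rfl⟩, _, ⟨_, rfl, _, ⟨ξ, rfl⟩, rfl⟩, rfl⟩

namespace IsPseudoMultiplicativeUnitary

/-- `[V (1 ⊗ α α*) V* |β⟩₂] = [|β⟩₂ ⟨α|₂ V* |β⟩₂]`, with `1 ⊗ α α* = |α⟩₂ ⟨α|₂`. -/
theorem cspan_comp_ket2_adjoint_leg (h : IsPseudoMultiplicativeUnitary b α β βh V)
    (hr : IsRegular α β βh V) :
    cspan ({V} ⬝ (Set.range (ket2 βh α) ⬝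
        (opAdj (Set.range (ket2 βh α)) ⬝ ({adjoint V} ⬝ Set.range (ket2 α β))))) =
      cspan (Set.range (ket2 α β) ⬝
        (opAdj (Set.range (ket2 βh α)) ⬝ ({adjoint V} ⬝ Set.range (ket2 α β)))) := by
  have p := h.fact_α.tensorPair h.fact_β
  have p2 := (h.fact_α.tensorPair h.fact_βh).symm
  have q : TensorPair α (factL α β β) := tensorPair_factL_right
    h.fact_α h.fact_β h.fact_α h.fact_β h.compat_α_β.symm
  let R := {k : H →L[ℂ] H | ∃ ξ ξ' : α, k = adjoint (ket1 α β ξ) ∘L V ∘L ket2 βh α ξ'}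
  -- `ξξ'*` commutes with `ρ_α(T)` because `ρ_α(T)ξ = ξT` and `ξ'*ρ_α(T) = Tξ'*`, so `1 ⊗ ξξ'*`
  -- makes sense.
  have hkk : ∀ ξ ξ' : α, ξ.1 ∘L adjoint ξ'.1 ∈ gramCommutant (ket1Space βh α) := by
    intro ξ ξ'
    refine p2.mem_gramCommutant_ket1Space fun η η' => ?_
    have hT := p2.gram_right η η'
    generalize adjoint η.1 ∘L η'.1 = T at hT ⊢
    change (_ ∘L _) ∘L _ = _ ∘L _
    rw [← comp_assoc, rho_comp h.fact_α.isTotal hT, comp_assoc, comp_assoc]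
    congr 1
    have e := congrArg adjoint
      (rho_comp h.fact_α.isTotal (adjoint_mem_gramCommutant hT) ξ')
    rwa [ContinuousLinearMap.adjoint_comp, ContinuousLinearMap.adjoint_comp,
      rho_adjoint h.fact_α.isTotal (adjoint_mem_gramCommutant hT), adjoint_adjoint] at e
  -- The identity is `1 ⊗ ξξ'* = |ξ⟩₂⟨ξ'|₂`; on `|η⟩₁v` both sides give `|η⟩₁ξξ'*v`.
  have h1 : rho (ket1Space βh α) '' ((α : Set (𝔥 →L[ℂ] H)) ⬝ opAdj (α : Set (𝔥 →L[ℂ] H))) =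
      Set.range (ket2 βh α) ⬝ opAdj (Set.range (ket2 βh α)) := by
    have e : ∀ ξ ξ' : α, rho (ket1Space βh α) (ξ.1 ∘L adjoint ξ'.1) =
        ket2 βh α ξ ∘L adjoint (ket2 βh α ξ') := by
      intro ξ ξ'
      refine eq_of_total (total_ket1 p2.right p2.gram) fun x => ?_
      have e1 := rho_apply p2.isTotal_ket1Space (hkk ξ ξ') ⟨_, ket1_mem βh α x.1⟩ x.2
      have e2 := DFunLike.congr_fun (p2.adjoint_ket2_ket1 x.1 ξ') x.2
      have e3 := DFunLike.congr_fun (p2.ket2_comp x.1 ξ) (adjoint ξ'.1 x.2)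
      simp only [comp_apply] at e1 e2 e3 ⊢
      rw [e1, e2, e3]
    ext x
    constructor
    · rintro ⟨_, ⟨ξ, hξ, _, ⟨ξ', hξ', rfl⟩, rfl⟩, rfl⟩
      exact ⟨_, ⟨⟨ξ, hξ⟩, rfl⟩, _, ⟨_, ⟨⟨ξ', hξ'⟩, rfl⟩, rfl⟩, (e ⟨ξ, hξ⟩ ⟨ξ', hξ'⟩).symm⟩
    · rintro ⟨_, ⟨ξ, rfl⟩, _, ⟨_, ⟨ξ', rfl⟩, rfl⟩, rfl⟩
      exact ⟨_, ⟨_, ξ.2, _, ⟨_, ξ'.2, rfl⟩, rfl⟩, e ξ ξ'⟩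
  -- Regularity, amplified to the second factor.
  have h2 : cspan (Set.range (ket2 βh α) ⬝ opAdj (Set.range (ket2 βh α))) =
      cspan (rho (ket1Space βh α) '' R) := by
    rw [← h1]
    refine cspan_rho_image_congr p2.isTotal_ket1Space ?_ ?_ hr.symm
    · rintro _ ⟨ξ, hξ, _, ⟨ξ', hξ', rfl⟩, rfl⟩
      exact hkk ⟨ξ, hξ⟩ ⟨ξ', hξ'⟩
    · rintro _ ⟨ξ, ξ', rfl⟩
      exact h.slice_mem_gramCommutant ξ ξ'
  rw [← opMul_assoc (Set.range (ket2 βh α)),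
    cspan_opMul_congr_right {V} (cspan_opMul_congr_left _ h2)]
  have h3 : cspan ({V} ⬝ (Set.range (ket2 βh α) ⬝ (β : Set (𝔥 →L[ℂ] H)))) = factL α β β := by
    refine (cspan_opMul_congr_right {V} ?_).trans
      (h.map_β'.cspan_eq.trans (cspan_coe (isClosed_cspan _)))
    exact (cspan_cspan _).symm
  -- `X ↦ ⟨ξ|₂V₁₂*|X⟩₂`, bounded and linear on `β ◁ β`. It sends `V|ξ'⟩₂η` to a generator of the
  -- left span and `|η⟩₂η'` to a generator of the right span. Both families span `β ◁ β`, so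
  -- continuity yields the two inclusions.
  let Φ (ξ : α) : factL α β β →L[ℂ] (H →L[ℂ] RTP α β) :=
    compL ℂ H _ _ (sliceShort α β βh V ξ) ∘L q.ket2L
  have hX : {V} ⬝ (rho (ket1Space βh α) '' R ⬝ ({adjoint V} ⬝ Set.range (ket2 α β))) =
      {x | ∃ (ξ ξ' : α) (η : β), x = V ∘L rho (ket1Space βh α)
        (adjoint (ket1 α β ξ) ∘L V ∘L ket2 βh α ξ') ∘L adjoint V ∘L ket2 α β η} := by
    rw [singleton_opMul, singleton_opMul]
    ext x
    constructor
    · rintro ⟨_, ⟨_, ⟨_, ⟨ξ, ξ', rfl⟩, rfl⟩, _, ⟨_, ⟨η, rfl⟩, rfl⟩, rfl⟩, rfl⟩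
      exact ⟨ξ, ξ', η, rfl⟩
    · rintro ⟨ξ, ξ', η, rfl⟩
      exact ⟨_, ⟨_, ⟨_, ⟨ξ, ξ', rfl⟩, rfl⟩, _, ⟨_, ⟨η, rfl⟩, rfl⟩, rfl⟩, rfl⟩
  have hY : Set.range (ket2 α β) ⬝
      (opAdj (Set.range (ket2 βh α)) ⬝ ({adjoint V} ⬝ Set.range (ket2 α β))) =
      {x | ∃ (ξ : α) (η η' : β),
        x = ket2 α β η ∘L adjoint (ket2 βh α ξ) ∘L adjoint V ∘L ket2 α β η'} := by
    rw [singleton_opMul]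
    ext x
    constructor
    · rintro ⟨_, ⟨η, rfl⟩, _, ⟨_, ⟨_, ⟨ξ, rfl⟩, rfl⟩, _, ⟨_, ⟨η', rfl⟩, rfl⟩, rfl⟩, rfl⟩
      exact ⟨ξ, η, η', rfl⟩
    · rintro ⟨ξ, η, η', rfl⟩
      exact ⟨_, ⟨η, rfl⟩, _, ⟨_, ⟨_, ⟨ξ, rfl⟩, rfl⟩, _, ⟨_, ⟨η', rfl⟩, rfl⟩, rfl⟩, rfl⟩
  rw [hX, hY]
  refine le_antisymm (cspan_le_cspan ?_) (cspan_le_cspan ?_)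
  · rintro _ ⟨ξ, ξ', η, rfl⟩
    have hx := h.map_β'.comp_mem ⟨_, ket2_comp_mem βh α ξ' η⟩
    rw [h.pentagon_slice ξ ξ' η]
    refine map_mem_of_mem_cspan (Φ ξ)
      (S := Set.range (ket2 α β) ⬝ (β : Set (𝔥 →L[ℂ] H))) (isClosed_cspan _) ?_ hx hx
    rintro _ ⟨_, ⟨η, rfl⟩, η', hη', rfl⟩
    exact ⟨ket2_comp_mem α β η ⟨η', hη'⟩, subset_cspan _
      ⟨ξ, η, ⟨η', hη'⟩, h.sliceShort_comp_ket2 ξ η ⟨η', hη'⟩⟩⟩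
  · rintro _ ⟨ξ, η, η', rfl⟩
    have hx := ket2_comp_mem α β η η'
    have hx' := hx
    rw [← h3, singleton_opMul] at hx'
    rw [← h.sliceShort_comp_ket2 ξ η η']
    refine map_mem_of_mem_cspan (Φ ξ) (isClosed_cspan _) ?_ hx' hx
    rintro _ ⟨_, ⟨_, ⟨ξ', rfl⟩, η, hη, rfl⟩, rfl⟩
    exact ⟨h.map_β'.comp_mem ⟨_, ket2_comp_mem βh α ξ' ⟨η, hη⟩⟩, subset_cspan _
      ⟨ξ, ξ', ⟨η, hη⟩, (h.pentagon_slice ξ ξ' ⟨η, hη⟩).symm⟩⟩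

/-- `ρ_α(T) ⟨ξ|₂ V* |η⟩₂ = ⟨ξ|₂ V* |ρ_α(T) η⟩₂`. -/
theorem rho_comp_adjoint_leg (h : IsPseudoMultiplicativeUnitary b α β βh V) (ξ : α) (η : β)
    {T : 𝔥 →L[ℂ] 𝔥} (hT : T ∈ b.Bd) :
    rho α T ∘L adjoint (ket2 βh α ξ) ∘L adjoint V ∘L ket2 α β η =
      adjoint (ket2 βh α ξ) ∘L adjoint V ∘L ket2 α β ⟨_, h.compat_α_β.mem_right hT η⟩ := by
  have hT' : adjoint T ∈ b.Bd := star_mem hT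
  have p := h.fact_α.tensorPair h.fact_β
  -- The intertwining relation for `T*`, after adjoints, moves `ρ_α(T)` to the right through
  -- `⟨ξ|₂V*`, where it becomes the representation of `α ▷ α`. On `|η⟩₂` that representation acts
  -- through `η ↦ ρ_α(T)η`.
  have e1 := congrArg adjoint (h.comp_ket2_rho ξ hT')
  simp only [ContinuousLinearMap.adjoint_comp, h.rho_factR_adjoint hT', adjoint_adjoint,
    rho_adjoint h.fact_α.isTotal (h.fact_α.mem_gramCommutant hT')] at e1
  have e2 : rho (factR α β α) T ∘L ket2 α β η =
      ket2 α β ⟨_, h.compat_α_β.mem_right hT η⟩ := by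
    refine eq_of_total p.left fun x => ?_
    have f1 := DFunLike.congr_fun (p.ket2_comp x.1 η) x.2
    have f2 := DFunLike.congr_fun (p.ket2_comp x.1 ⟨_, h.compat_α_β.mem_right hT η⟩) x.2
    have f3 := DFunLike.congr_fun (h.rho_comp_ket1 x.1 hT) (η.1 x.2)
    simp only [comp_apply] at f1 f2 f3 ⊢
    rw [f1, f2, f3]
  calc _ = (rho α T ∘L adjoint (ket2 βh α ξ) ∘L adjoint V) ∘L ket2 α β η := rfl
    _ = _ := by rw [← comp_assoc, e1, ← e2]; rfl

/-- `[ρ_α(𝔅†) ⟨α|₂ V* |β⟩₂] = [⟨α|₂ V* |β⟩₂]`. -/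
theorem cspan_rho_adjoint_leg (h : IsPseudoMultiplicativeUnitary b α β βh V) :
    cspan (rho α '' (b.Bd : Set (𝔥 →L[ℂ] 𝔥)) ⬝
        (opAdj (Set.range (ket2 βh α)) ⬝ ({adjoint V} ⬝ Set.range (ket2 α β)))) =
      cspan (opAdj (Set.range (ket2 βh α)) ⬝ ({adjoint V} ⬝ Set.range (ket2 α β))) := by
  have p := h.fact_α.tensorPair h.fact_β
  refine le_antisymm (cspan_le_cspan ?_) (cspan_le_cspan ?_)
  · rintro _ ⟨_, ⟨T, hT, rfl⟩, _, ⟨_, ⟨_, ⟨ξ, rfl⟩, rfl⟩, _, ⟨_, rfl, _, ⟨η, rfl⟩, rfl⟩, rfl⟩, rfl⟩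
    refine subset_cspan _ ?_
    change _ ∘L _ ∘L _ ∘L _ ∈ _
    rw [h.rho_comp_adjoint_leg ξ η hT]
    exact ⟨_, ⟨_, ⟨ξ, rfl⟩, rfl⟩, _, ⟨_, rfl, _, ⟨_, rfl⟩, rfl⟩, rfl⟩
  · rintro _ ⟨_, ⟨_, ⟨ξ, rfl⟩, rfl⟩, _, ⟨_, rfl, _, ⟨η, rfl⟩, rfl⟩, rfl⟩
    -- For this inclusion, compatibility makes `η` a limit of sums of elements `ρ_α(T)η'`, and `η ↦
    -- ⟨ξ|₂V*|η⟩₂` is continuous.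
    have hη : η.1 ∈ cspan (rho α '' (b.Bd : Set (𝔥 →L[ℂ] 𝔥)) ⬝ (β : Set (𝔥 →L[ℂ] H))) := by
      rw [h.compat_α_β.1]
      exact η.2
    refine map_mem_of_mem_cspan
      (compL ℂ H _ _ (adjoint (ket2 βh α ξ)) ∘L compL ℂ H _ _ (adjoint V) ∘L p.ket2L)
      (isClosed_cspan _) ?_ hη η.2
    rintro _ ⟨_, ⟨T, hT, rfl⟩, η', hη', rfl⟩
    refine ⟨h.compat_α_β.mem_right hT ⟨η', hη'⟩, subset_cspan _ ?_⟩
    change adjoint (ket2 βh α ξ) ∘L adjoint V ∘L ket2 α β _ ∈ _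
    rw [← h.rho_comp_adjoint_leg ξ ⟨η', hη'⟩ hT]
    exact ⟨_, ⟨T, hT, rfl⟩, _, ⟨_, ⟨_, ⟨ξ, rfl⟩, rfl⟩, _, ⟨_, rfl, _, ⟨_, rfl⟩, rfl⟩, rfl⟩, rfl⟩

/-- If `V` is regular, then `Â(V)` is self-adjoint. -/
theorem cspan_adjoint_leg (h : IsPseudoMultiplicativeUnitary b α β βh V)
    (hr : IsRegular α β βh V) :
    cspan (opAdj (Set.range (ket2 βh α)) ⬝ ({adjoint V} ⬝ Set.range (ket2 α β))) =
      cspan (opAdj (Set.range (ket2 α β)) ⬝ ({V} ⬝ Set.range (ket2 βh α))) := by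
  set A := opAdj (Set.range (ket2 α β)) ⬝ ({V} ⬝ Set.range (ket2 βh α)) with hA
  have hA' : opAdj (Set.range (ket2 βh α)) ⬝ ({adjoint V} ⬝ Set.range (ket2 α β)) = opAdj A := by
    rw [hA, opAdj_opMul, opAdj_opMul, opAdj_opAdj, opAdj_singleton, opMul_assoc]
  -- `[ÂÂ*] = Â*`: absorption removes the inner `V`, leaving `⟨β|₂|β⟩₂ = ρ_α(𝔅†)` up to closed span,
  -- which preserves `Â*`.
  have h1 : cspan (A ⬝ opAdj A) = cspan (opAdj A) := by
    rw [← hA']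
    calc _ = cspan (opAdj (Set.range (ket2 α β)) ⬝ ({V} ⬝ (Set.range (ket2 βh α) ⬝
          (opAdj (Set.range (ket2 βh α)) ⬝ ({adjoint V} ⬝ Set.range (ket2 α β)))))) := by
          rw [hA, opMul_assoc, opMul_assoc]
      _ = cspan (opAdj (Set.range (ket2 α β)) ⬝ Set.range (ket2 α β) ⬝
          (opAdj (Set.range (ket2 βh α)) ⬝ ({adjoint V} ⬝ Set.range (ket2 α β)))) := by
          rw [cspan_opMul_congr_right _ (h.cspan_comp_ket2_adjoint_leg hr), opMul_assoc]
      _ = _ := by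
          rw [cspan_opMul_congr_left _ (cspan_adjoint_ket2_ket2 h.fact_α h.fact_β),
            h.cspan_rho_adjoint_leg]
  -- `ÂÂ*` is invariant under adjoints, so its span equals both `[Â*]` and `[Â]`.
  have h2 := cspan_opAdj_congr h1
  rw [opAdj_opMul, opAdj_opAdj, h1] at h2
  rw [hA', h2]

end IsPseudoMultiplicativeUnitary
end Legs

/-! ### The operator `Σ(1 ⊗ U)` and the consequences of `V̌` and of the cube relation. -/

section KacSystem
variable {𝔥 H : Type*}
  [NormedAddCommGroup 𝔥] [InnerProductSpace ℂ 𝔥] [CompleteSpace 𝔥]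
  [NormedAddCommGroup H] [InnerProductSpace ℂ H] [CompleteSpace H]
  {b : CStarBase 𝔥} {α αh β βh : Submodule ℂ (𝔥 →L[ℂ] H)}
  {U : H →L[ℂ] H} {V : RTP βh α →L[ℂ] RTP α β}

/-- `Σ (1 ⊗ U) : H_α ⊗_β H → H_β̂ ⊗_α H`. -/
noncomputable def flipU (α β βh : Submodule ℂ (𝔥 →L[ℂ] H)) (U : H →L[ℂ] H) :
    RTP α β →L[ℂ] RTP βh α :=
  flipOp α βh ∘L tensorMap α β α βh (.id ℂ H) U

/-- Composition with an isometry can be cancelled. -/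
theorem cspan_eq_of_isometry {E F G : Type*}
    [NormedAddCommGroup E] [InnerProductSpace ℂ E] [CompleteSpace E]
    [NormedAddCommGroup F] [InnerProductSpace ℂ F] [CompleteSpace F]
    [NormedAddCommGroup G] [InnerProductSpace ℂ G] [CompleteSpace G]
    {W : F →L[ℂ] G} (hW : adjoint W ∘L W = .id ℂ F) {S T : Set (E →L[ℂ] F)}
    (h : cspan ({W} ⬝ S) = cspan ({W} ⬝ T)) : cspan S = cspan T := by
  have h2 := cspan_opMul_congr_right {adjoint W} h
  rwa [← opMul_assoc, ← opMul_assoc, singleton_opMul_singleton, hW, one_opMul, one_opMul] at h2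

namespace IsBalanced

theorem isometry_U (h : IsBalanced b α αh β βh U V) : adjoint U ∘L U = .id ℂ H := by
  rw [h.symm_U, h.sq_U]

theorem map_U_αh (h : IsBalanced b α αh β βh U V) : MapsOnto U αh α := by
  rw [MapsOnto, ← h.map_U_α, Set.image_image]
  have : ∀ x : 𝔥 →L[ℂ] H, U ∘L U ∘L x = x := fun x => by rw [← comp_assoc, h.sq_U, id_comp]
  simp [this]

theorem flipU_isometry (h : IsBalanced b α αh β βh U V) :
    adjoint (flipU α β βh U) ∘L flipU α β βh U = .id ℂ (RTP α β) := by
  have p1 := h.fact_α.tensorPair h.fact_β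
  have p2 := h.fact_α.tensorPair h.fact_βh
  rw [flipU, adjoint_comp, comp_assoc, adjoint_comp_cancel p2.flipOp_isometry]
  exact tensorMap_isometry p1 p2 id_isometry h.isometry_U (fun ξ => ξ.2) h.map_U_β.comp_mem

theorem flipU_comp_ket1 (h : IsBalanced b α αh β βh U V) (ξ : α) :
    flipU α β βh U ∘L ket1 α β ξ = ket2 βh α ξ ∘L U := by
  have p1 := h.fact_α.tensorPair h.fact_β
  have p2 := h.fact_α.tensorPair h.fact_βh
  have e : tensorMap α β α βh (.id ℂ H) U ∘L ket1 α β ξ = ket1 α βh ξ ∘L U :=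
    tensorMap_comp_ket1 (S := .id ℂ H) p1 p2 id_isometry h.isometry_U (fun ξ => ξ.2)
      h.map_U_β.comp_mem ξ
  rw [flipU, comp_assoc, e, ← comp_assoc, p2.flipOp_comp_ket1]

theorem flipU_comp_ket2 (h : IsBalanced b α αh β βh U V) (η : β) :
    flipU α β βh U ∘L ket2 α β η = ket1 βh α ⟨_, h.map_U_β.comp_mem η⟩ := by
  have p1 := h.fact_α.tensorPair h.fact_β
  have p2 := h.fact_α.tensorPair h.fact_βh
  have e : tensorMap α β α βh (.id ℂ H) U ∘L ket2 α β η =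
      ket2 α βh ⟨_, h.map_U_β.comp_mem η⟩ ∘L .id ℂ H :=
    tensorMap_comp_ket2 (S := .id ℂ H) p1 p2 id_isometry h.isometry_U (fun ξ => ξ.2)
      h.map_U_β.comp_mem η
  rw [flipU, comp_assoc, e, comp_id, p2.flipOp_comp_ket2]

theorem flipU_opMul_ket1 (h : IsBalanced b α αh β βh U V) :
    {flipU α β βh U} ⬝ Set.range (ket1 α β) = Set.range (ket2 βh α) ⬝ {U} := by
  simp only [opMul, Set.image2_singleton_left, Set.image2_singleton_right, ← Set.range_comp]
  exact congrArg Set.range (funext h.flipU_comp_ket1)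

theorem flipU_opMul_ket2 (h : IsBalanced b α αh β βh U V) :
    {flipU α β βh U} ⬝ Set.range (ket2 α β) = Set.range (ket1 βh α) := by
  rw [singleton_opMul]
  ext x
  constructor
  · rintro ⟨_, ⟨η, rfl⟩, rfl⟩
    exact ⟨_, (h.flipU_comp_ket2 η).symm⟩
  · rintro ⟨⟨η, hη⟩, rfl⟩
    have hη' : η ∈ (βh : Set (𝔥 →L[ℂ] H)) := hη
    rw [← h.map_U_β] at hη'
    obtain ⟨η', hη', rfl⟩ := hη'
    exact ⟨_, ⟨⟨η', hη'⟩, rfl⟩, h.flipU_comp_ket2 ⟨η', hη'⟩⟩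

/-- `(1 ⊗ U)Σ` is the right-hand factor of `V̌`; it sends `|ξ⟩₁` to `|Uξ⟩₂`, and `Uα̂ = α` because
`U² = 1`. -/
theorem flipU_opMul_ket1_hat (h : IsBalanced b α αh β βh U V) :
    {tensorMap βh αh βh α (.id ℂ H) U ∘L flipOp αh βh} ⬝ Set.range (ket1 αh βh) =
      Set.range (ket2 βh α) := by
  have p1 := h.fact_αh.tensorPair h.fact_βh
  have p2 := (h.fact_α.tensorPair h.fact_βh).symm
  have e : ∀ ξ : αh, (tensorMap βh αh βh α (.id ℂ H) U ∘L flipOp αh βh) ∘L ket1 αh βh ξ =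
      ket2 βh α ⟨_, h.map_U_αh.comp_mem ξ⟩ := fun ξ => by
    rw [comp_assoc, p1.flipOp_comp_ket1]
    exact tensorMap_comp_ket2 (S := .id ℂ H) p1.symm p2 id_isometry h.isometry_U (fun ξ => ξ.2)
      h.map_U_αh.comp_mem ξ
  rw [singleton_opMul]
  ext x
  constructor
  · rintro ⟨_, ⟨ξ, rfl⟩, rfl⟩
    exact ⟨_, (e ξ).symm⟩
  · rintro ⟨⟨ξ, hξ⟩, rfl⟩
    have hξ' : ξ ∈ (α : Set (𝔥 →L[ℂ] H)) := hξ
    rw [← h.map_U_αh] at hξ'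
    obtain ⟨ξ', hξ', rfl⟩ := hξ'
    exact ⟨_, ⟨⟨ξ', hξ'⟩, rfl⟩, e ⟨ξ', hξ'⟩⟩

/-- `[V |α⟩₂ α̂] = [|β⟩₂ α̂]`. -/
theorem cspan_comp_ket2_αh (h : IsBalanced b α αh β βh U V) :
    cspan ({V} ⬝ (Set.range (ket2 βh α) ⬝ (αh : Set (𝔥 →L[ℂ] H)))) =
      cspan (Set.range (ket2 α β) ⬝ (αh : Set (𝔥 →L[ℂ] H))) := by
  refine cspan_eq_of_isometry h.flipU_isometry ?_
  -- For the triple `(β̂, α, α̂)` the third mapping relation reads `V̌(α̂ ▷ α̂) = β̂ ▷ α̂`. Writing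
  -- `V̌ = JV(1 ⊗ U)Σ` and cancelling the isometry `J` gives the claim, since `|β̂⟩₁ = J|β⟩₂`.
  have h1 : cspan ({checkOp α αh β βh U V} ⬝
      (Set.range (ket1 αh βh) ⬝ (αh : Set (𝔥 →L[ℂ] H)))) =
      cspan (Set.range (ket1 βh α) ⬝ (αh : Set (𝔥 →L[ℂ] H))) := by
    refine (cspan_opMul_congr_right _ (cspan_cspan _).symm).trans
      (h.pmu_check.map_βh.cspan_eq.trans (cspan_cspan _))
  have h2 : checkOp α αh β βh U V = flipU α β βh U ∘L V ∘L
      (tensorMap βh αh βh α (.id ℂ H) U ∘L flipOp αh βh) := rfl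
  rw [h2, ← singleton_opMul_singleton, ← singleton_opMul_singleton, opMul_assoc, opMul_assoc,
    ← opMul_assoc {tensorMap βh αh βh α (.id ℂ H) U ∘L flipOp αh βh}, h.flipU_opMul_ket1_hat] at h1
  rw [h1, ← opMul_assoc, h.flipU_opMul_ket2]

/-- `[Â(V) α̂] = α̂`. -/
theorem cspan_legAhat_αh (h : IsBalanced b α αh β βh U V) :
    cspan (opAdj (Set.range (ket2 α β)) ⬝ ({V} ⬝ Set.range (ket2 βh α)) ⬝
      (αh : Set (𝔥 →L[ℂ] H))) = cspan (αh : Set (𝔥 →L[ℂ] H)) := by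
  rw [opMul_assoc, opMul_assoc, cspan_opMul_congr_right _ h.cspan_comp_ket2_αh, ← opMul_assoc,
    cspan_opMul_congr_left _ (cspan_adjoint_ket2_ket2 h.fact_α h.fact_β), h.compat_α_αh.1,
    cspan_coe h.fact_αh.isClosed]

end IsBalanced

namespace IsPseudoKacSystem

/-- `[⟨α|₁ V Σ (1 ⊗ U) V |α⟩₂] = [α̂ α̂*]`. -/
theorem cspan_slice_flipU (h : IsPseudoKacSystem b α αh β βh U V) :
    cspan (opAdj (Set.range (ket1 α β)) ⬝ ({V} ⬝ ({flipU α β βh U} ⬝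
        ({V} ⬝ Set.range (ket2 βh α))))) =
      cspan ((αh : Set (𝔥 →L[ℂ] H)) ⬝ opAdj (αh : Set (𝔥 →L[ℂ] H))) := by
  have hb := h.balanced
  set J := flipU α β βh U
  have hJJ : adjoint J ∘L J = .id ℂ _ := hb.flipU_isometry
  have hVV : adjoint V ∘L V = .id ℂ _ := hb.pmu.adjoint_comp
  have hUU := hb.sq_U
  have hcube : J ∘L V ∘L J ∘L V ∘L J ∘L V = .id ℂ _ := by
    have := h.cube
    rw [pow_succ, pow_two] at this
    exact this
  -- Solve `(JV)³ = 1` for `VJVJ`, using `J*J = 1` and `VV* = 1`.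
  have hVJVJ : V ∘L J ∘L V ∘L J = adjoint J ∘L adjoint V := by
    have e1 : V ∘L J ∘L V ∘L J ∘L V = adjoint J := by
      rw [← adjoint_comp_cancel hJJ (V ∘L J ∘L V ∘L J ∘L V), hcube, comp_id]
    calc V ∘L J ∘L V ∘L J = (V ∘L J ∘L V ∘L J ∘L V) ∘L adjoint V := by
          simp only [comp_assoc]
          rw [hb.pmu.comp_adjoint, comp_id]
      _ = _ := by rw [e1]
  have hJK : {J} ⬝ Set.range (ket1 α β) = Set.range (ket2 βh α) ⬝ {U} := hb.flipU_opMul_ket1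
  -- `J|ξ⟩₁ = |ξ⟩₂U` and `U² = 1` give `|ξ⟩₂ = J|ξ⟩₁U`. This supplies the extra `J` needed to form
  -- `VJVJ`.
  have hK : Set.range (ket2 βh α) = {J} ⬝ (Set.range (ket1 α β) ⬝ {U}) := by
    rw [← opMul_assoc, hJK, opMul_assoc, singleton_opMul_singleton, hUU]
    simp [opMul]
  have hKJ : opAdj (Set.range (ket1 α β)) ⬝ {adjoint J} = {U} ⬝ opAdj (Set.range (ket2 βh α)) := by
    have := congrArg opAdj hJK
    rwa [opAdj_opMul, opAdj_opMul, opAdj_singleton, opAdj_singleton, hb.symm_U] at this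
  have hUα : cspan ({U} ⬝ (α : Set (𝔥 →L[ℂ] H))) = cspan (αh : Set (𝔥 →L[ℂ] H)) :=
    hb.map_U_α.cspan_eq
  calc _ = cspan (opAdj (Set.range (ket1 α β)) ⬝ ({V ∘L J ∘L V ∘L J} ⬝
          (Set.range (ket1 α β) ⬝ {U}))) := by
        rw [hK]
        simp only [← singleton_opMul_singleton, opMul_assoc]
    -- `⟨α|₁J* = U⟨α|₂`, so the product becomes `U⟨α|₂V*|α⟩₁U`, the conjugate by `U` of the adjoint
    -- of the regularity set.
    _ = cspan ({U} ⬝ (opAdj (opAdj (Set.range (ket1 α β)) ⬝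
          ({V} ⬝ Set.range (ket2 βh α))) ⬝ {U})) := by
        rw [hVJVJ, ← singleton_opMul_singleton, opMul_assoc, ← opMul_assoc (opAdj _), hKJ]
        simp only [opAdj_opMul, opAdj_opAdj, opAdj_singleton, opMul_assoc]
    _ = cspan ({U} ⬝ (opAdj ((α : Set (𝔥 →L[ℂ] H)) ⬝ opAdj (α : Set (𝔥 →L[ℂ] H))) ⬝ {U})) :=
        cspan_opMul_congr_right _ (cspan_opMul_congr_left _
          (cspan_opAdj_congr h.regular.cspan_eq))
    _ = cspan ({U} ⬝ (α : Set (𝔥 →L[ℂ] H)) ⬝ opAdj ({U} ⬝ (α : Set (𝔥 →L[ℂ] H)))) := by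
        simp only [opAdj_opMul, opAdj_opAdj, opAdj_singleton, opMul_assoc, hb.symm_U]
    _ = _ := (cspan_opMul_congr_left _ hUα).trans
        (cspan_opMul_congr_right _ (cspan_opAdj_congr hUα))

end IsPseudoKacSystem
end KacSystem
end RelTensor

/-! ### The product of the two legs. -/

open RelTensor
theorem mainTheorem4 {𝔥 H : Type*}
    [NormedAddCommGroup 𝔥] [InnerProductSpace ℂ 𝔥] [CompleteSpace 𝔥]
    [NormedAddCommGroup H] [InnerProductSpace ℂ H] [CompleteSpace H]
    (b : CStarBase 𝔥) (α αh β βh : Submodule ℂ (𝔥 →L[ℂ] H))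
    (U : H →L[ℂ] H) (V : RTP βh α →L[ℂ] RTP α β)
    (h : IsPseudoKacSystem b α αh β βh U V) :
    cspan (opMul (legA α β βh V : Set (H →L[ℂ] H)) (legAhat α β βh V)) =
      cspan (opMul (αh : Set (𝔥 →L[ℂ] H)) (opAdj (αh : Set (𝔥 →L[ℂ] H)))) := by
  have hb := h.balanced
  set k1 := Set.range (ket1 α β)
  set k2 := Set.range (ket2 α β)
  set l1 := Set.range (ket1 βh α)
  set l2 := Set.range (ket2 βh α)
  have hs := hb.pmu.cspan_adjoint_leg h.regular
  have hA : opAdj (opMul (opAdj k2) (opMul {V} l2)) =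
      opMul (opAdj l2) (opMul {adjoint V} k2) := by
    rw [opAdj_opMul, opAdj_opMul, opAdj_opAdj, opAdj_singleton, opMul_assoc]
  have hJ : opMul {flipU α β βh U} k2 = l1 := hb.flipU_opMul_ket2
  -- The chain starts from `[α̂α̂*]`: replacing `α̂*` by `(Âα̂)*` creates the factor `Â*` on the
  -- right.
  symm
  calc _ = cspan (opMul (αh : Set (𝔥 →L[ℂ] H)) (opAdj (opMul
          (opMul (opAdj k2) (opMul {V} l2)) (αh : Set (𝔥 →L[ℂ] H))))) :=
        cspan_opMul_congr_right _ (cspan_opAdj_congr hb.cspan_legAhat_αh.symm)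
    _ = cspan (opMul (opMul (αh : Set (𝔥 →L[ℂ] H)) (opAdj (αh : Set (𝔥 →L[ℂ] H))))
          (opMul (opAdj l2) (opMul {adjoint V} k2))) := by
        rw [opAdj_opMul, hA, opMul_assoc]
    -- This expression for `α̂α̂*` ends in `V|α⟩₂`, which now meets the `⟨α|₂V*|β⟩₂` of `Â*`.
    _ = cspan (opMul (opMul (opAdj k1) (opMul {V} (opMul {flipU α β βh U} (opMul {V} l2))))
          (opMul (opAdj l2) (opMul {adjoint V} k2))) :=
        cspan_opMul_congr_left _ h.cspan_slice_flipU.symm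
    _ = cspan (opMul (opAdj k1) (opMul {V} (opMul {flipU α β βh U} (opMul {V} (opMul l2
          (opMul (opAdj l2) (opMul {adjoint V} k2))))))) := by
        simp only [opMul_assoc]
    -- Absorption: `V|α⟩₂` in front of `⟨α|₂V*|β⟩₂` becomes `|β⟩₂`.
    _ = cspan (opMul (opAdj k1) (opMul {V} (opMul {flipU α β βh U} (opMul k2
          (opMul (opAdj l2) (opMul {adjoint V} k2)))))) :=
        cspan_opMul_congr_right _ (cspan_opMul_congr_right _ (cspan_opMul_congr_right _
          (hb.pmu.cspan_comp_ket2_adjoint_leg h.regular)))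
    -- `J|β⟩₂ = |β̂⟩₁` completes `⟨α|₁V|β̂⟩₁`; the other factor is `Â*`, equal to `Â` by
    -- self-adjointness.
    _ = cspan (opMul (opMul (opAdj k1) (opMul {V} l1))
          (opMul (opAdj l2) (opMul {adjoint V} k2))) := by
        rw [← hJ]
        simp only [opMul_assoc]
    _ = cspan (opMul (legA α β βh V : Set (H →L[ℂ] H)) (legAhat α β βh V)) := by
        rw [legA_eq, legAhat_eq]
        exact (cspan_opMul_congr_left _ (cspan_cspan _).symm).trans
          (cspan_opMul_congr_right _ (hs.trans (cspan_cspan _).symm))
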